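/- Let $M$ be a complex surface (complex dimension $2$) with complex structure $J$. Two torsion-free affine connections on $TM$ preserving $J$ are called complex projectively equivalent if they have the same generalised geodesics, i.e. the same smoothly immersed curves $\gamma$ with $\nabla_{\dot\gamma}\dot\gamma\wedge\dot\gamma\wedge J\dot\gamma=0$. Let $[\nabla]$ be an equivalence class of such connections. For local holomorphic coordinates $z=(z^1,z^2)$ on $U\subset M$, let $\Gamma^i_{jk}$ be the complex Christoffel symbols of $\nabla$, defined by $\nabla_{\partial_{z^j}}\partial_{z^k}=\Gamma^i_{jk}\partial_{z^i}$, and put $\Pi^i_{jk}=\Gamma^i_{jk}-\tfrac13(\Gamma^l_{lj}\delta^i_k+\Gamma^l_{lk}\delta^i_j)$ and $\Pi_{ij}=\Pi^k_{il}\Pi^l_{jk}-\partial\Pi^k_{ij}/\partial z^k$ (repeated indices are summed over $1,2$). Let $P\subset\mathrm{PSL}(3,\mathbb C)$ be the stabiliser of $[1,0,0]\in\mathbb{CP}^2$ and let $(\pi:B\to M,\theta)$ be the Cartan geometry of $[\nabla]$: $B$ is a smooth right principal $P$-bundle and $\theta=(\theta^i_j)_{i,j=0,1,2}$ is a Cartan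 connection of type $(\mathrm{PSL}(3,\mathbb C),P)$ on $B$ (a smooth $\mathfrak{sl}(3,\mathbb C)$-valued $1$-form which is an isomorphism on each tangent space of $B$, satisfies $R_p^*\theta=\mathrm{Ad}(p^{-1})\circ\theta$ for $p\in P$, and maps the fundamental vector field of each $X$ in the Lie algebra of $P$ to $X$), such that every local holomorphic coordinate system $z:U\to\mathbb C^2$ has a section $\sigma_z:U\to B$ with $\sigma_z^*\theta^0_0=0$, $\sigma_z^*\theta^i_0=dz^i$, $\sigma_z^*\theta^i_j=\Pi^i_{jk}dz^k$ and $\sigma_z^*\theta^0_i=\Pi_{ik}dz^k$ for $i,j\in\{1,2\}$. A (pseudo-)Kähler metric $g$ on $M$ is called compatible with $[\nabla]$ if its Levi-Civita connection belongs to $[\nabla]$. Let $\varepsilon_{ij}=-\varepsilon_{ji}$ with $\varepsilon_{12}=1$, and let $\alpha\circ\beta=\tfrac12(\alpha\otimes\beta+\beta\otimes\alpha)$. All functions are smooth. (1) Let $g$ be a (pseudo-)Kähler metric on $M$ compatible with $[\nabla]$. Then there are unique complex-valued functions $g_{i\bar\jmath}$ on $B$ with $\pi^*g=g_{i\bar\jmath}\,\theta^i_0\circ\overline{\theta^j_0}$;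 they satisfy $g_{i\bar\jmath}=\overline{g_{j\bar\imath}}$ and $G=g_{1\bar1}g_{2\bar2}-|g_{1\bar2}|^2\neq0$. The functions $h_{i\bar\jmath}=g_{i\bar\jmath}\,G^{-2/3}$, where $G^{-2/3}=|G|^{-2/3}>0$ is the real power, satisfy $$dh_{i\bar\jmath}=h_{i\bar\jmath}\left(\theta^0_0+\overline{\theta^0_0}\right)+h_{i\bar s}\overline{\theta^s_j}+h_{s\bar\jmath}\theta^s_i+h_i\overline{\varepsilon_{sj}\theta^s_0}+\overline{h_j}\,\varepsilon_{si}\theta^s_0\qquad(\ast)$$ for some complex-valued functions $h_1,h_2$ on $B$. (2) Conversely, suppose that there are complex-valued functions $h_{i\bar\jmath}=\overline{h_{j\bar\imath}}$ and $h_i$ on $B$ solving $(\ast)$ with $h_{1\bar1}h_{2\bar2}-|h_{1\bar2}|^2\neq0$ everywhere. Then the symmetric $2$-form $$h_{i\bar\jmath}\left(h_{1\bar1}h_{2\bar2}-|h_{1\bar2}|^2\right)^{-2}\theta^i_0\circ\overline{\theta^j_0}$$ is the $\pi$-pullback of a (pseudo-)Kähler metric on $M$ compatible with $[\nabla]$.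 -/

import Mathlib

open scoped Manifold ContDiff ComplexConjugate
open Bundle

noncomputable section

namespace CProj

/-- The model space `ℂ²` of complex surfaces. -/
abbrev C2 : Type := Fin 2 → ℂ

/-- The real smooth structure underlying a complex surface. -/
instance realManifold (M : Type*) [TopologicalSpace M] [ChartedSpace C2 M]
    [IsManifold 𝓘(ℂ, C2) ω M] : IsManifold 𝓘(ℝ, C2) ω M := by
  refine isManifold_of_contDiffOn _ _ _ fun e e' he he' => ?_
  have h : e.symm ≫ₕ e' ∈ contDiffGroupoid ω 𝓘(ℂ, C2) :=
    HasGroupoid.compatible he he'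
  rw [contDiffGroupoid, mem_groupoid_of_pregroupoid] at h
  exact ContDiffOn.restrict_scalars ℝ h.1

section Surface

variable {M : Type*} [TopologicalSpace M] [ChartedSpace C2 M]

/-- The almost complex structure `J` of the surface, i.e. multiplication by `i` in a holomorphic
chart. (The real tangent space at `x` is identified with `ℂ²` by the preferred chart at `x`.) -/
def J (x : M) : TangentSpace 𝓘(ℝ, C2) x →L[ℝ] TangentSpace 𝓘(ℝ, C2) x :=
  (Complex.I • ContinuousLinearMap.id ℝ C2 : C2 →L[ℝ] C2)

/-- Differentiability at `x` of a vector field. -/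
def DiffFieldAt [IsManifold 𝓘(ℂ, C2) ω M]
    (X : ∀ x : M, TangentSpace 𝓘(ℝ, C2) x) (x : M) : Prop :=
  MDifferentiableAt 𝓘(ℝ, C2) (𝓘(ℝ, C2).prod 𝓘(ℝ, C2))
    (fun y => TotalSpace.mk' C2 (E := fun y : M => TangentSpace 𝓘(ℝ, C2) y) y (X y)) x

/-! ### Complex-linear torsion-free connections -/

/-- A smooth torsion-free affine connection `∇` on `TM` with `∇ J = 0`.
Recall that `∇ Y x v` is `∇_v Y`. -/
structure ComplexLinearConnection (M : Type*) [TopologicalSpace M] [ChartedSpace C2 M]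
    [IsManifold 𝓘(ℂ, C2) ω M] where
  nabla : CovariantDerivative 𝓘(ℝ, C2) C2 (TangentSpace 𝓘(ℝ, C2) : M → Type)
  smooth : CovariantDerivative.ContMDiffCovariantDerivative nabla ∞
  torsionFree : nabla.torsion = 0
  complexLinear : ∀ (Y : ∀ x : M, TangentSpace 𝓘(ℝ, C2) x) (x : M), DiffFieldAt Y x →
    ∀ v : TangentSpace 𝓘(ℝ, C2) x, nabla (fun y => J y (Y y)) x v = J x (nabla Y x v)

variable [IsManifold 𝓘(ℂ, C2) ω M]

/-- The local vector field which in the coordinates `z` is constant equal to `u`. For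
`u = Pi.single k 1` it is `∂/∂x^k`, where `z^k = x^k + i y^k`. -/
def coordField (z : OpenPartialHomeomorph M C2) (u : C2) : ∀ x : M, TangentSpace 𝓘(ℝ, C2) x :=
  VectorField.mpullback 𝓘(ℝ, C2) 𝓘(ℝ, C2) z (fun _ => u)

/-- The value `dz (∇_u v)` at `x`, for `u`, `v` constant vector fields in the coordinates `z`. -/
def christoffelVec (D : ComplexLinearConnection M) (z : OpenPartialHomeomorph M C2) (x : M)
    (u v : C2) : C2 :=
  mfderiv 𝓘(ℝ, C2) 𝓘(ℝ, C2) z x (D.nabla (coordField z v) x (coordField z u x))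

/-- The complex Christoffel symbols `Γ^i_{jk}`, given by
`∇_{∂/∂z^j} ∂/∂z^k = Γ^i_{jk} ∂/∂z^i`. As `∇` is complex-linear and torsion-free, `Γ^i_{jk}` is also
the value of `dz^i` on the real vector `∇_{∂/∂x^j} ∂/∂x^k`. -/
def christoffel (D : ComplexLinearConnection M) (z : OpenPartialHomeomorph M C2) (x : M)
    (i j k : Fin 2) : ℂ :=
  christoffelVec D z x (Pi.single j 1) (Pi.single k 1) i

/-! ### Generalised geodesics and complex projective equivalence -/

/-- The velocity of a curve. -/
def velocity (γ : ℝ → M) (t : ℝ) : TangentSpace 𝓘(ℝ, C2) (γ t) :=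
  mfderiv 𝓘(ℝ, ℝ) 𝓘(ℝ, C2) γ t (1 : ℝ)

/-- The covariant acceleration `∇_{γ'} γ'`, computed in the preferred chart at `γ t` as
`c'' + Γ(c', c')` where `c` is the coordinate expression of `γ`. -/
def covAccel (D : ComplexLinearConnection M) (γ : ℝ → M) (t : ℝ) : TangentSpace 𝓘(ℝ, C2) (γ t) :=
  let z := chartAt C2 (γ t)
  let c : ℝ → C2 := fun s => z (γ s)
  (mfderiv 𝓘(ℝ, C2) 𝓘(ℝ, C2) z (γ t)).inverse
    (deriv (deriv c) t + christoffelVec D z (γ t) (deriv c t) (deriv c t))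

/-- The restriction of `γ` to the open interval `s` is a generalised geodesic: a smoothly immersed
curve with `∇_{γ'} γ' ∧ γ' ∧ J γ' = 0`, i.e. `∇_{γ'} γ'` in the plane spanned by `γ'`, `J γ'`. -/
def IsGeneralisedGeodesic (D : ComplexLinearConnection M) (γ : ℝ → M) (s : Set ℝ) : Prop :=
  IsOpen s ∧ s.OrdConnected ∧ ContMDiffOn 𝓘(ℝ, ℝ) 𝓘(ℝ, C2) ∞ γ s ∧
    ∀ t ∈ s, velocity γ t ≠ 0 ∧
      ∃ a b : ℝ, covAccel D γ t = a • velocity γ t + b • J (γ t) (velocity γ t)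

/-- Complex projective equivalence: the same generalised geodesics. -/
def CProjEquiv (D D' : ComplexLinearConnection M) : Prop :=
  ∀ (γ : ℝ → M) (s : Set ℝ), IsGeneralisedGeodesic D γ s ↔ IsGeneralisedGeodesic D' γ s

/-! ### The complex projective invariants in holomorphic coordinates -/

/-- The local holomorphic coordinate systems of the surface. -/
def holCharts (M : Type*) [TopologicalSpace M] [ChartedSpace C2 M] :
    Set (OpenPartialHomeomorph M C2) :=
  IsManifold.maximalAtlas 𝓘(ℂ, C2) ω M

/-- `Π^i_{jk} = Γ^i_{jk} - (Γ^l_{lj} δ^i_k + Γ^l_{lk} δ^i_j) / 3`. -/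
def projInv (D : ComplexLinearConnection M) (z : OpenPartialHomeomorph M C2) (x : M)
    (i j k : Fin 2) : ℂ :=
  christoffel D z x i j k -
    (1 / 3) * ((∑ l, christoffel D z x l l j) * (if i = k then 1 else 0) +
      (∑ l, christoffel D z x l l k) * (if i = j then 1 else 0))

/-- The Wirtinger derivative `∂f/∂z^k` of a function on `ℂ²`. -/
def wirtinger (k : Fin 2) (f : C2 → ℂ) (p : C2) : ℂ :=
  (1 / 2) * (fderiv ℝ f p (Pi.single k 1) - Complex.I * fderiv ℝ f p (Pi.single k Complex.I))

/-- `Π_{ij} = Π^k_{il} Π^l_{jk} - ∂Π^k_{ij}/∂z^k`. -/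
def projInv₂ (D : ComplexLinearConnection M) (z : OpenPartialHomeomorph M C2) (x : M)
    (i j : Fin 2) : ℂ :=
  (∑ k, ∑ l, projInv D z x k i l * projInv D z x l j k) -
    ∑ k, wirtinger k (fun p => projInv D z (z.symm p) k i j) (z x)

/-- `dz^k(v)`. -/
def dz (z : OpenPartialHomeomorph M C2) (x : M) (v : TangentSpace 𝓘(ℝ, C2) x) (k : Fin 2) : ℂ :=
  (mfderiv 𝓘(ℝ, C2) 𝓘(ℝ, C2) z x v : C2) k

/-- The matrix `φ` of 1-forms associated to the coordinates `z`: `φ^0_0 = 0`, `φ^i_0 = dz^i`,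
`φ^i_j = Π^i_{jk} dz^k` and `φ^0_i = Π_{ik} dz^k`. -/
def phi (D : ComplexLinearConnection M) (z : OpenPartialHomeomorph M C2) (x : M) (v : TangentSpace 𝓘(ℝ, C2) x) :
    Matrix (Fin 3) (Fin 3) ℂ :=
  Matrix.of (Fin.cons
    (Fin.cons 0 (fun i => ∑ k, projInv₂ D z x i k * dz z x v k))
    (fun i => Fin.cons (dz z x v i) (fun j => ∑ k, projInv D z x i j k * dz z x v k)))

/-! ### Pseudo-Kähler metrics -/

/-- A (pseudo-)Kähler metric: a smooth nondegenerate symmetric bilinear form `g` on `TM`,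
invariant under `J`, whose fundamental 2-form `ω = g(J·, ·)` is closed. -/
structure PseudoKahlerMetric (M : Type*) [TopologicalSpace M] [ChartedSpace C2 M]
    [IsManifold 𝓘(ℂ, C2) ω M] where
  inner : ∀ x : M, TangentSpace 𝓘(ℝ, C2) x →L[ℝ] TangentSpace 𝓘(ℝ, C2) x →L[ℝ] ℝ
  symm : ∀ (x : M) (v w : TangentSpace 𝓘(ℝ, C2) x), inner x v w = inner x w v
  nondegenerate : ∀ (x : M) (v : TangentSpace 𝓘(ℝ, C2) x), (∀ w : TangentSpace 𝓘(ℝ, C2) x, inner x v w = 0) → v = 0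
  smooth : ContMDiff 𝓘(ℝ, C2) (𝓘(ℝ, C2).prod 𝓘(ℝ, C2 →L[ℝ] C2 →L[ℝ] ℝ)) ∞
    (fun x => TotalSpace.mk' (C2 →L[ℝ] C2 →L[ℝ] ℝ)
      (E := fun x : M => TangentSpace 𝓘(ℝ, C2) x →L[ℝ] TangentSpace 𝓘(ℝ, C2) x →L[ℝ] ℝ)
      x (inner x))
  hermitian : ∀ (x : M) (v w : TangentSpace 𝓘(ℝ, C2) x), inner x (J x v) (J x w) = inner x v w
  closed : ∀ (X Y Z : ∀ x : M, TangentSpace 𝓘(ℝ, C2) x) (x : M),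
    DiffFieldAt X x → DiffFieldAt Y x → DiffFieldAt Z x →
    mvfderiv 𝓘(ℝ, C2) (fun y => inner y (J y (Y y)) (Z y)) x (X x)
      + mvfderiv 𝓘(ℝ, C2) (fun y => inner y (J y (Z y)) (X y)) x (Y x)
      + mvfderiv 𝓘(ℝ, C2) (fun y => inner y (J y (X y)) (Y y)) x (Z x)
      - inner x (J x (VectorField.mlieBracket 𝓘(ℝ, C2) X Y x)) (Z x)
      - inner x (J x (VectorField.mlieBracket 𝓘(ℝ, C2) Y Z x)) (X x)
      - inner x (J x (VectorField.mlieBracket 𝓘(ℝ, C2) Z X x)) (Y x) = 0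

/-- `∇ g = 0`; since `∇` is torsion-free, this says that `∇` is the Levi-Civita connection
of `g`. -/
def IsLeviCivita (g : PseudoKahlerMetric M) (D : ComplexLinearConnection M) : Prop :=
  ∀ (X Y : ∀ x : M, TangentSpace 𝓘(ℝ, C2) x) (x : M), DiffFieldAt X x → DiffFieldAt Y x → ∀ v : TangentSpace 𝓘(ℝ, C2) x,
    mvfderiv 𝓘(ℝ, C2) (fun y => g.inner y (X y) (Y y)) x v =
      g.inner x (D.nabla X x v) (Y x) + g.inner x (X x) (D.nabla Y x v)

/-- `g` is compatible with `[∇]`: the Levi-Civita connection of `g` is an element of `[∇]`. -/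
def IsCompatible (g : PseudoKahlerMetric M) (D : ComplexLinearConnection M) : Prop :=
  ∃ D' : ComplexLinearConnection M, IsLeviCivita g D' ∧ CProjEquiv D' D

end Surface

/-! ### The group `P` -/

/-- `PSL(3, ℂ)`. -/
abbrev PSL3 : Type := Matrix.ProjectiveSpecialLinearGroup (Fin 3) ℂ

lemma e0_ne_zero : (Pi.single 0 1 : Fin 3 → ℂ) ≠ 0 := by
  simp

/-- The stabiliser `P ⊂ PSL(3, ℂ)` of the point `[1, 0, 0]` of `ℂℙ²`. -/
def P : Subgroup PSL3 :=
  MulAction.stabilizer PSL3 (Projectivization.mk ℂ (Pi.single 0 1 : Fin 3 → ℂ) e0_ne_zero)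

/-- Pairs `(a, b)` of a `2 × 2`-matrix and a row vector. Those with `det a ≠ 0` parametrise the
threefold covering group of `P` consisting of the matrices `(det a⁻¹, b; 0, a)`. -/
abbrev PParam : Type := (Fin 2 → Fin 2 → ℂ) × (Fin 2 → ℂ)

/-- The block matrix `(c, b; 0, a)`. -/
def blockMat (c : ℂ) (q : PParam) : Matrix (Fin 3) (Fin 3) ℂ :=
  Matrix.of (Fin.cons (Fin.cons c q.2) (fun i => Fin.cons 0 (q.1 i)))

lemma det_blockMat (c : ℂ) (q : PParam) :
    (blockMat c q).det = c * (Matrix.of q.1).det := by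
  have h1 : (1 : Fin 3) = Fin.succ 0 := rfl
  have h2 : (2 : Fin 3) = Fin.succ 1 := rfl
  simp only [blockMat, Matrix.det_fin_three, Matrix.det_fin_two, Matrix.of_apply, h1, h2,
    Fin.cons_zero, Fin.cons_succ]
  ring

/-- The matrix `(det a⁻¹, b; 0, a)` in `SL(3, ℂ)`. -/
def slBlock (q : PParam) (h : (Matrix.of q.1).det ≠ 0) : Matrix.SpecialLinearGroup (Fin 3) ℂ :=
  ⟨blockMat (Matrix.of q.1).det⁻¹ q, by rw [det_blockMat, inv_mul_cancel₀ h]⟩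

lemma slBlock_mem (q : PParam) (h : (Matrix.of q.1).det ≠ 0) : (slBlock q h : PSL3) ∈ P := by
  rw [P, MulAction.mem_stabilizer_iff, Matrix.ProjectiveSpecialLinearGroup.smul_proj_mk,
    Projectivization.smul_mk, Projectivization.mk_eq_mk_iff']
  refine ⟨(Matrix.of q.1).det⁻¹, ?_⟩
  change _ = (blockMat (Matrix.of q.1).det⁻¹ q).mulVec (Pi.single 0 1)
  ext i
  refine Fin.cases ?_ (fun j => ?_) i <;> simp [blockMat]

/-- The element of `P` represented by `(det a⁻¹, b; 0, a)` (and `1` if `det a = 0`). -/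
def toP (q : PParam) : P :=
  if h : (Matrix.of q.1).det ≠ 0 then ⟨(slBlock q h : PSL3), slBlock_mem q h⟩ else 1

/-- The parameters `(1, 0)` of the identity. -/
def idParam : PParam := (fun i j => if i = j then 1 else 0, 0)

/-! ### Cartan geometries of type `(PSL(3, ℂ), P)` -/

section Cartan

variable (M : Type*) [TopologicalSpace M] [ChartedSpace C2 M] [IsManifold 𝓘(ℂ, C2) ω M]
  (F : Type*) [NormedAddCommGroup F] [NormedSpace ℝ F]
  (B : Type*) [TopologicalSpace B] [ChartedSpace F B] [IsManifold 𝓘(ℝ, F) ∞ B]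

/-- A (real) Cartan geometry `(π : B → M, θ)` of type `(PSL(3, ℂ), P)`: a smooth right principal
`P`-bundle with a Cartan connection `θ`, a smooth 1-form on `B` with values in `𝔰𝔩(3, ℂ)`.
Smoothness in the group variable is tested on the covering group of `P`. Together with the other
axioms the smooth local sections amount to local triviality. -/
structure CartanGeometry where
  proj : B → M
  proj_smooth : ContMDiff 𝓘(ℝ, F) 𝓘(ℝ, C2) ∞ proj
  act : B → P → B
  act_one : ∀ b, act b 1 = b
  act_mul : ∀ b p q, act b (p * q) = act (act b p) q
  act_smooth : ContMDiffOn (𝓘(ℝ, F).prod 𝓘(ℝ, PParam)) 𝓘(ℝ, F) ∞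
    (fun y : B × PParam => act y.1 (toP y.2)) {y | (Matrix.of y.2.1).det ≠ 0}
  act_free : ∀ b p, act b p = b → p = 1
  proj_eq_iff : ∀ b b', proj b = proj b' ↔ ∃ p, b' = act b p
  local_section : ∀ x : M, ∃ U : Set M, IsOpen U ∧ x ∈ U ∧ ∃ s : M → B,
    ContMDiffOn 𝓘(ℝ, C2) 𝓘(ℝ, F) ∞ s U ∧ ∀ y ∈ U, proj (s y) = y
  /-- The entries `θ^i_j` of the Cartan connection. -/
  form : Fin 3 → Fin 3 → ∀ b : B, TangentSpace 𝓘(ℝ, F) b →L[ℝ] ℂ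
  form_smooth : ∀ i j, ContMDiff 𝓘(ℝ, F) (𝓘(ℝ, F).prod 𝓘(ℝ, F →L[ℝ] ℂ)) ∞
    (fun b => TotalSpace.mk' (F →L[ℝ] ℂ)
      (E := fun b : B => TangentSpace 𝓘(ℝ, F) b →L[ℝ] ℂ) b (form i j b))
  /-- `θ_b : T_b B → 𝔰𝔩(3, ℂ)` is a linear isomorphism. -/
  form_bijOn : ∀ b : B, Set.BijOn
    (fun v : TangentSpace 𝓘(ℝ, F) b => (Matrix.of fun i j => form i j b v))
    Set.univ {X : Matrix (Fin 3) (Fin 3) ℂ | X.trace = 0}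
  /-- `R_p^* θ = Ad(p⁻¹) ∘ θ`. -/
  equivariant : ∀ (A : Matrix.SpecialLinearGroup (Fin 3) ℂ) (hA : (A : PSL3) ∈ P) (b : B)
    (v : TangentSpace 𝓘(ℝ, F) b),
    (Matrix.of fun i j => form i j (act b ⟨(A : PSL3), hA⟩)
        (mfderiv 𝓘(ℝ, F) 𝓘(ℝ, F) (fun b' => act b' ⟨(A : PSL3), hA⟩) b v)) =
      (A⁻¹ : Matrix.SpecialLinearGroup (Fin 3) ℂ).1 * (Matrix.of fun i j => form i j b v) * A.1
  /-- `θ` maps the fundamental vector field of `X ∈ 𝔭` to `X`; here `X = (-tr a, β; 0, a)` is the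
  tangent vector `(a, β)` of the covering group of `P` at the identity. -/
  fundamental : ∀ (b : B) (q : PParam),
    (Matrix.of fun i j => form i j (act b (toP idParam))
        (mfderiv 𝓘(ℝ, PParam) 𝓘(ℝ, F) (fun q' : PParam => act b (toP q'))
          idParam q)) =
      blockMat (-(Matrix.of q.1).trace) q

variable {M F B}

/-- `(π : B → M, θ)` is the Cartan geometry of `[∇]`: for every local holomorphic coordinate system
`z : U → ℂ²` there is a section `σ_z : U → B` with `σ_z^* θ = φ`. -/
def CartanGeometry.IsCartanGeometryOf (C : CartanGeometry M F B)
    (D : ComplexLinearConnection M) : Prop :=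
  ∀ z ∈ holCharts M, ∃ σ : M → B,
    ContMDiffOn 𝓘(ℝ, C2) 𝓘(ℝ, F) ∞ σ z.source ∧
    ∀ x ∈ z.source, C.proj (σ x) = x ∧ ∀ v : TangentSpace 𝓘(ℝ, C2) x,
      (Matrix.of fun i j => C.form i j (σ x) (mfderiv 𝓘(ℝ, C2) 𝓘(ℝ, F) σ x v)) = phi D z x v

/-! ### The differential system -/

/-- `θ^i_0` for `i = 1, 2` (numbered `0, 1` here). -/
def CartanGeometry.sol (C : CartanGeometry M F B) (i : Fin 2) (b : B)
    (v : TangentSpace 𝓘(ℝ, F) b) : ℂ :=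
  C.form i.succ 0 b v

/-- `π^* g = f_{i\bar j} θ^i_0 ∘ conj θ^j_0`, where `α ∘ β = (α ⊗ β + β ⊗ α) / 2`. -/
def CartanGeometry.IsPullback (C : CartanGeometry M F B) (g : PseudoKahlerMetric M)
    (f : B → Matrix (Fin 2) (Fin 2) ℂ) : Prop :=
  ∀ (b : B) (v w : TangentSpace 𝓘(ℝ, F) b),
    ((g.inner (C.proj b) (mfderiv 𝓘(ℝ, F) 𝓘(ℝ, C2) C.proj b v)
        (mfderiv 𝓘(ℝ, F) 𝓘(ℝ, C2) C.proj b w) : ℝ) : ℂ) =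
      ∑ i, ∑ j, f b i j *
        ((C.sol i b v * conj (C.sol j b w) + C.sol i b w * conj (C.sol j b v)) / 2)

/-- `ε_{ij}`. -/
def eps : Matrix (Fin 2) (Fin 2) ℂ := !![0, 1; -1, 0]

/-- The first-order system
`dh_{i\bar j} = h_{i\bar j} (θ^0_0 + conj θ^0_0) + h_{i\bar s} conj θ^s_j + h_{s\bar j} θ^s_i
  + h_i conj (ε_{sj} θ^s_0) + conj h_j ε_{si} θ^s_0`. -/
def CartanGeometry.SolvesSystem (C : CartanGeometry M F B)
    (h : B → Matrix (Fin 2) (Fin 2) ℂ) (k : B → Fin 2 → ℂ) : Prop :=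
  ∀ (i j : Fin 2) (b : B) (v : TangentSpace 𝓘(ℝ, F) b),
    mvfderiv 𝓘(ℝ, F) (fun b' => h b' i j) b v =
      h b i j * (C.form 0 0 b v + conj (C.form 0 0 b v))
      + ∑ s, h b i s * conj (C.form s.succ j.succ b v)
      + ∑ s, h b s j * C.form s.succ i.succ b v
      + k b i * conj (∑ s, eps s j * C.sol s b v)
      + conj (k b j) * ∑ s, eps s i * C.sol s b v

end Cartan

/-- `m_{1\bar 1} m_{2\bar 2} - |m_{1\bar 2}|²`, a real number for a hermitian matrix `m`. -/
def hermDet (m : Matrix (Fin 2) (Fin 2) ℂ) : ℝ :=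
  (m 0 0 * m 1 1).re - Complex.normSq (m 0 1)

end CProj

end

noncomputable section

set_option linter.unusedSectionVars false

/-! Over a holomorphic chart an adapted section `σ` pulls `θ` back to the explicit form built from
the invariants `Π`. Every tangent vector of the bundle at `σ y` is the sum of a vector tangent to
the section and a fundamental vector (`exists_decomp`), and every point of the bundle is a translate
of a point on an adapted section. A statement on `B` therefore splits into a computation in
coordinates, a check on vertical vectors and an equivariance law under `P`.

Equivariance. Represent an element of `P` by the block matrix `(det a⁻¹, b; 0, a)`. Then `g`
transforms into `|det a|² aᵀ g ā` and `h` into `|det a|⁻² aᵀ h ā`. The rescalings `G^(-2/3)` and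
`(det h)⁻²` are the powers of the determinant that intertwine the two laws (`rescale_gTransl`,
`rescale_hTransl`). The right-hand side of the system follows the law of `h` once `k` follows the
affine law `kTransl` (`sysRHS_transl`). On fundamental vectors the system is the infinitesimal law
of `h`, and `k` drops out.

Coordinates. Let `Γ` have trace `τ_k = Γ^l_{lk}`. Coefficients of a parallel hermitian form satisfy
`dg = Γg + gΓ̄`, so `d log |G|` is twice the real part of `τ`. Hence `h = G^(-2/3) g` satisfies the
parallel equation with the extra term `-(2/3)(τ + τ̄) h`. Substituting `Π` in terms of `Γ` turns the
system into exactly this equation, provided that `k` is the contraction `kappaOf τ h`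
(`sysRHS_kappaOf`). Since `Π` depends only on the class of the connection (`CProjEquiv.projInv_eq`),
the Levi-Civita connection may be used here; this gives the first half.

Converse. Along the vertical directions the system integrates to the equivariance law, because the
covering group of `P` is connected (`solution_law`). So `(det h)⁻² h` descends to a form on the
surface. Nondegeneracy allows `k = kappaOf τ h` to be solved for `τ`. The projective change of the
given connection by `υ = (τ - tr Γ)/3` has Christoffel trace `τ`, and for the changed connection the
form is parallel. The determinant equation recovers `τ` from the derivative of `det h`, so `υ` is
smooth. The argument that makes a torsion-free metric connection unique shows that `υ` does not
depend on coordinates. The changed connection is complex-linear, torsion-free and equivalent to the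
given one. It preserves the form, which is therefore pseudo-Kähler and compatible
(`IsParallelFamily`). -/

namespace CProj

open scoped Topology

variable {M : Type*} [TopologicalSpace M] [ChartedSpace C2 M] [IsManifold 𝓘(ℂ, C2) ω M]

/-! ### Vector fields and functions in the preferred charts -/

/-- The derivative at `y` of the preferred chart at `x₀`. -/
def chartDeriv (x₀ y : M) : C2 →L[ℝ] C2 :=
  mfderiv 𝓘(ℝ, C2) 𝓘(ℝ, C2) (chartAt C2 x₀) y

/-- The coordinate expression of a vector field in the preferred chart at `x₀`. -/
def localRep (x₀ : M) (X : ∀ x : M, TangentSpace 𝓘(ℝ, C2) x) (p : C2) : C2 :=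
  chartDeriv x₀ ((chartAt C2 x₀).symm p) (X ((chartAt C2 x₀).symm p))

instance realManifold_of_le (n : ℕ∞ω) : IsManifold 𝓘(ℝ, C2) n M :=
  IsManifold.of_le (n := ω) le_top

/-- Bridge between chart computations and the bundle-theoretic notions of smooth section: the chart
derivative is the fibre map of the tangent bundle trivialization. -/
lemma chartDeriv_eq_trivialization {x₀ y : M} (hy : y ∈ (chartAt C2 x₀).source) :
    chartDeriv x₀ y =
      (trivializationAt C2 (TangentSpace 𝓘(ℝ, C2)) x₀).continuousLinearMapAt ℝ y := by
  rw [TangentBundle.continuousLinearMapAt_trivializationAt hy]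
  simp only [chartDeriv, mfld_simps]
  rfl

lemma trivializationAt_snd {x₀ y : M} (hy : y ∈ (chartAt C2 x₀).source)
    (v : TangentSpace 𝓘(ℝ, C2) y) :
    (trivializationAt C2 (TangentSpace 𝓘(ℝ, C2)) x₀ ⟨y, v⟩).2 = chartDeriv x₀ y v := by
  rw [chartDeriv_eq_trivialization hy]
  exact (Bundle.Trivialization.continuousLinearMapAt_apply_of_mem _ _ (by simpa using hy) _).symm

lemma chartDeriv_isInvertible {x₀ y : M} (hy : y ∈ (chartAt C2 x₀).source) :
    (chartDeriv x₀ y).IsInvertible := by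
  have h := isInvertible_mfderiv_extChartAt (I := 𝓘(ℝ, C2)) (x := x₀) (y := y) (by simpa using hy)
  simp only [mfld_simps] at h
  exact h

lemma chartDeriv_self (x : M) : chartDeriv x x = ContinuousLinearMap.id ℝ C2 := by
  have h := mfderiv_extChartAt_self (I := 𝓘(ℝ, C2)) (x := x)
  simp only [mfld_simps] at h
  exact h

lemma chartDeriv_injective {x₀ y : M} (hy : y ∈ (chartAt C2 x₀).source) :
    Function.Injective (chartDeriv x₀ y) :=
  (chartDeriv_isInvertible hy).injective

lemma chartDeriv_coordField {x₀ y : M} (hy : y ∈ (chartAt C2 x₀).source) (u : C2) :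
    chartDeriv x₀ y (coordField (chartAt C2 x₀) u y) = u := by
  change chartDeriv x₀ y ((chartDeriv x₀ y).inverse u) = u
  exact (chartDeriv_isInvertible hy).self_apply_inverse _

lemma coordField_chartDeriv {x₀ y : M} (hy : y ∈ (chartAt C2 x₀).source)
    (v : TangentSpace 𝓘(ℝ, C2) y) :
    coordField (chartAt C2 x₀) (chartDeriv x₀ y v) y = v :=
  chartDeriv_injective hy (chartDeriv_coordField hy _)

lemma contDiffAt_transition {x₀ x₁ y : M} (hy₀ : y ∈ (chartAt C2 x₀).source)
    (hy₁ : y ∈ (chartAt C2 x₁).source) :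
    ContDiffAt ℂ ω (chartAt C2 x₀ ∘ (chartAt C2 x₁).symm) (chartAt C2 x₁ y) := by
  have h : (chartAt C2 x₁).symm ≫ₕ chartAt C2 x₀ ∈ contDiffGroupoid ω 𝓘(ℂ, C2) :=
    HasGroupoid.compatible (chart_mem_atlas C2 x₁) (chart_mem_atlas C2 x₀)
  rw [contDiffGroupoid, mem_groupoid_of_pregroupoid] at h
  have h₁ : ContDiffOn ℂ ω (chartAt C2 x₀ ∘ (chartAt C2 x₁).symm)
      ((chartAt C2 x₁).symm ≫ₕ chartAt C2 x₀).source := by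
    simpa [contDiffPregroupoid] using h.1
  exact h₁.contDiffAt (((chartAt C2 x₁).symm ≫ₕ chartAt C2 x₀).open_source.mem_nhds
    (by simp [hy₀, hy₁]))

lemma chartDeriv_eq_fderiv {x₀ y : M} (hy : y ∈ (chartAt C2 x₀).source) :
    chartDeriv x₀ y = fderiv ℝ (chartAt C2 x₀ ∘ (chartAt C2 y).symm) (chartAt C2 y y) := by
  have h := mdifferentiableAt_atlas (I := 𝓘(ℝ, C2)) (chart_mem_atlas C2 x₀) hy
  rw [chartDeriv, MDifferentiableAt.mfderiv h]
  simp [fderivWithin_univ, mfld_simps]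
  rfl

/-- Transition maps are holomorphic, so their real derivatives are restrictions of complex-linear
maps. This is why `J`, defined through the preferred chart, is multiplication by `i` in every chart.
-/
lemma chartDeriv_J {x₀ y : M} (hy : y ∈ (chartAt C2 x₀).source) (v : TangentSpace 𝓘(ℝ, C2) y) :
    chartDeriv x₀ y (J y v) = Complex.I • chartDeriv x₀ y v := by
  rw [chartDeriv_eq_fderiv hy,
    ((contDiffAt_transition hy (mem_chart_source C2 y)).differentiableAt
      (by simp)).fderiv_restrictScalars ℝ]
  exact ContinuousLinearMap.map_smul _ _ _

lemma comp_chart_symm_comp_chart {V : Type*} {x₀ y : M} (hy : y ∈ (chartAt C2 x₀).source)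
    (f : M → V) : f =ᶠ[𝓝 y] (f ∘ (chartAt C2 x₀).symm) ∘ chartAt C2 x₀ := by
  filter_upwards [(chartAt C2 x₀).open_source.mem_nhds hy] with x hx
  simp [hx]

lemma mdifferentiableAt_iff_chart {V : Type*} [NormedAddCommGroup V] [NormedSpace ℝ V]
    {x₀ y : M} (hy : y ∈ (chartAt C2 x₀).source) (f : M → V) :
    MDifferentiableAt 𝓘(ℝ, C2) 𝓘(ℝ, V) f y ↔
      DifferentiableAt ℝ (f ∘ (chartAt C2 x₀).symm) (chartAt C2 x₀ y) := by
  rw [← mdifferentiableAt_iff_differentiableAt]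
  refine ⟨fun h => ?_, fun h => ?_⟩
  · refine MDifferentiableAt.comp (I' := 𝓘(ℝ, C2)) _ ?_
      (mdifferentiableAt_atlas_symm (chart_mem_atlas C2 x₀) ((chartAt C2 x₀).map_source hy))
    rwa [(chartAt C2 x₀).left_inv hy]
  · exact (MDifferentiableAt.comp y h
      (mdifferentiableAt_atlas (chart_mem_atlas C2 x₀) hy)).congr_of_eventuallyEq
        (comp_chart_symm_comp_chart hy f)

lemma contMDiffAt_iff_chart {V : Type*} [NormedAddCommGroup V] [NormedSpace ℝ V]
    {x₀ y : M} (hy : y ∈ (chartAt C2 x₀).source) (f : M → V) :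
    ContMDiffAt 𝓘(ℝ, C2) 𝓘(ℝ, V) ∞ f y ↔
      ContDiffAt ℝ ∞ (f ∘ (chartAt C2 x₀).symm) (chartAt C2 x₀ y) := by
  rw [← contMDiffAt_iff_contDiffAt]
  refine ⟨fun h => ?_, fun h => ?_⟩
  · refine ContMDiffAt.comp (I' := 𝓘(ℝ, C2)) _ ?_
      (contMDiffOn_chart_symm.contMDiffAt
        ((chartAt C2 x₀).open_target.mem_nhds ((chartAt C2 x₀).map_source hy)))
    rwa [(chartAt C2 x₀).left_inv hy]
  · exact (ContMDiffAt.comp y h (contMDiffOn_chart.contMDiffAt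
      ((chartAt C2 x₀).open_source.mem_nhds hy))).congr_of_eventuallyEq
        (comp_chart_symm_comp_chart hy f)

lemma mvfderiv_eq_chart {V : Type*} [NormedAddCommGroup V] [NormedSpace ℝ V]
    {x₀ y : M} (hy : y ∈ (chartAt C2 x₀).source) {f : M → V}
    (hf : DifferentiableAt ℝ (f ∘ (chartAt C2 x₀).symm) (chartAt C2 x₀ y))
    (v : TangentSpace 𝓘(ℝ, C2) y) :
    mvfderiv 𝓘(ℝ, C2) f y v =
      fderiv ℝ (f ∘ (chartAt C2 x₀).symm) (chartAt C2 x₀ y) (chartDeriv x₀ y v) := by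
  have h := (mdifferentiableAt_iff_differentiableAt.2 hf).hasMFDerivAt.comp y
      (mdifferentiableAt_atlas (I := 𝓘(ℝ, C2)) (chart_mem_atlas C2 x₀) hy).hasMFDerivAt
  have h' := (h.congr_of_eventuallyEq (comp_chart_symm_comp_chart hy f)).mfderiv
  rw [mfderiv_eq_fderiv] at h'
  exact congrArg (fun L : C2 →L[ℝ] V => L v) h'

lemma localRep_comp_chart {x₀ y : M} (hy : y ∈ (chartAt C2 x₀).source)
    (X : ∀ x : M, TangentSpace 𝓘(ℝ, C2) x) :
    localRep x₀ X (chartAt C2 x₀ y) = chartDeriv x₀ y (X y) := by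
  rw [localRep, (chartAt C2 x₀).left_inv hy]

lemma eventually_localRep {x₀ y : M} (hy : y ∈ (chartAt C2 x₀).source)
    (X : ∀ x : M, TangentSpace 𝓘(ℝ, C2) x) :
    ((fun x => (trivializationAt C2 (TangentSpace 𝓘(ℝ, C2)) x₀ ⟨x, X x⟩).2) ∘
      (chartAt C2 x₀).symm) =ᶠ[𝓝 (chartAt C2 x₀ y)] localRep x₀ X := by
  filter_upwards [(chartAt C2 x₀).open_target.mem_nhds ((chartAt C2 x₀).map_source hy)] with p hp
  exact trivializationAt_snd ((chartAt C2 x₀).map_target hp) _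

lemma diffFieldAt_iff {x₀ y : M} (hy : y ∈ (chartAt C2 x₀).source)
    (X : ∀ x : M, TangentSpace 𝓘(ℝ, C2) x) :
    DiffFieldAt X y ↔ DifferentiableAt ℝ (localRep x₀ X) (chartAt C2 x₀ y) := by
  unfold DiffFieldAt
  rw [← (eventually_localRep hy X).differentiableAt_iff, ← mdifferentiableAt_iff_chart hy]
  exact Bundle.Trivialization.mdifferentiableAt_section_iff 𝓘(ℝ, C2)
    (trivializationAt C2 (TangentSpace 𝓘(ℝ, C2)) x₀) X (by simpa using hy)

lemma contMDiffAt_field_iff {x₀ y : M} (hy : y ∈ (chartAt C2 x₀).source)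
    (X : ∀ x : M, TangentSpace 𝓘(ℝ, C2) x) :
    ContMDiffAt 𝓘(ℝ, C2) (𝓘(ℝ, C2).prod 𝓘(ℝ, C2)) ∞
      (fun y => TotalSpace.mk' C2 (E := fun y : M => TangentSpace 𝓘(ℝ, C2) y) y (X y)) y ↔
      ContDiffAt ℝ ∞ (localRep x₀ X) (chartAt C2 x₀ y) := by
  have h := eventually_localRep hy X
  refine (Bundle.Trivialization.contMDiffAt_section_iff
    (trivializationAt C2 (TangentSpace 𝓘(ℝ, C2)) x₀) (by simpa using hy)).trans
    ((contMDiffAt_iff_chart hy _).trans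
      ⟨fun h' => h'.congr_of_eventuallyEq ?_, fun h' => h'.congr_of_eventuallyEq h⟩)
  exact Filter.EventuallyEq.symm h

variable {M : Type*} [TopologicalSpace M] [ChartedSpace C2 M] [IsManifold 𝓘(ℂ, C2) ω M]

lemma localRep_coordField {x₀ : M} {p : C2} (hp : p ∈ (chartAt C2 x₀).target) (u : C2) :
    localRep x₀ (coordField (chartAt C2 x₀) u) p = u :=
  chartDeriv_coordField ((chartAt C2 x₀).map_target hp) u

lemma localRep_J {x₀ : M} {p : C2} (hp : p ∈ (chartAt C2 x₀).target)
    (X : ∀ x : M, TangentSpace 𝓘(ℝ, C2) x) :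
    localRep x₀ (fun y => J y (X y)) p = Complex.I • localRep x₀ X p :=
  chartDeriv_J ((chartAt C2 x₀).map_target hp) _

lemma target_mem_nhds {x₀ y : M} (hy : y ∈ (chartAt C2 x₀).source) :
    (chartAt C2 x₀).target ∈ 𝓝 (chartAt C2 x₀ y) :=
  (chartAt C2 x₀).open_target.mem_nhds ((chartAt C2 x₀).map_source hy)

lemma eventually_localRep_coordField {x₀ y : M} (hy : y ∈ (chartAt C2 x₀).source) (u : C2) :
    localRep x₀ (coordField (chartAt C2 x₀) u) =ᶠ[𝓝 (chartAt C2 x₀ y)] fun _ => u := by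
  filter_upwards [target_mem_nhds hy] with p hp using localRep_coordField hp u

lemma eventually_localRep_J {x₀ y : M} (hy : y ∈ (chartAt C2 x₀).source)
    (X : ∀ x : M, TangentSpace 𝓘(ℝ, C2) x) :
    localRep x₀ (fun y => J y (X y)) =ᶠ[𝓝 (chartAt C2 x₀ y)]
      fun p => Complex.I • localRep x₀ X p := by
  filter_upwards [target_mem_nhds hy] with p hp using localRep_J hp X

lemma diffFieldAt_coordField {x₀ y : M} (hy : y ∈ (chartAt C2 x₀).source) (u : C2) :
    DiffFieldAt (coordField (chartAt C2 x₀) u) y := by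
  rw [diffFieldAt_iff hy, (eventually_localRep_coordField hy u).differentiableAt_iff]
  exact differentiableAt_const _

lemma DiffFieldAt.J_apply {X : ∀ x : M, TangentSpace 𝓘(ℝ, C2) x} {y : M} (hX : DiffFieldAt X y) :
    DiffFieldAt (fun y => J y (X y)) y := by
  rw [diffFieldAt_iff (mem_chart_source C2 y)] at hX ⊢
  rw [(eventually_localRep_J (mem_chart_source C2 y) X).differentiableAt_iff]
  exact hX.const_smul Complex.I

lemma coordField_add (x₀ : M) (u v : C2) :
    coordField (chartAt C2 x₀) (u + v) =
      coordField (chartAt C2 x₀) u + coordField (chartAt C2 x₀) v := by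
  ext1 x
  exact map_add (chartDeriv x₀ x).inverse u v

lemma coordField_smul (x₀ : M) (a : ℝ) (u : C2) :
    coordField (chartAt C2 x₀) (a • u) = a • coordField (chartAt C2 x₀) u := by
  ext1 x
  exact map_smul (chartDeriv x₀ x).inverse a u

lemma coordField_I_smul {x₀ y : M} (hy : y ∈ (chartAt C2 x₀).source) (u : C2) :
    coordField (chartAt C2 x₀) (Complex.I • u) y = J y (coordField (chartAt C2 x₀) u y) := by
  refine chartDeriv_injective hy ?_
  rw [chartDeriv_coordField hy, chartDeriv_J hy, chartDeriv_coordField hy]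

/-! ### The Christoffel symbols of a complex-linear torsion-free connection -/

lemma nabla_congr (D : ComplexLinearConnection M) {X Y : ∀ x : M, TangentSpace 𝓘(ℝ, C2) x} {y : M}
    (hX : DiffFieldAt X y) (hY : DiffFieldAt Y y) (h : ∀ᶠ x in 𝓝 y, X x = Y x) :
    D.nabla X y = D.nabla Y y :=
  D.nabla.isCovariantDerivativeOnUniv.congr_of_eventuallyEq hX hY Filter.univ_mem h

lemma christoffelVec_add_left (D : ComplexLinearConnection M) (x₀ y : M) (u u' v : C2) :
    christoffelVec D (chartAt C2 x₀) y (u + u') v =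
      christoffelVec D (chartAt C2 x₀) y u v + christoffelVec D (chartAt C2 x₀) y u' v := by
  unfold christoffelVec
  rw [coordField_add, Pi.add_apply, map_add, map_add]
  rfl

lemma christoffelVec_smul_left (D : ComplexLinearConnection M) (x₀ y : M) (a : ℝ) (u v : C2) :
    christoffelVec D (chartAt C2 x₀) y (a • u) v =
      a • christoffelVec D (chartAt C2 x₀) y u v := by
  unfold christoffelVec
  rw [coordField_smul, Pi.smul_apply, map_smul, map_smul]
  rfl

lemma torsionFree_apply (D : ComplexLinearConnection M) {X Y : ∀ x : M, TangentSpace 𝓘(ℝ, C2) x}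
    {y : M} (hX : DiffFieldAt X y) (hY : DiffFieldAt Y y) :
    D.nabla Y y (X y) - D.nabla X y (Y y) = VectorField.mlieBracket 𝓘(ℝ, C2) X Y y :=
  (CovariantDerivative.torsion_eq_zero_iff D.nabla).1 D.torsionFree hX hY

/-- Brackets commute with pullback along the chart, and constant fields on the model space commute.
-/
lemma mlieBracket_coordField {x₀ y : M} (hy : y ∈ (chartAt C2 x₀).source) (u v : C2) :
    VectorField.mlieBracket 𝓘(ℝ, C2) (coordField (chartAt C2 x₀) u)
      (coordField (chartAt C2 x₀) v) y = 0 := by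
  have hc : ∀ w : C2, MDifferentiableAt 𝓘(ℝ, C2) (𝓘(ℝ, C2).prod 𝓘(ℝ, C2))
      (fun p : C2 => TotalSpace.mk' C2 (E := fun p : C2 => TangentSpace 𝓘(ℝ, C2) p) p w)
      (chartAt C2 x₀ y) := fun w =>
    (contMDiffAt_vectorSpace_iff_contDiffAt (n := 1).2
      (contDiffAt_const (c := w))).mdifferentiableAt one_ne_zero
  have h := VectorField.mpullback_mlieBracket (I := 𝓘(ℝ, C2)) (I' := 𝓘(ℝ, C2)) (n := ∞)
    (f := chartAt C2 x₀) (x₀ := y) (V := fun _ => u) (W := fun _ => v) (hc u) (hc v)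
    (contMDiffOn_chart.contMDiffAt ((chartAt C2 x₀).open_source.mem_nhds hy))
    (by simpa using! (by exact_mod_cast le_top : ((2 : ℕ∞) : ℕ∞ω) ≤ ((⊤ : ℕ∞) : ℕ∞ω)))
  have h0 : VectorField.mlieBracket 𝓘(ℝ, C2)
      (fun p => (u : TangentSpace 𝓘(ℝ, C2) (p : C2)))
      (fun p => (v : TangentSpace 𝓘(ℝ, C2) (p : C2))) (chartAt C2 x₀ y) = 0 := by
    have key : ∀ (V W : ∀ p : C2, TangentSpace 𝓘(ℝ, C2) p) (p : C2),
        VectorField.mlieBracket 𝓘(ℝ, C2) V W p = VectorField.lieBracket ℝ V W p := fun V W p => by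
      rw [← VectorField.mlieBracketWithin_univ,
        VectorField.mlieBracketWithin_eq_lieBracketWithin]
      exact congrFun VectorField.lieBracketWithin_univ p
    refine (key _ _ _).trans ?_
    change VectorField.lieBracket ℝ (fun _ : C2 => u) (fun _ : C2 => v) (chartAt C2 x₀ y) = 0
    simp [VectorField.lieBracket]
  exact h.symm.trans ((congrArg (mfderiv 𝓘(ℝ, C2) 𝓘(ℝ, C2) (chartAt C2 x₀) y).inverse h0).trans
    (map_zero _))

lemma christoffelVec_comm (D : ComplexLinearConnection M) {x₀ y : M}
    (hy : y ∈ (chartAt C2 x₀).source) (u v : C2) :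
    christoffelVec D (chartAt C2 x₀) y u v = christoffelVec D (chartAt C2 x₀) y v u := by
  have h := torsionFree_apply D (diffFieldAt_coordField hy u) (diffFieldAt_coordField hy v)
  rw [mlieBracket_coordField hy, sub_eq_zero] at h
  exact congrArg (chartDeriv x₀ y) h

/-- Near `y` the coordinate field of `i v` is `J` applied to that of `v`, so this is `∇J = 0`
together with locality of the connection. -/
lemma christoffelVec_I_smul_right (D : ComplexLinearConnection M) {x₀ y : M}
    (hy : y ∈ (chartAt C2 x₀).source) (u v : C2) :
    christoffelVec D (chartAt C2 x₀) y u (Complex.I • v) =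
      Complex.I • christoffelVec D (chartAt C2 x₀) y u v := by
  have h := nabla_congr D (diffFieldAt_coordField hy (Complex.I • v))
    (diffFieldAt_coordField hy v).J_apply (by
      filter_upwards [(chartAt C2 x₀).open_source.mem_nhds hy] with x hx
      exact coordField_I_smul hx v)
  have h' := D.complexLinear _ y (diffFieldAt_coordField hy v) (coordField (chartAt C2 x₀) u y)
  rw [← h] at h'
  exact (congrArg (chartDeriv x₀ y) h').trans (chartDeriv_J hy _)

/-- Real linearity comes for free only in the direction of differentiation; symmetry carries it to
the other slot, where linearity under `i` is known. -/
lemma christoffelVec_smul_right (D : ComplexLinearConnection M) {x₀ y : M}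
    (hy : y ∈ (chartAt C2 x₀).source) (u v : C2) (a : ℂ) :
    christoffelVec D (chartAt C2 x₀) y u (a • v) =
      a • christoffelVec D (chartAt C2 x₀) y u v := by
  have h : a • v = a.re • v + a.im • (Complex.I • v) := by
    conv_lhs => rw [← Complex.re_add_im a, add_smul, mul_smul]
    rfl
  rw [h, christoffelVec_comm D hy, christoffelVec_add_left, christoffelVec_smul_left,
    christoffelVec_smul_left, christoffelVec_comm D hy, christoffelVec_comm D hy _ u,
    christoffelVec_I_smul_right D hy]
  conv_rhs => rw [← Complex.re_add_im a, add_smul, mul_smul]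
  rfl

lemma christoffelVec_eq_sum (D : ComplexLinearConnection M) {x₀ y : M}
    (hy : y ∈ (chartAt C2 x₀).source) (u v : C2) (i : Fin 2) :
    christoffelVec D (chartAt C2 x₀) y u v i =
      ∑ j, ∑ k, christoffel D (chartAt C2 x₀) y i j k * u j * v k := by
  have e : ∀ w : C2, w = w 0 • Pi.single 0 1 + w 1 • Pi.single 1 1 := by
    intro w
    ext l
    fin_cases l <;> simp
  conv_lhs => rw [e v, christoffelVec_comm D hy, christoffelVec_add_left,
    christoffelVec_comm D hy _ u, christoffelVec_comm D hy _ u, christoffelVec_smul_right D hy,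
    christoffelVec_smul_right D hy, e u, christoffelVec_add_left, christoffelVec_add_left]
  rw [christoffelVec_comm D hy (u 0 • _), christoffelVec_comm D hy (u 1 • _),
    christoffelVec_comm D hy (u 0 • _), christoffelVec_comm D hy (u 1 • _)]
  simp only [christoffelVec_smul_right D hy]
  simp only [Fin.sum_univ_two, christoffel, Pi.add_apply, Pi.smul_apply, smul_eq_mul]
  rw [christoffelVec_comm D hy (Pi.single 1 1) (Pi.single 0 1)]
  ring

lemma christoffel_comm (D : ComplexLinearConnection M) {x₀ y : M}
    (hy : y ∈ (chartAt C2 x₀).source) (i j k : Fin 2) :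
    christoffel D (chartAt C2 x₀) y i j k = christoffel D (chartAt C2 x₀) y i k j :=
  congrFun (christoffelVec_comm D hy _ _) i

lemma nabla_sum (D : ComplexLinearConnection M) {ι : Type*} (s : Finset ι)
    (X : ι → ∀ x : M, TangentSpace 𝓘(ℝ, C2) x) {y : M} (hX : ∀ i, DiffFieldAt (X i) y) :
    D.nabla (fun x => ∑ i ∈ s, X i x) y = ∑ i ∈ s, D.nabla (X i) y := by
  classical
  induction s using Finset.induction_on with
  | empty =>
    simp only [Finset.sum_empty]
    exact congrFun (CovariantDerivative.zero D.nabla) y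
  | insert a s ha ih =>
    have h : DiffFieldAt (fun x => ∑ i ∈ s, X i x) y :=
      MDifferentiableAt.sum_section (fun i _ => hX i)
    have h' := D.nabla.isCovariantDerivativeOnUniv.add (hX a) h
    rw [Finset.sum_insert ha, ← ih, ← h']
    congr 1
    ext1 x
    simp [Finset.sum_insert ha]

/-- The coordinate expression of `∇_v X`. -/
lemma chartDeriv_nabla (D : ComplexLinearConnection M) {x₀ y : M}
    (hy : y ∈ (chartAt C2 x₀).source) {X : ∀ x : M, TangentSpace 𝓘(ℝ, C2) x}
    (hX : DiffFieldAt X y) (v : TangentSpace 𝓘(ℝ, C2) y) :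
    chartDeriv x₀ y (D.nabla X y v) =
      fderiv ℝ (localRep x₀ X) (chartAt C2 x₀ y) (chartDeriv x₀ y v) +
        christoffelVec D (chartAt C2 x₀) y (chartDeriv x₀ y v) (chartDeriv x₀ y (X y)) := by
  let b := Module.finBasis ℝ C2
  let z := chartAt C2 x₀
  let c : ∀ _ : Fin (Module.finrank ℝ C2), C2 →L[ℝ] ℝ := fun i =>
    LinearMap.toContinuousLinearMap (b.coord i)
  let φ : Fin (Module.finrank ℝ C2) → M → ℝ := fun i x => c i (localRep x₀ X (z x))
  have hX' := (diffFieldAt_iff hy X).1 hX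
  have hev : ∀ i, (φ i ∘ z.symm) =ᶠ[𝓝 (z y)] fun p => c i (localRep x₀ X p) := by
    intro i
    filter_upwards [target_mem_nhds hy] with p hp
    simp only [φ, Function.comp, z.right_inv hp]
  have hφd : ∀ i, HasFDerivAt (φ i ∘ z.symm) ((c i).comp (fderiv ℝ (localRep x₀ X) (z y)))
      (z y) := fun i =>
    ((c i).hasFDerivAt.comp _ hX'.hasFDerivAt).congr_of_eventuallyEq (hev i)
  have hφ : ∀ i, MDifferentiableAt 𝓘(ℝ, C2) 𝓘(ℝ, ℝ) (φ i) y := fun i =>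
    (mdifferentiableAt_iff_chart hy _).2 (hφd i).differentiableAt
  have hf : ∀ i, DiffFieldAt (φ i • coordField z (b i)) y := fun i =>
    MDifferentiableAt.smul_section (hφ i) (diffFieldAt_coordField hy (b i))
  -- Near `y` the field is expanded in a real frame of coordinate fields; the Leibniz rule on each
  -- summand then gives one derivative term and one Christoffel term.
  have hsum : ∀ᶠ x in 𝓝 y, X x = ∑ i, (φ i • coordField z (b i)) x := by
    filter_upwards [z.open_source.mem_nhds hy] with x hx
    refine chartDeriv_injective hx ?_
    refine Eq.trans ?_ (map_sum (chartDeriv x₀ x) _ _).symm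
    have : ∀ i, chartDeriv x₀ x ((φ i • coordField z (b i)) x) = φ i x • b i := fun i => by
      rw [Pi.smul_apply']
      exact (map_smul (chartDeriv x₀ x) _ _).trans (by rw [chartDeriv_coordField hx])
    rw [Finset.sum_congr rfl fun i _ => this i]
    simp only [φ, z, localRep_comp_chart hx]
    exact (b.sum_repr _).symm
  have hN : D.nabla X y = ∑ i, D.nabla (φ i • coordField z (b i)) y := by
    rw [← nabla_sum D _ _ hf]
    exact nabla_congr D hX (MDifferentiableAt.sum_section fun i _ => hf i) hsum
  have hterm : ∀ i, chartDeriv x₀ y (D.nabla (φ i • coordField z (b i)) y v) =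
      c i (fderiv ℝ (localRep x₀ X) (z y) (chartDeriv x₀ y v)) • b i +
      c i (chartDeriv x₀ y (X y)) • christoffelVec D z y (chartDeriv x₀ y v) (b i) := by
    intro i
    rw [D.nabla.isCovariantDerivativeOnUniv.leibniz (diffFieldAt_coordField hy (b i)) (hφ i)]
    have e1 : mvfderiv 𝓘(ℝ, C2) (φ i) y v =
        c i (fderiv ℝ (localRep x₀ X) (z y) (chartDeriv x₀ y v)) := by
      rw [mvfderiv_eq_chart hy (hφd i).differentiableAt, (hφd i).fderiv]
      rfl
    have e2 : φ i y = c i (chartDeriv x₀ y (X y)) := by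
      simp only [φ, z, localRep_comp_chart hy]
    have e3 : chartDeriv x₀ y (D.nabla (coordField z (b i)) y v) =
        christoffelVec D z y (chartDeriv x₀ y v) (b i) := by
      unfold christoffelVec
      rw [coordField_chartDeriv hy]
      rfl
    have e4 := chartDeriv_coordField hy (b i)
    rw [← e1, ← e2, ← e3]
    refine (map_add (chartDeriv x₀ y) _ _).trans ?_
    rw [add_comm]
    refine congrArg₂ _ ?_ ?_
    · exact (map_smul (chartDeriv x₀ y) _ _).trans (congrArg _ e4)
    · exact map_smul (chartDeriv x₀ y) _ _
  let Λ : C2 →ₗ[ℝ] C2 :=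
    { toFun := fun w => christoffelVec D z y w (chartDeriv x₀ y v)
      map_add' := fun w w' => christoffelVec_add_left D x₀ y w w' _
      map_smul' := fun a w => christoffelVec_smul_left D x₀ y a w _ }
  have hΛ : ∀ w, christoffelVec D z y (chartDeriv x₀ y v) w = Λ w := fun w =>
    christoffelVec_comm D hy _ _
  rw [hN, sum_apply]
  refine (map_sum (chartDeriv x₀ y) _ _).trans ?_
  rw [Finset.sum_congr rfl fun i _ => hterm i, Finset.sum_add_distrib]
  refine congrArg₂ _ (b.sum_repr _) ?_
  simp only [hΛ, ← map_smul, ← map_sum]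
  exact (congrArg Λ (b.sum_repr _)).trans (hΛ _).symm

/-! ### Smoothness of the Christoffel symbols -/

variable [T2Space M]

/-- Smoothness of the connection is applied here to global smooth fields, so the coordinate field is
first cut off by a bump function equal to one near `y`; locality of `∇` shows that the cut-off does
not change the value. The Hausdorff property makes the cut-off field smooth. -/
lemma contMDiffAt_christoffelVec (D : ComplexLinearConnection M) {x₀ y : M}
    (hy : y ∈ (chartAt C2 x₀).source) (u v : C2) :
    ContMDiffAt 𝓘(ℝ, C2) 𝓘(ℝ, C2) ∞ (fun x => christoffelVec D (chartAt C2 x₀) x u v) y := by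
  let z := chartAt C2 x₀
  have hs : z.source ∈ 𝓝 y := z.open_source.mem_nhds hy
  have hc : ∀ w, ∀ x ∈ z.source, ContMDiffAt 𝓘(ℝ, C2) (𝓘(ℝ, C2).prod 𝓘(ℝ, C2)) ∞
      (fun y => TotalSpace.mk' C2 (E := fun y : M => TangentSpace 𝓘(ℝ, C2) y) y
        (coordField z w y)) x := fun w x hx =>
    (contMDiffAt_field_iff hx _).2
      (contDiffAt_const.congr_of_eventuallyEq (eventually_localRep_coordField hx w))
  obtain ⟨ρ, -, hρ⟩ := (SmoothBumpFunction.nhds_basis_tsupport (I := 𝓘(ℝ, C2)) y).mem_iff.1 hs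
  have hY : ContMDiff 𝓘(ℝ, C2) (𝓘(ℝ, C2).prod 𝓘(ℝ, C2)) ∞
      (fun x => TotalSpace.mk' C2 (E := fun y : M => TangentSpace 𝓘(ℝ, C2) y) x
        (((ρ : M → ℝ) • coordField z v) x)) :=
    ContMDiffOn.smul_section_of_tsupport ρ.contMDiff.contMDiffOn z.open_source hρ
      fun x hx => (hc v x hx).contMDiffWithinAt
  have h := (D.smooth.contMDiff.contMDiff (σ := (ρ : M → ℝ) • coordField z v)
    (by simpa using hY.contMDiffOn)).contMDiffAt (x := y) Filter.univ_mem
  have h2 := h.clm_bundle_apply (hc u y hy)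
  have h3 := (contMDiffAt_field_iff hy _).1 h2
  refine (contMDiffAt_iff_chart hy _).2 (h3.congr_of_eventuallyEq ?_)
  have hone := eventually_eventually_nhds.2 ρ.eventuallyEq_one
  have hz : Filter.Tendsto z.symm (𝓝 (z y)) (𝓝 y) := by
    have := (z.continuousAt_symm (z.map_source hy)).tendsto
    rwa [z.left_inv hy] at this
  filter_upwards [target_mem_nhds hy, hz.eventually hone] with p hp h1
  have hp' := z.map_target hp
  have hdiff : DiffFieldAt ((ρ : M → ℝ) • coordField z v) (z.symm p) :=
    (hY _).mdifferentiableAt (by simp)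
  have := nabla_congr D (diffFieldAt_coordField hp' v) hdiff (by
    filter_upwards [h1] with x hx
    rw [Pi.smul_apply', hx]
    simp [z])
  simp only [Function.comp, localRep, christoffelVec]
  exact congrArg (fun L : C2 →L[ℝ] C2 => chartDeriv x₀ (z.symm p)
    (L (coordField z u (z.symm p)))) this

variable {M : Type*} [TopologicalSpace M] [ChartedSpace C2 M] [IsManifold 𝓘(ℂ, C2) ω M]

/-! ### Generalised geodesics in coordinates -/

lemma chartDeriv_trans {x₀ x₁ y : M} (hy₀ : y ∈ (chartAt C2 x₀).source)
    (hy₁ : y ∈ (chartAt C2 x₁).source) (v : TangentSpace 𝓘(ℝ, C2) y) :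
    chartDeriv x₀ y v = fderiv ℝ (chartAt C2 x₀ ∘ (chartAt C2 x₁).symm) (chartAt C2 x₁ y)
      (chartDeriv x₁ y v) :=
  mvfderiv_eq_chart hy₁ (((contDiffAt_transition hy₀ hy₁).restrict_scalars ℝ).differentiableAt
    (by simp)) v

/-- The transformation law of the Christoffel symbols. -/
lemma christoffelVec_transition (D : ComplexLinearConnection M) {x₀ y : M}
    (hy : y ∈ (chartAt C2 x₀).source) (u : C2) :
    chartDeriv x₀ y (christoffelVec D (chartAt C2 y) y u u) =
      fderiv ℝ (fderiv ℝ (chartAt C2 x₀ ∘ (chartAt C2 y).symm)) (chartAt C2 y y) u u +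
        christoffelVec D (chartAt C2 x₀) y (chartDeriv x₀ y u) (chartDeriv x₀ y u) := by
  set z := chartAt C2 x₀
  set z₁ := chartAt C2 y
  set ψ := z ∘ z₁.symm
  have hy₁ := mem_chart_source C2 y
  have hid : ∀ v : C2, chartDeriv y y v = v := fun v => by rw [chartDeriv_self]; rfl
  have hX := diffFieldAt_coordField hy₁ u
  have hXy : coordField z₁ u y = (u : C2) := by
    rw [← hid (coordField z₁ u y)]; exact chartDeriv_coordField hy₁ u
  have h := chartDeriv_nabla D hy hX (coordField z₁ u y)
  have e1 : christoffelVec D z₁ y u u = D.nabla (coordField z₁ u) y (coordField z₁ u y) :=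
    hid _
  rw [e1, h, hXy]
  congr 1
  have hψ : ContDiffAt ℝ ω ψ (z₁ y) := (contDiffAt_transition hy hy₁).restrict_scalars ℝ
  have hφ : ContDiffAt ℝ ω (z₁ ∘ z.symm) (z y) :=
    (contDiffAt_transition hy₁ hy).restrict_scalars ℝ
  -- Seen in the other chart, a constant field is the derivative of the transition map applied to
  -- `u`. Differentiating it produces the second-derivative term of the transformation law.
  have hev : localRep x₀ (coordField z₁ u) =ᶠ[𝓝 (z y)]
      fun p => fderiv ℝ ψ ((z₁ ∘ z.symm) p) u := by
    have hz : Filter.Tendsto z.symm (𝓝 (z y)) (𝓝 y) := by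
      have := (z.continuousAt_symm (z.map_source hy)).tendsto
      rwa [z.left_inv hy] at this
    filter_upwards [target_mem_nhds hy, hz.eventually (z₁.open_source.mem_nhds hy₁)] with p hp hp'
    rw [localRep, chartDeriv_trans (z.map_target hp) hp', chartDeriv_coordField hp']
    rfl
  have hψ' : DifferentiableAt ℝ (fderiv ℝ ψ) ((z₁ ∘ z.symm) (z y)) := by
    simp only [Function.comp, z.left_inv hy]
    exact (hψ.fderiv_right (m := 1) (by simp)).differentiableAt one_ne_zero
  have hd := (hψ'.hasFDerivAt.comp (z y) (hφ.differentiableAt (by simp)).hasFDerivAt).clm_apply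
    (hasFDerivAt_const u (z y))
  rw [(hd.congr_of_eventuallyEq hev).fderiv]
  have e2 := chartDeriv_trans hy₁ hy (u : C2)
  rw [hid] at e2
  simp only [ContinuousLinearMap.comp_zero, zero_add, ContinuousLinearMap.flip_apply,
    ContinuousLinearMap.comp_apply, Function.comp, z.left_inv hy]
  exact congrArg (fun w => fderiv ℝ (fderiv ℝ ψ) (z₁ y) w u) e2.symm

variable {γ : ℝ → M} {t : ℝ}

lemma contDiffAt_chart_curve {x₀ : M} (ht : γ t ∈ (chartAt C2 x₀).source)
    (hγ : ContMDiffAt 𝓘(ℝ, ℝ) 𝓘(ℝ, C2) ∞ γ t) :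
    ContDiffAt ℝ ∞ (fun s => chartAt C2 x₀ (γ s)) t :=
  contMDiffAt_iff_contDiffAt.1 (ContMDiffAt.comp t (contMDiffOn_chart.contMDiffAt
    ((chartAt C2 x₀).open_source.mem_nhds ht)) hγ)

lemma chartDeriv_velocity {x₀ : M} (ht : γ t ∈ (chartAt C2 x₀).source)
    (hγ : ContMDiffAt 𝓘(ℝ, ℝ) 𝓘(ℝ, C2) ∞ γ t) :
    chartDeriv x₀ (γ t) (velocity γ t) = deriv (fun s => chartAt C2 x₀ (γ s)) t := by
  have h := (mdifferentiableAt_atlas (I := 𝓘(ℝ, C2)) (chart_mem_atlas C2 x₀) ht).hasMFDerivAt.comp t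
    (hγ.mdifferentiableAt (by simp)).hasMFDerivAt
  have h' : HasFDerivAt (fun s => chartAt C2 x₀ (γ s)) ((chartDeriv x₀ (γ t)).comp
      (mfderiv 𝓘(ℝ, ℝ) 𝓘(ℝ, C2) γ t : ℝ →L[ℝ] C2)) t := hasMFDerivAt_iff_hasFDerivAt.1 h
  exact h'.hasDerivAt.deriv.symm

/-- `covAccel` is defined by a chart that moves with the curve; here any fixed chart is allowed. The
second derivative of the transition map arises both from differentiating the curve twice and from
the law of the Christoffel symbols, and the two contributions match. -/
lemma chartDeriv_covAccel (D : ComplexLinearConnection M) {x₀ : M}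
    (ht : γ t ∈ (chartAt C2 x₀).source) (hγ : ContMDiffAt 𝓘(ℝ, ℝ) 𝓘(ℝ, C2) ∞ γ t) :
    chartDeriv x₀ (γ t) (covAccel D γ t) =
      deriv (deriv fun s => chartAt C2 x₀ (γ s)) t +
        christoffelVec D (chartAt C2 x₀) (γ t) (deriv (fun s => chartAt C2 x₀ (γ s)) t)
          (deriv (fun s => chartAt C2 x₀ (γ s)) t) := by
  set z := chartAt C2 x₀
  set y := γ t with hyt
  set z₁ := chartAt C2 y
  set ψ := z ∘ z₁.symm
  have hy₁ := mem_chart_source C2 y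
  set c : ℝ → C2 := fun s => z₁ (γ s)
  have hc : ContDiffAt ℝ ∞ c t := contDiffAt_chart_curve hy₁ hγ
  have hc1 : DifferentiableAt ℝ (deriv c) t :=
    (((hc.fderiv_right (m := ∞) (by simp)).clm_apply
      (contDiffAt_const (c := (1 : ℝ)))).differentiableAt (by simp))
  have hψ : ContDiffAt ℝ ω ψ (z₁ y) := (contDiffAt_transition ht hy₁).restrict_scalars ℝ
  have e0 : covAccel D γ t = (deriv (deriv c) t + christoffelVec D z₁ y (deriv c t) (deriv c t)
      : C2) := by
    change (chartDeriv y y).inverse _ = _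
    rw [chartDeriv_self, ContinuousLinearMap.inverse_id]
    rfl
  have e1 : deriv (fun s => z (γ s)) =ᶠ[𝓝 t] fun s => fderiv ℝ ψ (c s) (deriv c s) := by
    have h1 : ∀ᶠ s in 𝓝 t, γ s ∈ z.source :=
      hγ.continuousAt.eventually (z.open_source.mem_nhds ht)
    have h2 : ∀ᶠ s in 𝓝 t, γ s ∈ z₁.source :=
      hγ.continuousAt.eventually (z₁.open_source.mem_nhds hy₁)
    have h3 : ∀ᶠ s in 𝓝 t, ContDiffAt ℝ 1 c s := (hc.of_le (by simp)).eventually (by simp)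
    filter_upwards [eventually_eventually_nhds.2 h2, h1, h2, h3] with s hs hs1 hs2 hs3
    have hev : (fun s => z (γ s)) =ᶠ[𝓝 s] ψ ∘ c := by
      filter_upwards [hs] with r hr
      simp only [ψ, c, Function.comp, z₁.left_inv hr]
    have hψs : DifferentiableAt ℝ ψ (c s) :=
      ((contDiffAt_transition hs1 hs2).restrict_scalars ℝ).differentiableAt (by simp)
    rw [hev.deriv_eq]
    exact fderiv_comp_deriv s hψs (hs3.differentiableAt one_ne_zero)
  have e2 : deriv (deriv fun s => z (γ s)) t =
      fderiv ℝ (fderiv ℝ ψ) (z₁ y) (deriv c t) (deriv c t) +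
        fderiv ℝ ψ (z₁ y) (deriv (deriv c) t) := by
    have hψ' : HasFDerivAt (fderiv ℝ ψ) (fderiv ℝ (fderiv ℝ ψ) (z₁ y)) (c t) :=
      ((hψ.fderiv_right (m := 1) (by simp)).differentiableAt one_ne_zero).hasFDerivAt
    have hd := (hψ'.comp_hasDerivAt t (hc.differentiableAt (by simp)).hasDerivAt).clm_apply
      hc1.hasDerivAt
    rw [e1.deriv_eq]
    exact hd.deriv
  have e3 : deriv (fun s => z (γ s)) t = chartDeriv x₀ y (deriv c t) := by
    rw [e1.eq_of_nhds, chartDeriv_eq_fderiv ht]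
  rw [e0, map_add, christoffelVec_transition D ht, e2, e3, chartDeriv_eq_fderiv ht]
  abel

/-- This is the first-order system for geodesics on position-velocity space. Writing the
acceleration through the complex symbols makes it visibly polynomial in the velocity. -/
lemma contDiffAt_geodesicField [T2Space M] (D : ComplexLinearConnection M) {x₀ : M} {q : C2 × C2}
    (hq : q.1 ∈ (chartAt C2 x₀).target) :
    ContDiffAt ℝ ∞ (fun q : C2 × C2 =>
      (q.2, -christoffelVec D (chartAt C2 x₀) ((chartAt C2 x₀).symm q.1) q.2 q.2)) q := by
  refine contDiffAt_snd.prodMk (ContDiffAt.neg (contDiffAt_pi.2 fun i => ?_))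
  have hΓ : ∀ j k, ContDiffAt ℝ ∞ (fun q : C2 × C2 =>
      christoffel D (chartAt C2 x₀) ((chartAt C2 x₀).symm q.1) i j k) q := by
    intro j k
    have h := (contMDiffAt_iff_chart ((chartAt C2 x₀).map_target hq) _).1
      (contMDiffAt_christoffelVec D ((chartAt C2 x₀).map_target hq) (Pi.single j 1) (Pi.single k 1))
    rw [(chartAt C2 x₀).right_inv hq] at h
    exact (contDiffAt_pi.1 (h.comp q contDiffAt_fst)) i
  have hw : ∀ j : Fin 2, ContDiffAt ℝ ∞ (fun q : C2 × C2 => q.2 j) q := fun j =>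
    contDiffAt_pi.1 contDiffAt_snd j
  refine (ContDiffAt.sum (s := Finset.univ) fun j _ => ContDiffAt.sum (s := Finset.univ) fun k _ =>
    ((hΓ j k).mul (hw j)).mul (hw k)).congr_of_eventuallyEq ?_
  have : ∀ᶠ q' : C2 × C2 in 𝓝 q, q'.1 ∈ (chartAt C2 x₀).target :=
    continuousAt_fst.eventually ((chartAt C2 x₀).open_target.mem_nhds hq)
  filter_upwards [this] with q' hq'
  rw [christoffelVec_eq_sum D ((chartAt C2 x₀).map_target hq')]

/-- Bootstrapping: if the solution is `C^n`, its derivative `V ∘ α` is `C^n`, so the solution is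
`C^(n+1)`. -/
lemma contDiffOn_of_hasDerivAt {E : Type*} [NormedAddCommGroup E] [NormedSpace ℝ E] {V : E → E}
    {α : ℝ → E} {s : Set ℝ} (hs : IsOpen s) (hα : ∀ t ∈ s, HasDerivAt α (V (α t)) t)
    (hV : ∀ t ∈ s, ContDiffAt ℝ ∞ V (α t)) : ContDiffOn ℝ ∞ α s := by
  rw [contDiffOn_infty]
  intro n
  induction n with
  | zero =>
    exact contDiffOn_zero.2 fun t ht => (hα t ht).continuousAt.continuousWithinAt
  | succ n ih =>
    rw [Nat.cast_succ]
    refine (contDiffOn_succ_iff_deriv_of_isOpen hs).2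
      ⟨fun t ht => (hα t ht).differentiableAt.differentiableWithinAt, ?_, ?_⟩
    · intro h
      exact absurd h (by simp)
    refine ContDiffOn.congr (f := V ∘ α) (fun t ht => ?_) fun t ht => (hα t ht).deriv
    exact (((hV t ht).of_le (by exact_mod_cast le_top)).comp t
      ((ih t ht).contDiffAt (hs.mem_nhds ht))).contDiffWithinAt

/-- A geodesic with prescribed initial velocity. -/
lemma exists_geodesic [T2Space M] (D : ComplexLinearConnection M) {x₀ y : M}
    (hy : y ∈ (chartAt C2 x₀).source) {v : C2} (hv : v ≠ 0) :
    ∃ (γ : ℝ → M) (s : Set ℝ), (0 : ℝ) ∈ s ∧ IsGeneralisedGeodesic D γ s ∧ γ 0 = y ∧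
      deriv (fun t => chartAt C2 x₀ (γ t)) 0 = v ∧
      deriv (deriv fun t => chartAt C2 x₀ (γ t)) 0 = -christoffelVec D (chartAt C2 x₀) y v v := by
  set z := chartAt C2 x₀
  set V : C2 × C2 → C2 × C2 := fun q => (q.2, -christoffelVec D z (z.symm q.1) q.2 q.2)
  obtain ⟨α, hα0, ε, hε, hα⟩ := ContDiffAt.exists_forall_mem_closedBall_exists_eq_forall_mem_Ioo_hasDerivAt₀
    (f := V) (x₀ := (z y, v))
    ((contDiffAt_geodesicField D (z.map_source hy)).of_le (by exact_mod_cast le_top)) 0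
  have hcont : ContinuousAt α 0 := (hα 0 (by constructor <;> linarith)).continuousAt
  -- The interval is shrunk so that the solution stays in the chart and its velocity never vanishes,
  -- as an immersed curve requires.
  have hopen : IsOpen (z.target ×ˢ {w : C2 | w ≠ 0}) := z.open_target.prod isOpen_ne
  have hmem : α 0 ∈ z.target ×ˢ {w : C2 | w ≠ 0} := by
    rw [hα0]
    exact ⟨z.map_source hy, hv⟩
  obtain ⟨δ, hδ, hball⟩ := Metric.eventually_nhds_iff.1
    ((hcont.eventually (hopen.mem_nhds hmem)).and
      (Ioo_mem_nhds (by linarith : 0 - ε < 0) (by linarith : 0 < 0 + ε)))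
  set s := Metric.ball (0 : ℝ) δ
  have hs : IsOpen s := Metric.isOpen_ball
  have hsm : ∀ t ∈ s, (α t).1 ∈ z.target ∧ (α t).2 ≠ 0 := fun t ht => (hball ht).1
  have hsd : ∀ t ∈ s, HasDerivAt α (V (α t)) t := fun t ht => hα t (hball ht).2
  have h0 : (0 : ℝ) ∈ s := Metric.mem_ball_self hδ
  have hαs := contDiffOn_of_hasDerivAt hs hsd fun t ht => contDiffAt_geodesicField D (hsm t ht).1
  set γ : ℝ → M := fun t => z.symm (α t).1
  have hzγ : ∀ t ∈ s, (fun t => z (γ t)) =ᶠ[𝓝 t] fun t => (α t).1 := by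
    intro t ht
    filter_upwards [hs.mem_nhds ht] with r hr
    exact z.right_inv (hsm r hr).1
  have hd1 : ∀ t ∈ s, deriv (fun t => z (γ t)) t = (α t).2 := by
    intro t ht
    rw [(hzγ t ht).deriv_eq]
    exact ((hasFDerivAt_fst (𝕜 := ℝ) (p := α t)).comp_hasDerivAt t (hsd t ht)).deriv
  have hd2 : ∀ t ∈ s, deriv (deriv fun t => z (γ t)) t =
      -christoffelVec D z (γ t) (α t).2 (α t).2 := by
    intro t ht
    have : deriv (fun t => z (γ t)) =ᶠ[𝓝 t] fun t => (α t).2 := by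
      filter_upwards [hs.mem_nhds ht] with r hr using hd1 r hr
    rw [this.deriv_eq]
    exact ((hasFDerivAt_snd (𝕜 := ℝ) (p := α t)).comp_hasDerivAt t (hsd t ht)).deriv
  have hγs : ∀ t ∈ s, γ t ∈ z.source := fun t ht => z.map_target (hsm t ht).1
  have hγ : ∀ t ∈ s, ContMDiffAt 𝓘(ℝ, ℝ) 𝓘(ℝ, C2) ∞ γ t := by
    intro t ht
    have h1 : ContMDiffAt 𝓘(ℝ, ℝ) 𝓘(ℝ, C2) ∞ (fun t => (α t).1) t :=
      contMDiffAt_iff_contDiffAt.2 ((hαs.contDiffAt (hs.mem_nhds ht)).fst)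
    exact ContMDiffAt.comp t (contMDiffOn_chart_symm.contMDiffAt
      (z.open_target.mem_nhds (hsm t ht).1)) h1
  have hγ0 : γ 0 = y := by simp only [γ, hα0, z.left_inv hy]
  refine ⟨γ, s, h0, ⟨hs, ?_, fun t ht => (hγ t ht).contMDiffWithinAt, fun t ht => ⟨?_, 0, 0, ?_⟩⟩,
    hγ0, ?_, ?_⟩
  · exact (convex_ball (0 : ℝ) δ).ordConnected
  · intro hvel
    have h := chartDeriv_velocity (hγs t ht) (hγ t ht)
    rw [hd1 t ht, hvel] at h
    exact (hsm t ht).2 (h.symm.trans (map_zero _))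
  · refine chartDeriv_injective (hγs t ht) ?_
    rw [chartDeriv_covAccel D (hγs t ht) (hγ t ht), hd1 t ht, hd2 t ht, neg_add_cancel, zero_smul,
      zero_smul, add_zero]
    exact (map_zero _).symm
  · rw [hd1 0 h0, hα0]
  · rw [hd2 0 h0, hα0, hγ0]

/-- Complex projectively equivalent connections differ by a complex multiple of the velocity. -/
lemma CProjEquiv.exists_smul [T2Space M] {D D' : ComplexLinearConnection M} (h : CProjEquiv D' D)
    {x₀ y : M} (hy : y ∈ (chartAt C2 x₀).source) (v : C2) (hv : v ≠ 0) :
    ∃ a : ℂ, christoffelVec D' (chartAt C2 x₀) y v v - christoffelVec D (chartAt C2 x₀) y v v =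
      a • v := by
  -- A true geodesic of `D` has zero `D`-acceleration, so its acceleration for `D'` is exactly the
  -- difference of the two Christoffel terms at `v`; being a generalised geodesic of `D'` forces it
  -- into the complex line of `v`.
  obtain ⟨γ, s, h0, hγ, hγ0, hd1, hd2⟩ := exists_geodesic D hy hv
  obtain ⟨hs, -, hsm, hgeo⟩ := (h γ s).2 hγ
  obtain ⟨-, a, b, hab⟩ := hgeo 0 h0
  have hy' : γ 0 ∈ (chartAt C2 x₀).source := by rwa [hγ0]
  have hγc := hsm.contMDiffAt (hs.mem_nhds h0)
  have e1 := chartDeriv_covAccel D' hy' hγc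
  have e2 : chartDeriv x₀ (γ 0) (a • velocity γ 0 + b • J (γ 0) (velocity γ 0)) =
      a • v + b • (Complex.I • v) := by
    rw [← hd1, ← chartDeriv_velocity hy' hγc, ← chartDeriv_J hy']
    exact (map_add (chartDeriv x₀ (γ 0)) _ _).trans (congrArg₂ _ (map_smul _ _ _) (map_smul _ _ _))
  rw [hab, e2, hd1, hd2, hγ0] at e1
  refine ⟨a + b * Complex.I, ?_⟩
  rw [add_smul, mul_smul, sub_eq_neg_add, ← e1]
  rfl

/-- The difference `S` of the connections is complex bilinear and symmetric with `S(v, v)`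
proportional to `v`, so it has the form `υ ⊗ 1 + 1 ⊗ υ`. Its trace-free part, which is the
difference of the `Π`, therefore vanishes. -/
lemma CProjEquiv.projInv_eq [T2Space M] {D D' : ComplexLinearConnection M} (h : CProjEquiv D' D)
    {x₀ y : M} (hy : y ∈ (chartAt C2 x₀).source) (i j k : Fin 2) :
    projInv D' (chartAt C2 x₀) y i j k = projInv D (chartAt C2 x₀) y i j k := by
  have key : ∀ v : C2, v ≠ 0 →
      (christoffelVec D' (chartAt C2 x₀) y v v - christoffelVec D (chartAt C2 x₀) y v v) 0 * v 1 =
      (christoffelVec D' (chartAt C2 x₀) y v v - christoffelVec D (chartAt C2 x₀) y v v) 1 * v 0 := by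
    intro v hv
    obtain ⟨a, ha⟩ := h.exists_smul hy v hv
    rw [ha]
    simp only [Pi.smul_apply, smul_eq_mul]
    ring
  -- Proportionality is the vanishing of a binary cubic form in `v`; four pairwise independent
  -- vectors suffice to kill its four coefficients.
  have h1 := key ![1, 0] (by simp)
  have h2 := key ![0, 1] (by simp)
  have h3 := key ![1, 1] (by simp)
  have h4 := key ![1, -1] (by simp)
  simp only [Pi.sub_apply, christoffelVec_eq_sum D hy, christoffelVec_eq_sum D' hy,
    Fin.sum_univ_two] at h1 h2 h3 h4
  have c1 := fun i => christoffel_comm D hy i 1 0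
  have c2 := fun i => christoffel_comm D' hy i 1 0
  simp [c1, c2] at h1 h2 h3 h4
  fin_cases i <;> fin_cases j <;> fin_cases k <;>
    simp [projInv, Fin.sum_univ_two, c1, c2] <;> grind

/-! ### The parabolic group in coordinates -/

/-- The determinant of the linear part of a parameter. -/
def pdet (q : PParam) : ℂ := (Matrix.of q.1).det

lemma pdet_eq (q : PParam) : pdet q = q.1 0 0 * q.1 1 1 - q.1 0 1 * q.1 1 0 := by
  simp [pdet, Matrix.det_fin_two]

lemma pdet_idParam : pdet idParam = 1 := by
  simp [pdet_eq, idParam]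

@[simp] lemma blockMat_zero_zero (c : ℂ) (q : PParam) : blockMat c q 0 0 = c := rfl
@[simp] lemma blockMat_zero_succ (c : ℂ) (q : PParam) (j : Fin 2) :
    blockMat c q 0 j.succ = q.2 j := rfl
@[simp] lemma blockMat_succ_zero (c : ℂ) (q : PParam) (i : Fin 2) :
    blockMat c q i.succ 0 = 0 := rfl
@[simp] lemma blockMat_succ_succ (c : ℂ) (q : PParam) (i j : Fin 2) :
    blockMat c q i.succ j.succ = q.1 i j := rfl

lemma toP_of_ne {q : PParam} (h : pdet q ≠ 0) :
    toP q = ⟨(slBlock q h : PSL3), slBlock_mem q h⟩ := dif_pos h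

lemma eq_blockMat {X : Matrix (Fin 3) (Fin 3) ℂ} (h : ∀ i : Fin 2, X i.succ 0 = 0) :
    X = blockMat (X 0 0) (fun i j => X i.succ j.succ, fun j => X 0 j.succ) := by
  ext i j
  refine Fin.cases ?_ (fun i => ?_) i <;> refine Fin.cases ?_ (fun j => ?_) j <;> simp [h]

/-- A lift to `SL(3, ℂ)` fixes the line of the first basis vector, so its first column is zero below
the corner, and determinant one forces the corner to be the inverse determinant of the lower block.
-/
lemma exists_toP (p : P) : ∃ q : PParam, pdet q ≠ 0 ∧ p = toP q := by
  obtain ⟨p, hp⟩ := p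
  obtain ⟨A, rfl⟩ := QuotientGroup.mk_surjective p
  have hp' := hp
  rw [P, MulAction.mem_stabilizer_iff, Matrix.ProjectiveSpecialLinearGroup.smul_proj_mk,
    Projectivization.smul_mk, Projectivization.mk_eq_mk_iff'] at hp'
  obtain ⟨a, ha⟩ := hp'
  change _ = A.1.mulVec (Pi.single 0 1) at ha
  have hA : ∀ i : Fin 2, A.1 i.succ 0 = 0 := by
    intro i
    have := congrFun ha i.succ
    simpa using this.symm
  have hb := eq_blockMat hA
  set q : PParam := (fun i j => A.1 i.succ j.succ, fun j => A.1 0 j.succ)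
  have hdet : A.1 0 0 * pdet q = 1 := by
    rw [pdet, ← det_blockMat, ← hb]
    exact A.2
  have hq : pdet q ≠ 0 := right_ne_zero_of_mul_eq_one hdet
  refine ⟨q, hq, ?_⟩
  rw [toP_of_ne hq]
  congr 2
  apply Subtype.ext
  rw [hb]
  congr 1
  exact eq_inv_of_mul_eq_one_left hdet

/-- The product of the matrices with parameters `q` and `q'`, as a parameter. -/
def mulParam (q q' : PParam) : PParam :=
  (fun i j => ∑ s, q.1 i s * q'.1 s j, fun j => (pdet q)⁻¹ * q'.2 j + ∑ s, q.2 s * q'.1 s j)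

lemma pdet_mulParam (q q' : PParam) : pdet (mulParam q q') = pdet q * pdet q' := by
  simp only [pdet_eq, mulParam, Fin.sum_univ_two]
  ring

lemma toP_mulParam {q q' : PParam} (h : pdet q ≠ 0) (h' : pdet q' ≠ 0) :
    toP (mulParam q q') = toP q * toP q' := by
  have h'' : pdet (mulParam q q') ≠ 0 := by
    rw [pdet_mulParam]; exact mul_ne_zero h h'
  rw [toP_of_ne h, toP_of_ne h', toP_of_ne h'']
  apply Subtype.ext
  have : slBlock (mulParam q q') h'' = slBlock q h * slBlock q' h' := by
    apply Subtype.ext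
    change blockMat (pdet (mulParam q q'))⁻¹ _ = blockMat (pdet q)⁻¹ q * blockMat (pdet q')⁻¹ q'
    rw [pdet_mulParam]
    ext i j
    refine Fin.cases ?_ (fun i => ?_) i <;> refine Fin.cases ?_ (fun j => ?_) j <;>
      simp [Matrix.mul_apply, Fin.sum_univ_succ, mulParam]
    ring
  change ((slBlock (mulParam q q') h'' : Matrix.SpecialLinearGroup (Fin 3) ℂ) : PSL3) = _
  rw [this]
  rfl

/-- `idParam` is idempotent for `mulParam`, and a group has only one idempotent. -/
lemma toP_idParam : toP idParam = 1 := by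
  have h : pdet idParam ≠ 0 := by rw [pdet_idParam]; exact one_ne_zero
  have h1 : mulParam idParam idParam = idParam := by
    ext i
    · simp [mulParam, idParam]
    · simp [mulParam, idParam]
  have h2 := toP_mulParam h h
  rw [h1] at h2
  exact (left_eq_mul.1 h2)

lemma isOpen_pdet_ne : IsOpen {q : PParam | pdet q ≠ 0} := by
  have : Continuous pdet := by
    simp only [funext pdet_eq]
    fun_prop
  exact isOpen_ne.preimage this

section Bundle

variable {M : Type*} [TopologicalSpace M] [ChartedSpace C2 M] [IsManifold 𝓘(ℂ, C2) ω M]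
  {F : Type*} [NormedAddCommGroup F] [NormedSpace ℝ F]
  {B : Type*} [TopologicalSpace B] [ChartedSpace F B] [IsManifold 𝓘(ℝ, F) ∞ B]

namespace CartanGeometry

variable (C : CartanGeometry M F B)

/-! ### The Cartan connection in terms of model vectors -/

/-- The matrix `θ(v)`. -/
def theta (b : B) (v : F) : Matrix (Fin 3) (Fin 3) ℂ := Matrix.of fun i j => C.form i j b v

/-- The derivative of the projection. -/
def projDeriv (b : B) : F →L[ℝ] C2 := mfderiv 𝓘(ℝ, F) 𝓘(ℝ, C2) C.proj b

/-- The derivative of the right translation by `p`. -/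
def translDeriv (p : P) (b : B) : F →L[ℝ] F :=
  mfderiv 𝓘(ℝ, F) 𝓘(ℝ, F) (fun b' => C.act b' p) b

/-- The fundamental vectors at `b`. -/
def fund (b : B) : PParam →L[ℝ] F :=
  mfderiv 𝓘(ℝ, PParam) 𝓘(ℝ, F) (fun q => C.act b (toP q)) idParam

lemma theta_add (b : B) (v w : F) : C.theta b (v + w) = C.theta b v + C.theta b w := by
  ext i j
  exact map_add (C.form i j b) v w

lemma theta_sub (b : B) (v w : F) : C.theta b (v - w) = C.theta b v - C.theta b w := by
  ext i j
  exact map_sub (C.form i j b) v w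

lemma trace_theta (b : B) (v : F) : (C.theta b v).trace = 0 :=
  (C.form_bijOn b).mapsTo (Set.mem_univ v)

lemma theta_injective (b : B) : Function.Injective (C.theta b) := fun _ _ h =>
  (C.form_bijOn b).injOn (Set.mem_univ _) (Set.mem_univ _) h

lemma exists_theta_eq (b : B) {X : Matrix (Fin 3) (Fin 3) ℂ} (hX : X.trace = 0) :
    ∃ v, C.theta b v = X := by
  obtain ⟨v, -, hv⟩ := (C.form_bijOn b).surjOn hX
  exact ⟨v, hv⟩

lemma act_toP_idParam (b : B) : C.act b (toP idParam) = b := by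
  rw [toP_idParam, C.act_one]

lemma theta_fund (b : B) (q : PParam) :
    C.theta b (C.fund b q) = blockMat (-(Matrix.of q.1).trace) q := by
  have h : C.theta (C.act b (toP idParam)) (C.fund b q) = _ := C.fundamental b q
  rwa [act_toP_idParam] at h

/-- The block matrix in `SL(3, ℂ)` with the given parameter. -/
def _root_.CProj.blockOf (q : PParam) : Matrix (Fin 3) (Fin 3) ℂ := blockMat (pdet q)⁻¹ q

/-- Equivariance of `θ` with the inverse matrix cleared, so that its entries can be compared one at
a time. -/
lemma theta_transl {q : PParam} (hq : pdet q ≠ 0) (b : B) (v : F) :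
    blockOf q * C.theta (C.act b (toP q)) (C.translDeriv (toP q) b v) =
      C.theta b v * blockOf q := by
  rw [toP_of_ne hq]
  have h : C.theta (C.act b ⟨(slBlock q hq : PSL3), slBlock_mem q hq⟩)
      (C.translDeriv ⟨(slBlock q hq : PSL3), slBlock_mem q hq⟩ b v) = _ :=
    C.equivariant (slBlock q hq) (slBlock_mem q hq) b v
  rw [h]
  have h1 : blockOf q * (slBlock q hq)⁻¹.1 = 1 := by
    have := congrArg Subtype.val (mul_inv_cancel (slBlock q hq))
    exact this
  rw [← mul_assoc, ← mul_assoc, h1, one_mul]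
  rfl

lemma contMDiffAt_act {b : B} {q : PParam} (hq : pdet q ≠ 0) :
    ContMDiffAt (𝓘(ℝ, F).prod 𝓘(ℝ, PParam)) 𝓘(ℝ, F) ∞
      (fun y : B × PParam => C.act y.1 (toP y.2)) (b, q) :=
  C.act_smooth.contMDiffAt ((isOpen_pdet_ne.preimage continuous_snd).mem_nhds hq)

lemma contMDiff_transl (p : P) : ContMDiff 𝓘(ℝ, F) 𝓘(ℝ, F) ∞ (fun b => C.act b p) := by
  obtain ⟨q, hq, rfl⟩ := exists_toP p
  intro b
  exact ContMDiffAt.comp b (C.contMDiffAt_act hq) (contMDiffAt_id.prodMk contMDiffAt_const)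

lemma contMDiffAt_orbit (b : B) {q : PParam} (hq : pdet q ≠ 0) :
    ContMDiffAt 𝓘(ℝ, PParam) 𝓘(ℝ, F) ∞ (fun q => C.act b (toP q)) q :=
  ContMDiffAt.comp (g := fun y : B × PParam => C.act y.1 (toP y.2)) (f := fun q => (b, q)) q
    (C.contMDiffAt_act hq) (contMDiffAt_const.prodMk contMDiffAt_id)

lemma proj_act (b : B) (p : P) : C.proj (C.act b p) = C.proj b :=
  ((C.proj_eq_iff b (C.act b p)).2 ⟨p, rfl⟩).symm

lemma act_act_inv (b : B) (p : P) : C.act (C.act b p) p⁻¹ = b := by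
  rw [← C.act_mul, mul_inv_cancel, C.act_one]

lemma projDeriv_transl (p : P) (b : B) (v : F) :
    C.projDeriv (C.act b p) (C.translDeriv p b v) = C.projDeriv b v := by
  have h := (((C.proj_smooth (C.act b p)).mdifferentiableAt (by simp)).hasMFDerivAt.comp b
    ((C.contMDiff_transl p b).mdifferentiableAt (by simp)).hasMFDerivAt).mfderiv
  have e : C.proj ∘ (fun b' => C.act b' p) = C.proj := funext fun b' => C.proj_act b' p
  rw [e] at h
  exact (congrArg (fun L : F →L[ℝ] C2 => L v) h).symm

lemma projDeriv_fund (b : B) (q : PParam) : C.projDeriv b (C.fund b q) = 0 := by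
  have hd := (C.contMDiffAt_orbit b (q := idParam)
    (by rw [pdet_idParam]; exact one_ne_zero)).mdifferentiableAt (by simp)
  have h := (((C.proj_smooth (C.act b (toP idParam))).mdifferentiableAt
    (by simp)).hasMFDerivAt.comp idParam hd.hasMFDerivAt).mfderiv
  have e : C.proj ∘ (fun q => C.act b (toP q)) = fun _ => C.proj b :=
    funext fun q => C.proj_act b (toP q)
  rw [e, mfderiv_const] at h
  have h' : C.projDeriv (C.act b (toP idParam)) (C.fund b q) = 0 :=
    (congrArg (fun L : PParam →L[ℝ] C2 => L q) h).symm
  rwa [act_toP_idParam] at h'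

/-- Translation by the inverse element supplies the preimage. Every tangent vector at a translate
can thus be taken to come from the original point. -/
lemma translDeriv_surjective (p : P) (b : B) : Function.Surjective (C.translDeriv p b) := by
  intro w
  have h := (((C.contMDiff_transl p (C.act (C.act b p) p⁻¹)).mdifferentiableAt
    (by simp)).hasMFDerivAt.comp (C.act b p)
    ((C.contMDiff_transl p⁻¹ (C.act b p)).mdifferentiableAt (by simp)).hasMFDerivAt).mfderiv
  have e : (fun b' => C.act b' p) ∘ (fun b' => C.act b' p⁻¹) = id := by
    ext1 b'
    simp only [Function.comp, ← C.act_mul, inv_mul_cancel, C.act_one, id]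
  rw [e, mfderiv_id] at h
  have h' : w = C.translDeriv p (C.act (C.act b p) p⁻¹) (C.translDeriv p⁻¹ (C.act b p) w) :=
    congrArg (fun L : F →L[ℝ] F => L w) h
  rw [act_act_inv] at h'
  exact ⟨_, h'.symm⟩

/-! ### Adapted sections -/

/-- `σ` is a section over the preferred chart at `x₀` with `σ^* θ = φ`. -/
def IsAdapted (D : ComplexLinearConnection M) (x₀ : M) (σ : M → B) : Prop :=
  ContMDiffOn 𝓘(ℝ, C2) 𝓘(ℝ, F) ∞ σ (chartAt C2 x₀).source ∧
    ∀ x ∈ (chartAt C2 x₀).source, C.proj (σ x) = x ∧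
      ∀ v : C2, C.theta (σ x) (mfderiv 𝓘(ℝ, C2) 𝓘(ℝ, F) σ x v) = phi D (chartAt C2 x₀) x v

variable {C} {D : ComplexLinearConnection M}

lemma IsCartanGeometryOf.exists_isAdapted (hC : C.IsCartanGeometryOf D) (x₀ : M) :
    ∃ σ, C.IsAdapted D x₀ σ :=
  hC _ (IsManifold.chart_mem_maximalAtlas x₀)

/-- The derivative of a map from the surface to the bundle. -/
def _root_.CProj.secDeriv (σ : M → B) (x : M) : C2 →L[ℝ] F := mfderiv 𝓘(ℝ, C2) 𝓘(ℝ, F) σ x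

section

variable {x₀ y : M} {σ : M → B}

lemma IsAdapted.contMDiffAt (hσ : C.IsAdapted D x₀ σ) (hy : y ∈ (chartAt C2 x₀).source) :
    ContMDiffAt 𝓘(ℝ, C2) 𝓘(ℝ, F) ∞ σ y :=
  hσ.1.contMDiffAt ((chartAt C2 x₀).open_source.mem_nhds hy)

lemma IsAdapted.proj_eq (hσ : C.IsAdapted D x₀ σ) (hy : y ∈ (chartAt C2 x₀).source) :
    C.proj (σ y) = y := (hσ.2 y hy).1

lemma IsAdapted.theta_secDeriv (hσ : C.IsAdapted D x₀ σ) (hy : y ∈ (chartAt C2 x₀).source)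
    (u : C2) : C.theta (σ y) (secDeriv σ y u) = phi D (chartAt C2 x₀) y u :=
  (hσ.2 y hy).2 u

lemma IsAdapted.projDeriv_secDeriv (hσ : C.IsAdapted D x₀ σ) (hy : y ∈ (chartAt C2 x₀).source)
    (u : C2) : C.projDeriv (σ y) (secDeriv σ y u) = u := by
  have h := (((C.proj_smooth (σ y)).mdifferentiableAt (by simp)).hasMFDerivAt.comp y
    ((hσ.contMDiffAt hy).mdifferentiableAt (by simp)).hasMFDerivAt)
  have e : id =ᶠ[𝓝 y] C.proj ∘ σ := by
    filter_upwards [(chartAt C2 x₀).open_source.mem_nhds hy] with x hx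
    exact (hσ.proj_eq hx).symm
  have h' := (h.congr_of_eventuallyEq e).mfderiv
  rw [mfderiv_id] at h'
  exact (congrArg (fun L : C2 →L[ℝ] C2 => L u) h').symm

lemma phi_succ_zero (D : ComplexLinearConnection M) (x₀ y : M) (u : C2) (i : Fin 2) :
    phi D (chartAt C2 x₀) y u i.succ 0 = chartDeriv x₀ y u i := rfl

lemma phi_zero_zero (D : ComplexLinearConnection M) (x₀ y : M) (u : C2) :
    phi D (chartAt C2 x₀) y u 0 0 = 0 := rfl

lemma phi_succ_succ (D : ComplexLinearConnection M) (x₀ y : M) (u : C2) (i j : Fin 2) :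
    phi D (chartAt C2 x₀) y u i.succ j.succ =
      ∑ k, projInv D (chartAt C2 x₀) y i j k * chartDeriv x₀ y u k := rfl

/-- Subtract the vector along the section with the same `θ^i_0`. The remainder has a block upper
triangular value under `θ`, with corner fixed by trace zero, so it has the same value as a
fundamental vector and equals it because `θ` is injective. -/
lemma IsAdapted.exists_decomp (hσ : C.IsAdapted D x₀ σ) (hy : y ∈ (chartAt C2 x₀).source)
    (v : F) : ∃ (u : C2) (q : PParam), v = secDeriv σ y u + C.fund (σ y) q := by
  set X := C.theta (σ y) v
  obtain ⟨u, hu⟩ : ∃ u : C2, chartDeriv x₀ y u = fun i => X i.succ 0 :=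
    ⟨_, chartDeriv_coordField hy _⟩
  set Y := C.theta (σ y) (v - secDeriv σ y u) with hY
  have hY0 : ∀ i : Fin 2, Y i.succ 0 = 0 := by
    intro i
    rw [hY, theta_sub, hσ.theta_secDeriv hy, Matrix.sub_apply, phi_succ_zero, hu]
    exact sub_self _
  have htr : Y.trace = 0 := C.trace_theta _ _
  refine ⟨u, (fun i j => Y i.succ j.succ, fun j => Y 0 j.succ), ?_⟩
  rw [← sub_eq_iff_eq_add']
  apply C.theta_injective (σ y)
  rw [C.theta_fund]
  refine (eq_blockMat hY0).trans ?_
  congr 1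
  rw [Matrix.trace, Fin.sum_univ_succ] at htr
  exact eq_neg_of_add_eq_zero_left htr

/-- Both sides vanish on fundamental vectors and agree along the section. Thus at points of the
section `θ^i_0` is the pullback of `dz^i`. -/
lemma IsAdapted.sol_eq (hσ : C.IsAdapted D x₀ σ) (hy : y ∈ (chartAt C2 x₀).source) (v : F)
    (i : Fin 2) : C.sol i (σ y) v = chartDeriv x₀ y (C.projDeriv (σ y) v) i := by
  obtain ⟨u, q, rfl⟩ := hσ.exists_decomp hy v
  rw [map_add, hσ.projDeriv_secDeriv hy, C.projDeriv_fund, add_zero]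
  change C.theta (σ y) (secDeriv σ y u + C.fund (σ y) q) i.succ 0 = _
  rw [theta_add, hσ.theta_secDeriv hy, C.theta_fund, Matrix.add_apply, phi_succ_zero,
    blockMat_succ_zero, add_zero]

end

end CartanGeometry

end Bundle

/-! ### Algebra of the transformation laws -/

/-- The matrix `aᵀ m ā`. -/
def conjTr (a : Fin 2 → Fin 2 → ℂ) (m : Matrix (Fin 2) (Fin 2) ℂ) : Matrix (Fin 2) (Fin 2) ℂ :=
  Matrix.of fun i j => ∑ s, ∑ t, a s i * m s t * conj (a t j)

/-- The right-hand side of the differential system, as a function of `θ(v)`. -/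
def sysRHS (h : Matrix (Fin 2) (Fin 2) ℂ) (k : Fin 2 → ℂ) (X : Matrix (Fin 3) (Fin 3) ℂ)
    (i j : Fin 2) : ℂ :=
  h i j * (X 0 0 + conj (X 0 0)) + ∑ s : Fin 2, h i s * conj (X s.succ j.succ)
    + ∑ s : Fin 2, h s j * X s.succ i.succ
    + k i * conj (∑ s : Fin 2, eps s j * X s.succ 0)
    + conj (k j) * ∑ s : Fin 2, eps s i * X s.succ 0

/-- The part of type `(1, 0)` of the right-hand side of the differential system. -/
def sysHol (h : Matrix (Fin 2) (Fin 2) ℂ) (k : Fin 2 → ℂ) (X : Matrix (Fin 3) (Fin 3) ℂ)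
    (i j : Fin 2) : ℂ :=
  h i j * X 0 0 + ∑ s : Fin 2, h s j * X s.succ i.succ
    + conj (k j) * ∑ s : Fin 2, eps s i * X s.succ 0

lemma isHermitian_apply {h : Matrix (Fin 2) (Fin 2) ℂ} (hh : h.IsHermitian) (i j : Fin 2) :
    conj (h i j) = h j i := hh.apply j i

/-- For hermitian `h` the system is the hermitian symmetrization of its `(1, 0)` part, so
transformation laws need only be checked on that half. -/
lemma sysRHS_eq {h : Matrix (Fin 2) (Fin 2) ℂ} (hh : h.IsHermitian) (k : Fin 2 → ℂ)
    (X : Matrix (Fin 3) (Fin 3) ℂ) (i j : Fin 2) :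
    sysRHS h k X i j = sysHol h k X i j + conj (sysHol h k X j i) := by
  simp only [sysRHS, sysHol, map_add, map_mul, map_sum, isHermitian_apply hh, Complex.conj_conj]
  ring

lemma sysRHS_add (h : Matrix (Fin 2) (Fin 2) ℂ) (k : Fin 2 → ℂ)
    (X Y : Matrix (Fin 3) (Fin 3) ℂ) (i j : Fin 2) :
    sysRHS h k (X + Y) i j = sysRHS h k X i j + sysRHS h k Y i j := by
  simp only [sysRHS, Matrix.add_apply, map_add, map_mul, Fin.sum_univ_two]
  ring

lemma conjTr_isHermitian (a : Fin 2 → Fin 2 → ℂ) {m : Matrix (Fin 2) (Fin 2) ℂ}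
    (hm : m.IsHermitian) : (conjTr a m).IsHermitian := by
  ext i j
  simp only [Matrix.conjTranspose_apply, conjTr, Matrix.of_apply, Complex.star_def, map_add,
    map_mul, isHermitian_apply hm, Complex.conj_conj, Fin.sum_univ_two]
  ring

/-- The transformation of the functions `h_{i\bar j}` under the element of `P` given by `q`. -/
def hTransl (q : PParam) (h : Matrix (Fin 2) (Fin 2) ℂ) : Matrix (Fin 2) (Fin 2) ℂ :=
  (pdet q * conj (pdet q))⁻¹ • conjTr q.1 h

/-- The transformation of the functions `g_{i\bar j}` under the element of `P` given by `q`. -/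
def gTransl (q : PParam) (g : Matrix (Fin 2) (Fin 2) ℂ) : Matrix (Fin 2) (Fin 2) ℂ :=
  (pdet q * conj (pdet q)) • conjTr q.1 g

/-- The transformation of the functions `h_i` under the element of `P` given by `q`. -/
def kTransl (q : PParam) (h : Matrix (Fin 2) (Fin 2) ℂ) (k : Fin 2 → ℂ) (j : Fin 2) : ℂ :=
  (pdet q)⁻¹ * conj (pdet q) * ∑ l, k l * q.1 l j
    - conj (pdet q) * (conj (q.2 1) * hTransl q h j 0 - conj (q.2 0) * hTransl q h j 1)

lemma smul_isHermitian {c : ℂ} (hc : conj c = c) {m : Matrix (Fin 2) (Fin 2) ℂ}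
    (hm : m.IsHermitian) : (c • m).IsHermitian := by
  ext i j
  simp [Matrix.conjTranspose_apply, hc, isHermitian_apply hm]

lemma hTransl_isHermitian (q : PParam) {h : Matrix (Fin 2) (Fin 2) ℂ} (hh : h.IsHermitian) :
    (hTransl q h).IsHermitian :=
  smul_isHermitian (by simp [mul_comm]) (conjTr_isHermitian _ hh)

lemma gTransl_isHermitian (q : PParam) {h : Matrix (Fin 2) (Fin 2) ℂ} (hh : h.IsHermitian) :
    (gTransl q h).IsHermitian :=
  smul_isHermitian (by simp [mul_comm]) (conjTr_isHermitian _ hh)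

/-! ### Transformation of the differential system under the structure group -/

section Block

variable {q : PParam} {X X' : Matrix (Fin 3) (Fin 3) ℂ}

lemma block_succ_zero (hq : pdet q ≠ 0) (h : blockOf q * X' = X * blockOf q) (i : Fin 2) :
    X i.succ 0 = pdet q * ∑ s, q.1 i s * X' s.succ 0 := by
  have := congrFun (congrFun h i.succ) 0
  simp only [Matrix.mul_apply, Fin.sum_univ_succ (n := 2), blockOf, blockMat_zero_zero,
    blockMat_succ_zero, blockMat_succ_succ] at this
  simp only [zero_mul, zero_add, mul_zero, Finset.sum_const_zero, add_zero] at this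
  rw [this]
  field_simp

lemma block_succ_succ (h : blockOf q * X' = X * blockOf q) (i j : Fin 2) :
    ∑ s, q.1 i s * X' s.succ j.succ = X i.succ 0 * q.2 j + ∑ s, X i.succ s.succ * q.1 s j := by
  have := congrFun (congrFun h i.succ) j.succ
  simp only [Matrix.mul_apply, Fin.sum_univ_succ (n := 2), blockOf, blockMat_zero_succ,
    blockMat_succ_zero, blockMat_succ_succ] at this
  simpa only [zero_mul, zero_add] using this

lemma block_zero_zero (hq : pdet q ≠ 0) (h : blockOf q * X' = X * blockOf q) :
    X' 0 0 = X 0 0 - pdet q * ∑ s, q.2 s * X' s.succ 0 := by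
  have := congrFun (congrFun h 0) 0
  simp only [Matrix.mul_apply, Fin.sum_univ_succ (n := 2), blockOf, blockMat_zero_zero,
    blockMat_zero_succ, blockMat_succ_zero] at this
  simp only [mul_zero, Finset.sum_const_zero, add_zero] at this
  field_simp at this
  linear_combination this

/-- Two facts about `ε` are behind this. The `k` terms match because `aᵀ ε a = det a · ε`. The terms
linear in `b` leave an expression `b_i h_{sj} - b_s h_{ij}` skew in `i` and `s`, hence a multiple of
`ε_{si}`, and the inhomogeneous part of `kTransl` cancels precisely that multiple. -/
lemma sysHol_transl (hq : pdet q ≠ 0) (h : blockOf q * X' = X * blockOf q)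
    {m : Matrix (Fin 2) (Fin 2) ℂ} (hm : m.IsHermitian) (k : Fin 2 → ℂ) (i j : Fin 2) :
    sysHol (hTransl q m) (kTransl q m k) X' i j =
      (pdet q * conj (pdet q))⁻¹ * ∑ s, ∑ t, q.1 s i * sysHol m k X s t * conj (q.1 t j) := by
  have hq' : conj (pdet q) ≠ 0 := by simpa using hq
  have e0 := block_zero_zero hq h
  have e1 := block_succ_zero hq h
  have e2 := block_succ_succ h
  have hk : conj (kTransl q m k j) =
      (conj (pdet q))⁻¹ * pdet q * ∑ l, conj (k l) * conj (q.1 l j)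
      - pdet q * (q.2 1 * hTransl q m 0 j - q.2 0 * hTransl q m 1 j) := by
    simp only [kTransl, map_sub, map_mul, map_sum, map_inv₀, Complex.conj_conj,
      isHermitian_apply (hTransl_isHermitian q hm)]
  have e3 : ∑ s : Fin 2, hTransl q m s j * X' s.succ i.succ =
      (pdet q * conj (pdet q))⁻¹ * ∑ s, ∑ t, (X s.succ 0 * q.2 i + ∑ l, X s.succ l.succ * q.1 l i) *
        m s t * conj (q.1 t j) := by
    simp only [← e2]
    simp only [hTransl, conjTr, Matrix.smul_apply, Matrix.of_apply, smul_eq_mul,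
      Fin.sum_univ_two]
    ring
  simp only [sysHol, e3, hk, e0]
  simp only [hTransl, conjTr, Matrix.smul_apply, Matrix.of_apply, smul_eq_mul]
  simp only [e1, Fin.sum_univ_two]
  -- The determinant and its conjugate are kept as independent variables while denominators are
  -- cleared; only then is the determinant expanded.
  have hd := pdet_eq q
  generalize pdet q = δ at *
  generalize conj δ = δ' at *
  fin_cases i <;> simp [eps] <;> field_simp <;> rw [hd] <;> ring

lemma sysRHS_transl (hq : pdet q ≠ 0) (h : blockOf q * X' = X * blockOf q)
    {m : Matrix (Fin 2) (Fin 2) ℂ} (hm : m.IsHermitian) (k : Fin 2 → ℂ) (i j : Fin 2) :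
    sysRHS (hTransl q m) (kTransl q m k) X' i j =
      hTransl q (Matrix.of (sysRHS m k X)) i j := by
  rw [sysRHS_eq (hTransl_isHermitian q hm), sysHol_transl hq h hm, sysHol_transl hq h hm]
  simp only [hTransl, conjTr, Matrix.smul_apply, Matrix.of_apply, smul_eq_mul, sysRHS_eq hm,
    map_mul, map_inv₀, map_add, Complex.conj_conj, Fin.sum_univ_two]
  ring

end Block

lemma hermDet_eq {m : Matrix (Fin 2) (Fin 2) ℂ} (hm : m.IsHermitian) :
    (hermDet m : ℂ) = m 0 0 * m 1 1 - m 0 1 * m 1 0 := by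
  have h0 := isHermitian_apply hm 0 0
  have h1 := isHermitian_apply hm 1 1
  have h2 := isHermitian_apply hm 0 1
  rw [← h2, Complex.mul_conj]
  have h3 : ((m 0 0 * m 1 1).re : ℂ) = m 0 0 * m 1 1 :=
    Complex.conj_eq_iff_re.1 (by rw [map_mul, h0, h1])
  rw [hermDet, Complex.ofReal_sub, h3]

lemma hermDet_smul (c : ℝ) (m : Matrix (Fin 2) (Fin 2) ℂ) :
    hermDet ((c : ℂ) • m) = c ^ 2 * hermDet m := by
  simp only [hermDet, Matrix.smul_apply, smul_eq_mul]
  have : (c : ℂ) * m 0 0 * (c * m 1 1) = ((c ^ 2 : ℝ) : ℂ) * (m 0 0 * m 1 1) := by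
    push_cast; ring
  rw [this, Complex.re_ofReal_mul, Complex.normSq_mul, Complex.normSq_ofReal]
  ring

lemma hermDet_conjTr (q : PParam) {m : Matrix (Fin 2) (Fin 2) ℂ} (hm : m.IsHermitian) :
    hermDet (conjTr q.1 m) = Complex.normSq (pdet q) * hermDet m := by
  have : (hermDet (conjTr q.1 m) : ℂ) = ((Complex.normSq (pdet q) * hermDet m : ℝ) : ℂ) := by
    rw [Complex.ofReal_mul, hermDet_eq hm, hermDet_eq (conjTr_isHermitian _ hm),
      ← Complex.mul_conj, pdet_eq]
    simp only [conjTr, Matrix.of_apply, Fin.sum_univ_two, map_sub, map_mul]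
    ring
  exact_mod_cast this

lemma gTransl_eq (q : PParam) (m : Matrix (Fin 2) (Fin 2) ℂ) :
    gTransl q m = ((Complex.normSq (pdet q) : ℝ) : ℂ) • conjTr q.1 m := by
  rw [gTransl, Complex.mul_conj]

lemma hTransl_eq (q : PParam) (m : Matrix (Fin 2) (Fin 2) ℂ) :
    hTransl q m = (((Complex.normSq (pdet q))⁻¹ : ℝ) : ℂ) • conjTr q.1 m := by
  rw [hTransl, Complex.mul_conj, Complex.ofReal_inv]

lemma conjTr_smul (a : Fin 2 → Fin 2 → ℂ) (c : ℂ) (m : Matrix (Fin 2) (Fin 2) ℂ) :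
    conjTr a (c • m) = c • conjTr a m := by
  ext i j
  simp only [conjTr, Matrix.of_apply, Matrix.smul_apply, smul_eq_mul, Fin.sum_univ_two]
  ring

/-- The rescaling from a metric to a solution of the differential system is equivariant. -/
lemma rescale_gTransl {q : PParam} (hq : pdet q ≠ 0) {m : Matrix (Fin 2) (Fin 2) ℂ}
    (hm : m.IsHermitian) :
    ((|hermDet (gTransl q m)| ^ (-2 / 3 : ℝ) : ℝ) : ℂ) • gTransl q m =
      hTransl q (((|hermDet m| ^ (-2 / 3 : ℝ) : ℝ) : ℂ) • m) := by
  set n := Complex.normSq (pdet q)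
  have hn : 0 < n := Complex.normSq_pos.2 hq
  -- Two factors `n` come from the scalar and one from `aᵀ m ā`. The power `-2/3` turns `n³` into
  -- `n⁻²`, and with the remaining factor `n` of `gTransl` this is the factor `n⁻¹` of `hTransl`.
  have h1 : hermDet (gTransl q m) = n ^ 3 * hermDet m := by
    rw [gTransl_eq, hermDet_smul, hermDet_conjTr q hm]
    ring
  have h2 : |n ^ 3 * hermDet m| ^ (-2 / 3 : ℝ) = (n ^ 2)⁻¹ * |hermDet m| ^ (-2 / 3 : ℝ) := by
    rw [abs_mul, abs_of_pos (pow_pos hn 3), Real.mul_rpow (pow_pos hn 3).le (abs_nonneg _),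
      ← Real.rpow_natCast n 3, ← Real.rpow_mul hn.le]
    norm_num
  rw [h1, h2, gTransl_eq, hTransl_eq, conjTr_smul, smul_smul, smul_smul]
  congr 1
  rw [← Complex.ofReal_mul, ← Complex.ofReal_mul]
  congr 1
  change (n ^ 2)⁻¹ * _ * n = n⁻¹ * _
  field_simp

/-- The rescaling from a solution of the differential system to a metric is equivariant. -/
lemma rescale_hTransl {q : PParam} (hq : pdet q ≠ 0) {m : Matrix (Fin 2) (Fin 2) ℂ}
    (hm : m.IsHermitian) :
    ((hermDet (hTransl q m) ^ (-2 : ℤ) : ℝ) : ℂ) • hTransl q m =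
      gTransl q (((hermDet m ^ (-2 : ℤ) : ℝ) : ℂ) • m) := by
  set n := Complex.normSq (pdet q)
  have hn : n ≠ 0 := (Complex.normSq_pos.2 hq).ne'
  -- Here the determinant scales by `n⁻² · n`. Its power `-2` gives `n²`, which turns the factor
  -- `n⁻¹` of `hTransl` into the factor `n` of `gTransl`.
  have h1 : hermDet (hTransl q m) = n⁻¹ * hermDet m := by
    rw [hTransl_eq, hermDet_smul, hermDet_conjTr q hm]
    change n⁻¹ ^ 2 * (n * _) = _
    field_simp
  rw [h1, gTransl_eq, hTransl_eq, conjTr_smul, smul_smul, smul_smul]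
  congr 1
  rw [← Complex.ofReal_mul, ← Complex.ofReal_mul]
  congr 1
  change (n⁻¹ * hermDet m) ^ (-2 : ℤ) * n⁻¹ = n * _
  clear_value n
  rw [mul_zpow]
  simp only [zpow_neg, inv_zpow', inv_inv]
  have : n ^ 2 * n⁻¹ = n := by field_simp
  norm_num
  linear_combination (hermDet m ^ 2)⁻¹ * this

/-! ### Calculus on manifolds -/

section Calculus

variable {F : Type*} [NormedAddCommGroup F] [NormedSpace ℝ F]
  {B : Type*} [TopologicalSpace B] [ChartedSpace F B]
  {V W : Type*} [NormedAddCommGroup V] [NormedSpace ℝ V] [NormedAddCommGroup W] [NormedSpace ℝ W]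

lemma mvfderiv_clm_comp (L : V →L[ℝ] W) {f : B → V} {b : B}
    (hf : MDifferentiableAt 𝓘(ℝ, F) 𝓘(ℝ, V) f b) (v : F) :
    mvfderiv 𝓘(ℝ, F) (fun b' => L (f b')) b v = L (mvfderiv 𝓘(ℝ, F) f b v) := by
  have h := (L.hasMFDerivAt.comp b hf.hasMFDerivAt).mfderiv
  exact congrArg (fun L : F →L[ℝ] W => L v) h

/-- Inverse function theorem: `Φ` is invertible near `e` with smooth inverse, and `k` is `k ∘ Φ`
composed with that inverse. -/
lemma contMDiffAt_of_comp [CompleteSpace F] [IsManifold 𝓘(ℝ, F) ∞ B] [CompleteSpace V]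
    {Φ : V → B} {e : V}
    (hΦ : ContMDiffAt 𝓘(ℝ, V) 𝓘(ℝ, F) ∞ Φ e)
    (hbij : Function.Bijective (mfderiv 𝓘(ℝ, V) 𝓘(ℝ, F) Φ e)) {k : B → W}
    (hk : ContDiffAt ℝ ∞ (k ∘ Φ) e) : ContMDiffAt 𝓘(ℝ, F) 𝓘(ℝ, W) ∞ k (Φ e) := by
  set χ := chartAt F (Φ e)
  have hs := mem_chart_source F (Φ e)
  have hχ : ContMDiffAt 𝓘(ℝ, F) 𝓘(ℝ, F) ∞ χ (Φ e) :=
    contMDiffOn_chart.contMDiffAt (χ.open_source.mem_nhds hs)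
  have hG : ContDiffAt ℝ ∞ (χ ∘ Φ) e := contMDiffAt_iff_contDiffAt.1 (ContMDiffAt.comp e hχ hΦ)
  have hχ' : mfderiv 𝓘(ℝ, F) 𝓘(ℝ, F) χ (Φ e) = ContinuousLinearMap.id ℝ F := by
    have : IsManifold 𝓘(ℝ, F) 1 B := IsManifold.of_le (n := ∞) (by simp)
    have h := mfderiv_extChartAt_self (I := 𝓘(ℝ, F)) (x := Φ e)
    simp only [mfld_simps] at h
    exact h
  set Λ : V →L[ℝ] F := mfderiv 𝓘(ℝ, V) 𝓘(ℝ, F) Φ e with hΛ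
  have hG' : HasFDerivAt (χ ∘ Φ) Λ e := by
    have h := (hχ.mdifferentiableAt (by simp)).hasMFDerivAt.comp e
      (hΦ.mdifferentiableAt (by simp)).hasMFDerivAt
    rw [hχ'] at h
    exact hasMFDerivAt_iff_hasFDerivAt.1 h
  let Le : V ≃L[ℝ] F := ContinuousLinearEquiv.ofBijective Λ
    (LinearMap.ker_eq_bot.2 hbij.1) (LinearMap.range_eq_top.2 hbij.2)
  have hG'' : HasFDerivAt (χ ∘ Φ) (Le : V →L[ℝ] F) e := by
    convert hG'
    ext v
    rfl
  have hn : (∞ : ℕ∞ω) ≠ 0 := by simp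
  have hinv := hG.to_localInverse hG'' hn
  have hsd := hG.hasStrictFDerivAt' hG'' hn
  have hright := hsd.eventually_right_inverse
  have hcont : Filter.Tendsto (hG.localInverse hG'' hn) (𝓝 ((χ ∘ Φ) e)) (𝓝 e) := by
    have := hinv.continuousAt.tendsto
    rwa [hG.localInverse_apply_image hG'' hn] at this
  have hsrc : ∀ᶠ w in 𝓝 ((χ ∘ Φ) e), Φ (hG.localInverse hG'' hn w) ∈ χ.source :=
    hcont.eventually (hΦ.continuousAt.eventually (χ.open_source.mem_nhds hs))
  have hev : k ∘ χ.symm =ᶠ[𝓝 ((χ ∘ Φ) e)] (k ∘ Φ) ∘ hG.localInverse hG'' hn := by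
    filter_upwards [hright, hsrc] with w h1 h2
    have h3 : χ (Φ (hG.localInverse hG'' hn w)) = w := h1
    simp only [Function.comp]
    conv_lhs => rw [← h3, χ.left_inv h2]
  have hkχ : ContDiffAt ℝ ∞ (k ∘ χ.symm) (χ (Φ e)) := by
    refine ContDiffAt.congr_of_eventuallyEq ?_ hev
    refine ContDiffAt.comp _ ?_ hinv
    have hi := hG.localInverse_apply_image hG'' hn
    change ContDiffAt ℝ ∞ (k ∘ Φ) (hG.localInverse hG'' hn ((χ ∘ Φ) e))
    rwa [hi]
  refine (ContMDiffAt.comp (Φ e) (contMDiffAt_iff_contDiffAt.2 hkχ) hχ).congr_of_eventuallyEq ?_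
  filter_upwards [χ.open_source.mem_nhds hs] with b hb
  simp [hb]

end Calculus

/-! ### Uniqueness and equivariance of pullback coefficients and of solutions -/

section Bundle

variable {M : Type*} [TopologicalSpace M] [ChartedSpace C2 M] [IsManifold 𝓘(ℂ, C2) ω M]
  {F : Type*} [NormedAddCommGroup F] [NormedSpace ℝ F]
  {B : Type*} [TopologicalSpace B] [ChartedSpace F B] [IsManifold 𝓘(ℝ, F) ∞ B]

namespace CartanGeometry

variable (C : CartanGeometry M F B)

/-- The pullback of the bilinear form `β` on `T_xM` to `b` is `f_{i\bar j} θ^i_0 ∘ conj θ^j_0`. -/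
def PullbackAt (β : C2 → C2 → ℝ) (b : B) (f : Matrix (Fin 2) (Fin 2) ℂ) : Prop :=
  ∀ v w : F, ((β (C.projDeriv b v) (C.projDeriv b w) : ℝ) : ℂ) =
    ∑ i, ∑ j, f i j * ((C.sol i b v * conj (C.sol j b w) + C.sol i b w * conj (C.sol j b v)) / 2)

lemma sol_eq_theta (i : Fin 2) (b : B) (v : F) : C.sol i b v = C.theta b v i.succ 0 := rfl

lemma exists_sol_eq (b : B) (η : C2) : ∃ v : F, ∀ i, C.sol i b v = η i := by
  obtain ⟨v, hv⟩ := C.exists_theta_eq b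
    (X := Matrix.of (Fin.cons 0 (fun i => Fin.cons (η i) 0))) (by
      rw [Matrix.trace, Fin.sum_univ_succ]
      simp)
  refine ⟨v, fun i => ?_⟩
  rw [sol_eq_theta, hv]
  rfl

variable {C}

/-- The forms `θ^i_0` take arbitrary values at `b`. Basis vectors determine `f_{ij} + f_{ji}`, and
multiplying the second one by `i` determines `f_{ij} - f_{ji}` when the indices differ. -/
lemma PullbackAt.unique {β : C2 → C2 → ℝ} {b : B} {f f' : Matrix (Fin 2) (Fin 2) ℂ}
    (h : C.PullbackAt β b f) (h' : C.PullbackAt β b f') : f = f' := by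
  have key : ∀ η ζ : C2, ∑ i, ∑ j, f i j * ((η i * conj (ζ j) + ζ i * conj (η j)) / 2) =
      ∑ i, ∑ j, f' i j * ((η i * conj (ζ j) + ζ i * conj (η j)) / 2) := by
    intro η ζ
    obtain ⟨v, hv⟩ := C.exists_sol_eq b η
    obtain ⟨w, hw⟩ := C.exists_sol_eq b ζ
    have := (h v w).symm.trans (h' v w)
    simpa only [hv, hw] using this
  ext i j
  have h1 := key (Pi.single i 1) (Pi.single j 1)
  have h2 := key (Pi.single i 1) (Pi.single j Complex.I)
  have hI := Complex.I_mul_I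
  fin_cases i <;> fin_cases j <;> simp [Fin.sum_univ_two, Complex.conj_I] at h1 h2 ⊢ <;>
    grind

lemma PullbackAt.transl {β : C2 → C2 → ℝ} {b : B} {f : Matrix (Fin 2) (Fin 2) ℂ}
    (h : C.PullbackAt β b f) {q : PParam} (hq : pdet q ≠ 0) :
    C.PullbackAt β (C.act b (toP q)) (gTransl q f) := by
  intro v w
  obtain ⟨v, rfl⟩ := C.translDeriv_surjective (toP q) b v
  obtain ⟨w, rfl⟩ := C.translDeriv_surjective (toP q) b w
  rw [projDeriv_transl, projDeriv_transl, h v w]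
  have hv := block_succ_zero hq (C.theta_transl hq b v)
  have hw := block_succ_zero hq (C.theta_transl hq b w)
  simp only [sol_eq_theta, hv, hw, gTransl, conjTr, Matrix.smul_apply, Matrix.of_apply,
    smul_eq_mul, Fin.sum_univ_two, map_mul, map_add]
  ring

lemma isPullback_iff {g : PseudoKahlerMetric M} {f : B → Matrix (Fin 2) (Fin 2) ℂ} :
    C.IsPullback g f ↔ ∀ b, C.PullbackAt (fun v w => g.inner (C.proj b) v w) b (f b) :=
  Iff.rfl

variable (C) in
/-- The differential system at the point `b`. -/
def SolvesAt (h : B → Matrix (Fin 2) (Fin 2) ℂ) (b : B) (κ : Fin 2 → ℂ) : Prop :=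
  ∀ (i j : Fin 2) (v : F), mvfderiv 𝓘(ℝ, F) (fun b' => h b' i j) b v =
    sysRHS (h b) κ (C.theta b v) i j

lemma solvesSystem_iff {h : B → Matrix (Fin 2) (Fin 2) ℂ} {k : B → Fin 2 → ℂ} :
    C.SolvesSystem h k ↔ ∀ b, C.SolvesAt h b (k b) :=
  ⟨fun H b i j v => H i j b v, fun H i j b v => H b i j v⟩

/-- In a diagonal equation `κ_i` enters only through the real part of `κ_i` times the conjugate of
`ε_{si} θ^s_0`. This complex number is arbitrary, so testing it at a real and an imaginary value
determines `κ_i`; the index `s` must differ from `i` for `ε` not to vanish. -/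
lemma SolvesAt.unique {h : B → Matrix (Fin 2) (Fin 2) ℂ} {b : B} {κ κ' : Fin 2 → ℂ}
    (H : C.SolvesAt h b κ) (H' : C.SolvesAt h b κ') : κ = κ' := by
  have key : ∀ (i : Fin 2) (η : C2),
      κ i * conj (∑ s, eps s i * η s) + conj (κ i) * ∑ s, eps s i * η s =
      κ' i * conj (∑ s, eps s i * η s) + conj (κ' i) * ∑ s, eps s i * η s := by
    intro i η
    obtain ⟨v, hv⟩ := C.exists_sol_eq b η
    have := (H i i v).symm.trans (H' i i v)
    simp only [sol_eq_theta] at hv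
    simp only [sysRHS, hv] at this
    linear_combination this
  have hI := Complex.I_mul_I
  ext i
  fin_cases i
  · have h1 := key 0 (Pi.single 1 1)
    have h2 := key 0 (Pi.single 1 Complex.I)
    simp [Fin.sum_univ_two, eps] at h1 h2 ⊢
    grind
  · have h1 := key 1 (Pi.single 0 1)
    have h2 := key 1 (Pi.single 0 Complex.I)
    simp [Fin.sum_univ_two, eps] at h1 h2 ⊢
    grind

lemma contMDiffAt_matrix {h : B → Fin 2 → Fin 2 → ℂ} {b : B}
    (hh : ∀ i j, ContMDiffAt 𝓘(ℝ, F) 𝓘(ℝ, ℂ) ∞ (fun b => h b i j) b) :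
    ContMDiffAt 𝓘(ℝ, F) 𝓘(ℝ, Fin 2 → Fin 2 → ℂ) ∞ h b :=
  contMDiffAt_pi_space.2 fun i => contMDiffAt_pi_space.2 fun j => hh i j

/-- `hTransl` as a linear function of the matrix. -/
def _root_.CProj.hTranslCLM (q : PParam) (i j : Fin 2) : (Fin 2 → Fin 2 → ℂ) →L[ℝ] ℂ :=
  LinearMap.toContinuousLinearMap
    { toFun := fun m => hTransl q (Matrix.of m) i j
      map_add' := fun m m' => by
        simp only [hTransl, conjTr, Matrix.smul_apply, Matrix.of_apply, smul_eq_mul,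
          Fin.sum_univ_two, Pi.add_apply]
        ring
      map_smul' := fun c m => by
        simp only [hTransl, conjTr, Matrix.smul_apply, Matrix.of_apply, smul_eq_mul,
          Fin.sum_univ_two, Pi.smul_apply, Complex.real_smul, RingHom.id_apply]
        ring }

/-- For fixed `q` the law of `h` is real linear, so it passes through the derivative and
`sysRHS_transl` applies. -/
lemma SolvesAt.transl {h : B → Matrix (Fin 2) (Fin 2) ℂ} {b : B} {κ : Fin 2 → ℂ}
    (H : C.SolvesAt h b κ) (hherm : (h b).IsHermitian) {q : PParam} (hq : pdet q ≠ 0)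
    (hh : ∀ i j, ContMDiff 𝓘(ℝ, F) 𝓘(ℝ, ℂ) ∞ (fun b => h b i j))
    (hlaw : ∀ b', h (C.act b' (toP q)) = hTransl q (h b')) :
    C.SolvesAt h (C.act b (toP q)) (kTransl q (h b) κ) := by
  intro i j w
  obtain ⟨v, rfl⟩ := C.translDeriv_surjective (toP q) b w
  have hm : MDifferentiableAt 𝓘(ℝ, F) 𝓘(ℝ, Fin 2 → Fin 2 → ℂ)
      (fun b i j => h b i j) b :=
    (contMDiffAt_matrix fun i j => hh i j b).mdifferentiableAt (by simp)
  have hcomp : mvfderiv 𝓘(ℝ, F) (fun b' => h (C.act b' (toP q)) i j) b v =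
      mvfderiv 𝓘(ℝ, F) (fun b' => h b' i j) (C.act b (toP q)) (C.translDeriv (toP q) b v) := by
    have := (((hh i j (C.act b (toP q))).mdifferentiableAt (by simp)).hasMFDerivAt.comp b
      ((C.contMDiff_transl (toP q) b).mdifferentiableAt (by simp)).hasMFDerivAt).mfderiv
    exact congrArg (fun L : F →L[ℝ] ℂ => L v) this
  rw [← hcomp, hlaw b, sysRHS_transl hq (C.theta_transl hq b v) hherm]
  simp only [hlaw]
  have e1 := mvfderiv_clm_comp (hTranslCLM q i j) hm v
  have e2 : (mvfderiv 𝓘(ℝ, F) (fun b i j => h b i j) b v) =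
      sysRHS (h b) κ (C.theta b v) := by
    ext i j
    rw [← H i j v]
    exact (mvfderiv_clm_comp ((ContinuousLinearMap.proj (R := ℝ) j).comp
      (ContinuousLinearMap.proj (R := ℝ) (φ := fun _ : Fin 2 => Fin 2 → ℂ) i)) hm v).symm
  rw [e2] at e1
  exact e1

end CartanGeometry

end Bundle

/-! ### Vertical directions and smoothness by local trivialization -/

lemma pdet_idParam_ne : pdet idParam ≠ 0 := by
  rw [pdet_idParam]
  exact one_ne_zero

/-- Differentiating the determinant factor at the identity gives `-tr a` and its conjugate, which
are the corner terms of the system. The value of `κ` is irrelevant because the first column of an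
element of the Lie algebra of `P` vanishes below the corner. -/
lemma hasDerivAt_hTransl (m : Matrix (Fin 2) (Fin 2) ℂ) (κ : Fin 2 → ℂ) (q : PParam)
    (i j : Fin 2) :
    HasDerivAt (fun t : ℝ => hTransl (idParam + t • q) m i j)
      (sysRHS m κ (blockMat (-(Matrix.of q.1).trace) q) i j) 0 := by
  have ha : ∀ i j : Fin 2,
      HasDerivAt (fun t : ℝ => (idParam + t • q).1 i j) (q.1 i j) 0 := by
    intro i j
    have h := ((hasDerivAt_id (0 : ℝ)).ofReal_comp.mul_const (q.1 i j)).const_add (idParam.1 i j)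
    simpa using h
  have hc : ∀ i j : Fin 2,
      HasDerivAt (fun t : ℝ => conj ((idParam + t • q).1 i j)) (conj (q.1 i j)) 0 :=
    fun i j => (Complex.conjCLE.toContinuousLinearMap.hasFDerivAt).comp_hasDerivAt (0 : ℝ) (ha i j)
  have hd : HasDerivAt (fun t : ℝ => pdet (idParam + t • q)) (q.1 0 0 + q.1 1 1) 0 := by
    have h := ((ha 0 0).mul (ha 1 1)).sub ((ha 0 1).mul (ha 1 0))
    refine (h.congr_of_eventuallyEq (.of_forall fun t => ?_)).congr_deriv ?_
    · simp [pdet_eq]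
    · simp [idParam]

  have hd' : HasDerivAt (fun t : ℝ => conj (pdet (idParam + t • q)))
      (conj (q.1 0 0 + q.1 1 1)) 0 :=
    (Complex.conjCLE.toContinuousLinearMap.hasFDerivAt).comp_hasDerivAt (0 : ℝ) hd
  have h0 : pdet (idParam + (0 : ℝ) • q) = 1 := by simp [pdet_idParam]
  have hi := (hd.mul hd').inv (by simp [pdet_idParam])
  have hs := hi.mul ((((((ha 0 i).mul_const (m 0 0)).mul (hc 0 j)).add
    (((ha 0 i).mul_const (m 0 1)).mul (hc 1 j)))).add
    ((((ha 1 i).mul_const (m 1 0)).mul (hc 0 j)).add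
    (((ha 1 i).mul_const (m 1 1)).mul (hc 1 j))))
  refine (hs.congr_of_eventuallyEq (.of_forall fun t => ?_)).congr_deriv ?_
  · simp [hTransl, conjTr, Fin.sum_univ_two]
  · simp only [sysRHS, Fin.sum_univ_two, blockMat_zero_zero, blockMat_succ_zero,
      blockMat_succ_succ, Matrix.trace_fin_two, Matrix.of_apply, Pi.mul_apply, Pi.inv_apply, Pi.add_apply, h0]
    fin_cases i <;> fin_cases j <;> simp [idParam] <;> ring

section Bundle

variable {M : Type*} [TopologicalSpace M] [ChartedSpace C2 M] [IsManifold 𝓘(ℂ, C2) ω M]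
  {F : Type*} [NormedAddCommGroup F] [NormedSpace ℝ F]
  {B : Type*} [TopologicalSpace B] [ChartedSpace F B] [IsManifold 𝓘(ℝ, F) ∞ B]

/-- The derivative of a vector-valued function, as a continuous linear map on the model space. -/
def fieldDeriv {W : Type*} [NormedAddCommGroup W] [NormedSpace ℝ W] (k : B → W) (b : B) :
    F →L[ℝ] W := mfderiv 𝓘(ℝ, F) 𝓘(ℝ, W) k b

namespace CartanGeometry

variable (C : CartanGeometry M F B)

lemma hasFDerivAt_orbit {k : B → ℂ} {b : B} (hk : MDifferentiableAt 𝓘(ℝ, F) 𝓘(ℝ, ℂ) k b) :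
    HasFDerivAt (fun q => k (C.act b (toP q))) ((fieldDeriv k b).comp (C.fund b)) idParam := by
  have hk' : MDifferentiableAt 𝓘(ℝ, F) 𝓘(ℝ, ℂ) k (C.act b (toP idParam)) := by
    rwa [act_toP_idParam]
  have h := hk'.hasMFDerivAt.comp idParam
    ((C.contMDiffAt_orbit b pdet_idParam_ne).mdifferentiableAt (by simp)).hasMFDerivAt
  have h' : HasFDerivAt (fun q => k (C.act b (toP q)))
      ((fieldDeriv k (C.act b (toP idParam))).comp (C.fund b)) idParam :=
    hasMFDerivAt_iff_hasFDerivAt.1 h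
  rwa [act_toP_idParam] at h'

/-- On vertical vectors the system is a consequence of equivariance alone; only directions along a
section carry further information. -/
lemma mvfderiv_fund {h : B → Matrix (Fin 2) (Fin 2) ℂ} {b : B} (i j : Fin 2)
    (hh : MDifferentiableAt 𝓘(ℝ, F) 𝓘(ℝ, ℂ) (fun b => h b i j) b)
    (hlaw : ∀ q, pdet q ≠ 0 → h (C.act b (toP q)) = hTransl q (h b)) (κ : Fin 2 → ℂ)
    (q : PParam) : mvfderiv 𝓘(ℝ, F) (fun b' => h b' i j) b (C.fund b q) =
      sysRHS (h b) κ (C.theta b (C.fund b q)) i j := by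
  rw [theta_fund]
  have hline : HasDerivAt (fun t : ℝ => idParam + t • q) q 0 := by
    simpa using ((hasDerivAt_id (0 : ℝ)).smul_const q).const_add idParam
  have h0 : idParam + (0 : ℝ) • q = idParam := by simp
  have h1 := HasFDerivAt.comp_hasDerivAt_of_eq (0 : ℝ) (C.hasFDerivAt_orbit hh) hline h0.symm
  have h2 := hasDerivAt_hTransl (h b) κ q i j
  refine h1.unique (h2.congr_of_eventuallyEq ?_)
  have : ∀ᶠ t in 𝓝 (0 : ℝ), pdet (idParam + t • q) ≠ 0 := by
    refine hline.continuousAt.eventually (p := fun q => pdet q ≠ 0) ?_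
    simp only [h0]
    exact isOpen_pdet_ne.mem_nhds pdet_idParam_ne
  filter_upwards [this] with t ht
  simp only [Function.comp, hlaw _ ht]

variable {C} {D : ComplexLinearConnection M} {x₀ y : M} {σ : M → B}

/-- Translating an adapted section by the group parameters gives a local diffeomorphism onto the
bundle, so smoothness can be tested in position and group parameter. -/
lemma IsAdapted.contMDiffAt_of_trivialization [FiniteDimensional ℝ F]
    (hσ : C.IsAdapted D x₀ σ) (hy : y ∈ (chartAt C2 x₀).source)
    {W : Type*} [NormedAddCommGroup W] [NormedSpace ℝ W] {k : B → W}
    (hk : ContDiffAt ℝ ∞ (fun e : C2 × PParam =>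
      k (C.act (σ ((chartAt C2 x₀).symm e.1)) (toP e.2))) (chartAt C2 x₀ y, idParam)) :
    ContMDiffAt 𝓘(ℝ, F) 𝓘(ℝ, W) ∞ k (σ y) := by
  set z := chartAt C2 x₀
  set Φ : C2 × PParam → B := fun e => C.act (σ (z.symm e.1)) (toP e.2) with hΦdef
  have hΦe : Φ (z y, idParam) = σ y := by
    simp only [Φ, act_toP_idParam, z.left_inv hy]
  have hzs : ContMDiffAt 𝓘(ℝ, C2) 𝓘(ℝ, C2) ∞ z.symm (z y) :=
    contMDiffOn_chart_symm.contMDiffAt (z.open_target.mem_nhds (z.map_source hy))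
  have hσz : ContMDiffAt 𝓘(ℝ, C2) 𝓘(ℝ, F) ∞ (σ ∘ z.symm) (z y) :=
    ContMDiffAt.comp (z y) (by rw [z.left_inv hy]; exact hσ.contMDiffAt hy) hzs
  have hfst : ContMDiffAt 𝓘(ℝ, C2 × PParam) 𝓘(ℝ, C2) ∞ Prod.fst (z y, idParam) :=
    contDiffAt_fst.contMDiffAt
  have hsnd : ContMDiffAt 𝓘(ℝ, C2 × PParam) 𝓘(ℝ, PParam) ∞ Prod.snd (z y, idParam) :=
    contDiffAt_snd.contMDiffAt
  have hΦ : ContMDiffAt 𝓘(ℝ, C2 × PParam) 𝓘(ℝ, F) ∞ Φ (z y, idParam) := by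
    have h1 : ContMDiffAt 𝓘(ℝ, C2 × PParam) (𝓘(ℝ, F).prod 𝓘(ℝ, PParam)) ∞
        (fun e : C2 × PParam => (σ (z.symm e.1), e.2)) (z y, idParam) :=
      (ContMDiffAt.comp (z y, idParam) hσz hfst).prodMk hsnd
    exact ContMDiffAt.comp (z y, idParam)
      (g := fun y : B × PParam => C.act y.1 (toP y.2)) (C.contMDiffAt_act pdet_idParam_ne) h1
  set Λ : C2 × PParam →L[ℝ] F := mfderiv 𝓘(ℝ, C2 × PParam) 𝓘(ℝ, F) Φ (z y, idParam) with hΛ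
  have hΦd := (hΦ.mdifferentiableAt (by simp)).hasMFDerivAt
  have hr : ∀ q, Λ (0, q) = C.fund (σ y) q := by
    intro q
    have hi : HasMFDerivAt 𝓘(ℝ, PParam) 𝓘(ℝ, C2 × PParam) (fun q : PParam => (z y, q)) idParam
        (ContinuousLinearMap.inr ℝ C2 PParam) :=
      (hasFDerivAt_prodMk_right (z y) idParam).hasMFDerivAt
    have h := (HasMFDerivAt.comp idParam hΦd hi).mfderiv
    have e : Φ ∘ (fun q : PParam => (z y, q)) = fun q => C.act (σ y) (toP q) := by
      ext1 q
      simp only [Φ, Function.comp, z.left_inv hy]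
    rw [e] at h
    exact (congrArg (fun L : PParam →L[ℝ] F => L q) h).symm
  have hl : ∀ u, Λ (chartDeriv x₀ y u, 0) = secDeriv σ y u := by
    intro u
    have hz : MDifferentiableAt 𝓘(ℝ, C2) 𝓘(ℝ, C2) z y :=
      (contMDiffOn_chart.contMDiffAt (n := 1) (z.open_source.mem_nhds hy)).mdifferentiableAt
        (by simp)
    have hi : HasMFDerivAt 𝓘(ℝ, C2) 𝓘(ℝ, C2 × PParam) (fun p : C2 => (p, idParam)) (z y)
        (ContinuousLinearMap.inl ℝ C2 PParam) :=
      (hasFDerivAt_prodMk_left (z y) idParam).hasMFDerivAt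
    have h := HasMFDerivAt.comp y (HasMFDerivAt.comp (z y) hΦd hi) hz.hasMFDerivAt
    have e : σ =ᶠ[𝓝 y] ((Φ ∘ fun p : C2 => (p, idParam)) ∘ z) := by
      filter_upwards [z.open_source.mem_nhds hy] with x hx
      simp only [Φ, Function.comp, z.left_inv hx, act_toP_idParam]
    have h' := (h.congr_of_eventuallyEq e).mfderiv
    exact (congrArg (fun L : C2 →L[ℝ] F => L u) h').symm
  have hΛ' : ∀ u q, Λ (chartDeriv x₀ y u, q) = secDeriv σ y u + C.fund (σ y) q := by
    intro u q
    rw [← hl, ← hr, ← map_add]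
    simp
  -- For injectivity, the first column of `θ` recovers `u` and, once `u = 0`, the other columns
  -- recover `q`. Surjectivity is the splitting of tangent vectors into section and fundamental
  -- parts.
  have hbij : Function.Bijective Λ := by
    constructor
    · rw [injective_iff_map_eq_zero]
      rintro ⟨p, q⟩ hpq
      obtain ⟨u, rfl⟩ : ∃ u, chartDeriv x₀ y u = p := ⟨_, chartDeriv_coordField hy p⟩
      rw [hΛ'] at hpq
      have h0 : C.theta (σ y) (0 : F) = 0 := by
        have := C.theta_sub (σ y) 0 0
        simpa using this
      have hθ := congrArg (C.theta (σ y)) hpq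
      rw [theta_add, hσ.theta_secDeriv hy, C.theta_fund, h0] at hθ
      have hu : chartDeriv x₀ y u = 0 := by
        ext i
        have := congrFun (congrFun hθ i.succ) 0
        rw [Matrix.add_apply, phi_succ_zero, blockMat_succ_zero, add_zero] at this
        exact this
      obtain rfl : u = 0 := chartDeriv_injective hy (by rw [hu, map_zero])
      rw [← hσ.theta_secDeriv hy, map_zero, h0, zero_add] at hθ
      have hq : q = 0 := by
        ext i j
        · exact congrFun (congrFun hθ i.succ) j.succ
        · exact congrFun (congrFun hθ 0) (Fin.succ i)
      rw [hu, hq]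
      rfl
    · intro v
      obtain ⟨u, q, rfl⟩ := hσ.exists_decomp hy v
      exact ⟨_, hΛ' u q⟩
  have hC2 : CompleteSpace F := FiniteDimensional.complete ℝ F
  have := contMDiffAt_of_comp hΦ hbij hk
  rwa [hΦe] at this

/-- A property of points of `B` which holds on the adapted sections and is invariant under right
translations holds everywhere. -/
lemma IsCartanGeometryOf.induction (hC : C.IsCartanGeometryOf D) {p : B → Prop}
    (hsec : ∀ (x₀ : M) (σ : M → B), C.IsAdapted D x₀ σ → p (σ x₀))
    (htr : ∀ b q, pdet q ≠ 0 → p b → p (C.act b (toP q))) (b : B) : p b := by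
  obtain ⟨σ, hσ⟩ := hC.exists_isAdapted (C.proj b)
  have hx := mem_chart_source C2 (C.proj b)
  obtain ⟨r, hr⟩ := (C.proj_eq_iff (σ (C.proj b)) b).1 (hσ.proj_eq hx)
  obtain ⟨q, hq, rfl⟩ := exists_toP r
  rw [hr]
  exact htr _ _ hq (hsec _ _ hσ)

lemma contMDiffAt_transl_iff {W : Type*} [NormedAddCommGroup W] [NormedSpace ℝ W]
    {V : Type*} [NormedAddCommGroup V] [NormedSpace ℝ V] {k : B → W} {k' : B → V} {b : B} {p : P}
    {T : V → W} (hT : ContDiff ℝ ∞ T) (hk : ∀ b', k (C.act b' p) = T (k' b'))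
    (h : ContMDiffAt 𝓘(ℝ, F) 𝓘(ℝ, V) ∞ k' b) :
    ContMDiffAt 𝓘(ℝ, F) 𝓘(ℝ, W) ∞ k (C.act b p) := by
  have h' : ContMDiffAt 𝓘(ℝ, F) 𝓘(ℝ, V) ∞ (fun b' => k' (C.act b' p⁻¹)) (C.act b p) :=
    ContMDiffAt.comp (C.act b p) (g := k') (by rwa [act_act_inv]) (C.contMDiff_transl p⁻¹ _)
  refine (hT.contMDiff.contMDiffAt.comp (C.act b p) h').congr_of_eventuallyEq
    (.of_forall fun b' => ?_)
  have := hk (C.act b' p⁻¹)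
  rw [← C.act_mul, inv_mul_cancel, C.act_one] at this
  exact this

end CartanGeometry

end Bundle

/-! ### Hermitian forms on `ℂ²` -/

/-- The complex sesquilinear form associated to a real bilinear form invariant under `i`. -/
def sesq (β : C2 →L[ℝ] C2 →L[ℝ] ℝ) (v w : C2) : ℂ := β v w + Complex.I * β v (Complex.I • w)

/-- The matrix of `sesq β`. -/
def hermMat (β : C2 →L[ℝ] C2 →L[ℝ] ℝ) : Matrix (Fin 2) (Fin 2) ℂ :=
  Matrix.of fun i j => sesq β (Pi.single i 1) (Pi.single j 1)

/-- Symmetric bilinear forms on `ℂ²` invariant under multiplication by `i`. -/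
structure IsHermForm (β : C2 →L[ℝ] C2 →L[ℝ] ℝ) : Prop where
  symm : ∀ v w, β v w = β w v
  inv : ∀ v w, β (Complex.I • v) (Complex.I • w) = β v w

section Form

variable {β : C2 →L[ℝ] C2 →L[ℝ] ℝ}

lemma C2_smul_eq (a : ℂ) (v : C2) : a • v = a.re • v + a.im • (Complex.I • v) := by
  ext i
  simp only [Pi.smul_apply, Pi.add_apply, smul_eq_mul, Complex.real_smul]
  conv_lhs => rw [← Complex.re_add_im a]
  ring

lemma I_smul_I_smul (v : C2) : Complex.I • (Complex.I • v) = -v := by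
  rw [smul_smul, Complex.I_mul_I, neg_one_smul]

lemma IsHermForm.I_left (h : IsHermForm β) (v w : C2) :
    β (Complex.I • v) w = -β v (Complex.I • w) := by
  rw [← h.inv (Complex.I • v) w, I_smul_I_smul, map_neg, neg_apply]

lemma sesq_add_left (v v' w : C2) : sesq β (v + v') w = sesq β v w + sesq β v' w := by
  simp only [sesq, map_add, add_apply, Complex.ofReal_add]
  ring

lemma sesq_add_right (v w w' : C2) : sesq β v (w + w') = sesq β v w + sesq β v w' := by
  simp only [sesq, map_add, smul_add, Complex.ofReal_add]
  ring

lemma IsHermForm.sesq_smul_left (h : IsHermForm β) (a : ℂ) (v w : C2) :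
    sesq β (a • v) w = a * sesq β v w := by
  rw [C2_smul_eq]
  simp only [sesq, map_add, map_smul, add_apply, smul_apply,
    Complex.ofReal_add, smul_eq_mul, Complex.ofReal_mul, h.I_left, I_smul_I_smul, map_neg]
  conv_rhs => rw [← Complex.re_add_im a]
  push_cast
  linear_combination (-(a.im : ℂ) * (β v (Complex.I • w) : ℂ)) * Complex.I_mul_I

lemma sesq_smul_right (a : ℂ) (v w : C2) :
    sesq β v (a • w) = conj a * sesq β v w := by
  have e1 : Complex.I • (a.re • w) = a.re • (Complex.I • w) := smul_comm _ _ _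
  have e2 : Complex.I • (a.im • (Complex.I • w)) = a.im • -w := by
    rw [smul_comm, I_smul_I_smul]
  rw [C2_smul_eq]
  simp only [sesq, map_add, map_smul, smul_add, e1, e2, Complex.ofReal_add,
    smul_eq_mul, Complex.ofReal_mul, map_neg]
  conv_rhs => rw [← Complex.re_add_im a]
  simp only [map_add, map_mul, Complex.conj_ofReal, Complex.conj_I]
  push_cast
  linear_combination ((a.im : ℂ) * (β v (Complex.I • w) : ℂ)) * Complex.I_mul_I

lemma C2_eq_sum (v : C2) : v = v 0 • Pi.single 0 1 + v 1 • Pi.single 1 1 := by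
  ext i
  fin_cases i <;> simp

lemma IsHermForm.sesq_eq (h : IsHermForm β) (v w : C2) :
    sesq β v w = ∑ i, ∑ j, hermMat β i j * v i * conj (w j) := by
  conv_lhs => rw [C2_eq_sum v, C2_eq_sum w]
  simp only [sesq_add_left, sesq_add_right, h.sesq_smul_left, sesq_smul_right, Fin.sum_univ_two,
    hermMat, Matrix.of_apply]
  ring

lemma IsHermForm.conj_sesq (h : IsHermForm β) (v w : C2) : conj (sesq β v w) = sesq β w v := by
  simp only [sesq, map_add, map_mul, Complex.conj_ofReal, Complex.conj_I]
  rw [h.symm v (Complex.I • w), h.I_left, h.symm v w]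
  push_cast
  ring

lemma re_sesq (v w : C2) : (sesq β v w).re = β v w := by
  simp [sesq]

lemma IsHermForm.eq_sum (h : IsHermForm β) (v w : C2) :
    (β v w : ℂ) = ∑ i, ∑ j, hermMat β i j * ((v i * conj (w j) + w i * conj (v j)) / 2) := by
  have h1 : (β v w : ℂ) = (sesq β v w + sesq β w v) / 2 := by
    rw [← h.conj_sesq v w, Complex.add_conj, re_sesq]
    push_cast
    ring
  rw [h1, h.sesq_eq, h.sesq_eq]
  simp only [Fin.sum_univ_two]
  ring

lemma IsHermForm.isHermitian (h : IsHermForm β) : (hermMat β).IsHermitian := by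
  ext i j
  exact h.conj_sesq _ _

/-- A vector in the left kernel of the matrix is orthogonal to everything for the sesquilinear form,
hence for its real part `β`. -/
lemma IsHermForm.hermDet_ne_zero (h : IsHermForm β) (hnd : ∀ v, (∀ w, β v w = 0) → v = 0) :
    hermDet (hermMat β) ≠ 0 := by
  intro h0
  have hdet : (hermMat β).det = 0 := by
    rw [Matrix.det_fin_two, ← hermDet_eq h.isHermitian, h0, Complex.ofReal_zero]
  obtain ⟨v, hv, hv0⟩ := Matrix.exists_vecMul_eq_zero_iff.2 hdet
  refine hv (hnd v fun w => ?_)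
  rw [← re_sesq, h.sesq_eq]
  have h0 := congrFun hv0 0
  have h1 := congrFun hv0 1
  simp only [Matrix.vecMul, dotProduct, Fin.sum_univ_two, Pi.zero_apply] at h0 h1
  have : ∑ i, ∑ j, hermMat β i j * v i * conj (w j) = 0 := by
    simp only [Fin.sum_univ_two]
    linear_combination conj (w 0) * h0 + conj (w 1) * h1
  rw [this, Complex.zero_re]

end Form

/-! ### Parallel hermitian matrices -/

/-- The derivative of the coefficient matrix `m` of a parallel hermitian form in the direction `u`,
for a connection with complex Christoffel symbols `Γ`. -/
def parallelRHS (Γ : Fin 2 → Fin 2 → Fin 2 → ℂ) (m : Matrix (Fin 2) (Fin 2) ℂ) (u : C2)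
    (i j : Fin 2) : ℂ :=
  ∑ s, (∑ k, Γ s i k * u k) * m s j + ∑ s, m i s * conj (∑ k, Γ s j k * u k)

/-! ### Coordinate expressions of pseudo-Kähler metrics -/

section Surface

variable {M : Type*} [TopologicalSpace M] [ChartedSpace C2 M] [IsManifold 𝓘(ℂ, C2) ω M]

/-- The coordinate expression of a pseudo-Kähler metric. -/
def metricRep (g : PseudoKahlerMetric M) (x₀ y : M) : C2 →L[ℝ] C2 →L[ℝ] ℝ :=
  (show C2 →L[ℝ] C2 →L[ℝ] ℝ from g.inner y).bilinearComp (chartDeriv x₀ y).inverse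
    (chartDeriv x₀ y).inverse

variable {x₀ y : M}

lemma metricRep_apply (g : PseudoKahlerMetric M) (x₀ y : M) (u w : C2) :
    metricRep g x₀ y u w =
      g.inner y (coordField (chartAt C2 x₀) u y) (coordField (chartAt C2 x₀) w y) := rfl

lemma inner_eq_metricRep (g : PseudoKahlerMetric M) (hy : y ∈ (chartAt C2 x₀).source)
    (v w : TangentSpace 𝓘(ℝ, C2) y) :
    g.inner y v w = metricRep g x₀ y (chartDeriv x₀ y v) (chartDeriv x₀ y w) := by
  rw [metricRep_apply, coordField_chartDeriv hy, coordField_chartDeriv hy]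

lemma isHermForm_metricRep (g : PseudoKahlerMetric M) (hy : y ∈ (chartAt C2 x₀).source) :
    IsHermForm (metricRep g x₀ y) where
  symm v w := g.symm _ _ _
  inv v w := by
    simp only [metricRep_apply, coordField_I_smul hy]
    exact g.hermitian y _ _

lemma hermDet_metricRep (g : PseudoKahlerMetric M) (hy : y ∈ (chartAt C2 x₀).source) :
    hermDet (hermMat (metricRep g x₀ y)) ≠ 0 := by
  refine (isHermForm_metricRep g hy).hermDet_ne_zero fun v hv => ?_
  have h0 := g.nondegenerate y (coordField (chartAt C2 x₀) v y) fun w => by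
    rw [inner_eq_metricRep g hy, chartDeriv_coordField hy]
    exact hv _
  rw [← chartDeriv_coordField hy v, h0]
  exact map_zero (chartDeriv x₀ y)

lemma contMDiffAt_coordField (hy : y ∈ (chartAt C2 x₀).source) (u : C2) :
    ContMDiffAt 𝓘(ℝ, C2) (𝓘(ℝ, C2).prod 𝓘(ℝ, C2)) ∞
      (fun y => TotalSpace.mk' C2 (E := fun y : M => TangentSpace 𝓘(ℝ, C2) y) y
        (coordField (chartAt C2 x₀) u y)) y :=
  (contMDiffAt_field_iff hy _).2
    (contDiffAt_const.congr_of_eventuallyEq (eventually_localRep_coordField hy u))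

lemma contMDiffAt_metricRep (g : PseudoKahlerMetric M) (hy : y ∈ (chartAt C2 x₀).source)
    (u w : C2) : ContMDiffAt 𝓘(ℝ, C2) 𝓘(ℝ, ℝ) ∞ (fun x => metricRep g x₀ x u w) y := by
  have h := ContMDiffAt.clm_bundle_apply₂ (F₁ := C2) (F₂ := C2) (F₃ := ℝ)
    (E₃ := Bundle.Trivial M ℝ) (g.smooth y) (contMDiffAt_coordField hy u)
    (contMDiffAt_coordField hy w)
  simp only [contMDiffAt_totalSpace] at h
  exact h.2

lemma contMDiffAt_hermMat (g : PseudoKahlerMetric M) (hy : y ∈ (chartAt C2 x₀).source)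
    (i j : Fin 2) :
    ContMDiffAt 𝓘(ℝ, C2) 𝓘(ℝ, ℂ) ∞ (fun x => hermMat (metricRep g x₀ x) i j) y := by
  have h : ∀ u w, ContMDiffAt 𝓘(ℝ, C2) 𝓘(ℝ, ℂ) ∞ (fun x => (metricRep g x₀ x u w : ℂ)) y :=
    fun u w => Complex.ofRealCLM.contDiff.contMDiff.contMDiffAt.comp y
      (contMDiffAt_metricRep g hy u w)
  have h2 : ContMDiffAt 𝓘(ℝ, C2) 𝓘(ℝ, ℂ) ∞
      (fun x => Complex.I * (metricRep g x₀ x (Pi.single i 1) (Complex.I • Pi.single j 1) : ℂ)) y :=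
    (contDiff_const_smul (𝕜 := ℝ) Complex.I).contMDiff.contMDiffAt.comp y (h _ _)
  exact (h _ _).add h2

/-- `∇g = 0` is applied to coordinate fields. Since `∇` commutes with `i`, the identity extends from
the real form to its sesquilinear extension, where only the complex symbols `Γ^i_{jk}` appear. -/
lemma IsLeviCivita.mvfderiv_hermMat {g : PseudoKahlerMetric M} {D : ComplexLinearConnection M}
    (hD : IsLeviCivita g D) (hy : y ∈ (chartAt C2 x₀).source) (i j : Fin 2) (v : C2) :
    mvfderiv 𝓘(ℝ, C2) (fun x => hermMat (metricRep g x₀ x) i j) y v =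
      parallelRHS (christoffel D (chartAt C2 x₀) y) (hermMat (metricRep g x₀ y))
        (chartDeriv x₀ y v) i j := by
  set z := chartAt C2 x₀
  have hβ := isHermForm_metricRep g hy
  set β := metricRep g x₀ y
  set u := chartDeriv x₀ y v
  have hd : ∀ a b : C2, mvfderiv 𝓘(ℝ, C2) (fun x => metricRep g x₀ x a b) y v =
      β (christoffelVec D z y u a) b + β a (christoffelVec D z y u b) := by
    intro a b
    have h := hD (coordField z a) (coordField z b) y (diffFieldAt_coordField hy a)
      (diffFieldAt_coordField hy b) v
    have hc : ∀ a, chartDeriv x₀ y (D.nabla (coordField z a) y v) = christoffelVec D z y u a := by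
      intro a
      rw [← coordField_chartDeriv hy v]
      rfl
    rw [inner_eq_metricRep g hy, inner_eq_metricRep g hy, hc, hc, chartDeriv_coordField hy,
      chartDeriv_coordField hy] at h
    exact h
  have hs : mvfderiv 𝓘(ℝ, C2) (fun x => hermMat (metricRep g x₀ x) i j) y v =
      sesq β (christoffelVec D z y u (Pi.single i 1)) (Pi.single j 1) +
      sesq β (Pi.single i 1) (christoffelVec D z y u (Pi.single j 1)) := by
    have hm : ∀ a b, MDifferentiableAt 𝓘(ℝ, C2) 𝓘(ℝ, ℝ) (fun x => metricRep g x₀ x a b) y :=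
      fun a b => (contMDiffAt_metricRep g hy a b).mdifferentiableAt (by simp)
    have h1 := mvfderiv_clm_comp Complex.ofRealCLM (hm (Pi.single i 1) (Pi.single j 1)) v
    have h2 := mvfderiv_clm_comp (Complex.I • Complex.ofRealCLM)
      (hm (Pi.single i 1) (Complex.I • Pi.single j 1)) v
    have ha := mvfderiv_add
      (((Complex.ofRealCLM.hasMFDerivAt.comp y (hm (Pi.single i 1)
        (Pi.single j 1)).hasMFDerivAt)).mdifferentiableAt)
      ((((Complex.I • Complex.ofRealCLM).hasMFDerivAt.comp y (hm (Pi.single i 1)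
        (Complex.I • Pi.single j 1)).hasMFDerivAt)).mdifferentiableAt)
    have ha' := congrArg (fun L : C2 →L[ℝ] ℂ => L v) ha
    rw [hd] at h1 h2
    refine ha'.trans ((congrArg₂ (· + ·) h1 h2).trans ?_)
    rw [christoffelVec_smul_right D hy]
    simp only [sesq, smul_apply, Complex.ofRealCLM_apply, smul_eq_mul,
      Complex.ofReal_add]
    ring
  have hΓ : ∀ s i : Fin 2, christoffelVec D z y u (Pi.single i 1) s =
      ∑ k, christoffel D z y s i k * u k := by
    intro s i
    rw [christoffelVec_eq_sum D hy]
    have hc := christoffel_comm D hy s 0 1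
    fin_cases i <;> simp [Fin.sum_univ_two, z, hc]
  rw [hs, hβ.sesq_eq, hβ.sesq_eq]
  simp only [hΓ, parallelRHS]
  fin_cases i <;> fin_cases j <;> simp [Fin.sum_univ_two] <;> ring

end Surface

/-! ### Smoothness of the transformation laws -/

@[fun_prop]
lemma contDiffAt_conj {E : Type*} [NormedAddCommGroup E] [NormedSpace ℝ E] {n : ℕ∞ω} {f : E → ℂ}
    {x : E} (hf : ContDiffAt ℝ n f x) : ContDiffAt ℝ n (fun y => conj (f y)) x :=
  Complex.conjCLE.contDiff.contDiffAt.comp x hf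

lemma contDiffAt_gTransl (i j : Fin 2) (e : PParam × (Fin 2 → Fin 2 → ℂ)) :
    ContDiffAt ℝ ∞ (fun e : PParam × (Fin 2 → Fin 2 → ℂ) =>
      gTransl e.1 (Matrix.of e.2) i j) e := by
  simp only [gTransl, conjTr, pdet_eq, Matrix.smul_apply, Matrix.of_apply, smul_eq_mul,
    Fin.sum_univ_two]
  fun_prop

lemma contDiffAt_kTransl (j : Fin 2) {e : PParam × (Fin 2 → Fin 2 → ℂ) × C2}
    (he : pdet e.1 ≠ 0) :
    ContDiffAt ℝ ∞ (fun e : PParam × (Fin 2 → Fin 2 → ℂ) × C2 =>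
      kTransl e.1 (Matrix.of e.2.1) e.2.2 j) e := by
  have : pdet e.1 * conj (pdet e.1) ≠ 0 := by simpa using he
  simp only [kTransl, hTransl, conjTr, pdet_eq, Matrix.smul_apply, Matrix.of_apply, smul_eq_mul,
    Fin.sum_univ_two] at this he ⊢
  fun_prop (disch := assumption)

lemma contDiffAt_hermDet (m : Fin 2 → Fin 2 → ℂ) :
    ContDiffAt ℝ ∞ (fun m : Fin 2 → Fin 2 → ℂ => hermDet (Matrix.of m)) m := by
  simp only [hermDet, Complex.normSq_apply, Matrix.of_apply]
  have hre : ContDiff ℝ ∞ Complex.re := Complex.reCLM.contDiff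
  have him : ContDiff ℝ ∞ Complex.im := Complex.imCLM.contDiff
  refine ContDiffAt.sub (hre.contDiffAt.comp m (by fun_prop)) (ContDiffAt.add ?_ ?_)
  · exact ContDiffAt.mul (hre.contDiffAt.comp m (by fun_prop)) (hre.contDiffAt.comp m (by fun_prop))
  · exact ContDiffAt.mul (him.contDiffAt.comp m (by fun_prop)) (him.contDiffAt.comp m (by fun_prop))

lemma contDiffAt_rescale (i j : Fin 2) {m : Fin 2 → Fin 2 → ℂ} (hm : hermDet (Matrix.of m) ≠ 0) :
    ContDiffAt ℝ ∞ (fun m : Fin 2 → Fin 2 → ℂ =>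
      (((|hermDet (Matrix.of m)| ^ (-2 / 3 : ℝ) : ℝ) : ℂ) • Matrix.of m) i j) m := by
  have h1 : ContDiffAt ℝ ∞ (fun m : Fin 2 → Fin 2 → ℂ =>
      |hermDet (Matrix.of m)| ^ (-2 / 3 : ℝ)) m :=
    ((contDiffAt_hermDet m).abs hm).rpow_const_of_ne (abs_ne_zero.2 hm)
  have h2 := Complex.ofRealCLM.contDiff.contDiffAt.comp m h1
  exact ContDiffAt.mul h2 (by simp only [Matrix.of_apply]; fun_prop)

/-! ### Derivatives along lines in a chart -/

/-- Near `t₀` hermitian symmetry identifies `hermDet` with the polynomial determinant, which obeys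
the product rule. -/
lemma hasDerivAt_hermDet {m : ℝ → Matrix (Fin 2) (Fin 2) ℂ} {d : Fin 2 → Fin 2 → ℂ} {t₀ : ℝ}
    (hm : ∀ i j, HasDerivAt (fun t => m t i j) (d i j) t₀)
    (hh : ∀ᶠ t in 𝓝 t₀, (m t).IsHermitian) {r : ℝ}
    (hr : (r : ℂ) = d 0 0 * m t₀ 1 1 + m t₀ 0 0 * d 1 1 - (d 0 1 * m t₀ 1 0 + m t₀ 0 1 * d 1 0)) :
    HasDerivAt (fun t => hermDet (m t)) r t₀ := by
  have h1 : HasDerivAt (fun t => (hermDet (m t) : ℂ)) r t₀ := by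
    rw [hr]
    refine (((hm 0 0).mul (hm 1 1)).sub ((hm 0 1).mul (hm 1 0))).congr_of_eventuallyEq ?_
    filter_upwards [hh] with t ht
    exact hermDet_eq ht
  have h2 := Complex.reCLM.hasFDerivAt.comp_hasDerivAt t₀ h1
  simp only [Complex.reCLM_apply, Complex.ofReal_re] at h2
  exact h2

/-- Jacobi's formula: the logarithmic derivative of the determinant is the trace of the connection
matrix plus its conjugate. -/
lemma parallelRHS_det (Γ : Fin 2 → Fin 2 → Fin 2 → ℂ) (m : Matrix (Fin 2) (Fin 2) ℂ) (u : C2) :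
    parallelRHS Γ m u 0 0 * m 1 1 + m 0 0 * parallelRHS Γ m u 1 1
      - (parallelRHS Γ m u 0 1 * m 1 0 + m 0 1 * parallelRHS Γ m u 1 0) =
    (∑ k, (∑ l, Γ l l k) * u k + conj (∑ k, (∑ l, Γ l l k) * u k)) *
      (m 0 0 * m 1 1 - m 0 1 * m 1 0) := by
  simp only [parallelRHS, Fin.sum_univ_two, map_add, map_mul]
  ring

lemma hasDerivAt_abs_rpow {x : ℝ} (hx : x ≠ 0) (p : ℝ) :
    HasDerivAt (fun x : ℝ => |x| ^ p) (p * |x| ^ p / x) x := by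
  have h := ((Real.hasDerivAt_log hx).mul_const p).exp
  refine (h.congr_of_eventuallyEq ?_).congr_deriv ?_
  · filter_upwards [isOpen_ne.mem_nhds hx] with y hy
    rw [Real.rpow_def_of_pos (abs_pos.2 hy), Real.log_abs]
  · rw [Real.rpow_def_of_pos (abs_pos.2 hx), Real.log_abs]
    field_simp

/-- The determinant factor contributes `-2/3` of the logarithmic derivative of the determinant; the
matrix factor stays parallel. -/
lemma hasDerivAt_rescale {m : ℝ → Matrix (Fin 2) (Fin 2) ℂ} {t₀ : ℝ}
    {Γ : Fin 2 → Fin 2 → Fin 2 → ℂ} {u : C2}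
    (hm : ∀ i j, HasDerivAt (fun t => m t i j) (parallelRHS Γ (m t₀) u i j) t₀)
    (hh : ∀ᶠ t in 𝓝 t₀, (m t).IsHermitian) (h0 : hermDet (m t₀) ≠ 0) (i j : Fin 2) :
    HasDerivAt (fun t => (((|hermDet (m t)| ^ (-2 / 3 : ℝ) : ℝ) : ℂ) • m t) i j)
      (parallelRHS Γ (((|hermDet (m t₀)| ^ (-2 / 3 : ℝ) : ℝ) : ℂ) • m t₀) u i j
        - 2 / 3 * (∑ k, (∑ l, Γ l l k) * u k + conj (∑ k, (∑ l, Γ l l k) * u k)) *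
          (((|hermDet (m t₀)| ^ (-2 / 3 : ℝ) : ℝ) : ℂ) • m t₀) i j) t₀ := by
  set T := ∑ k, (∑ l, Γ l l k) * u k with hT
  have hr : ((2 * T.re * hermDet (m t₀) : ℝ) : ℂ) =
      (T + conj T) * (m t₀ 0 0 * m t₀ 1 1 - m t₀ 0 1 * m t₀ 1 0) := by
    rw [← hermDet_eq hh.self_of_nhds, Complex.add_conj]
    push_cast
    ring
  have hd := hasDerivAt_hermDet hm hh (hr.trans (parallelRHS_det Γ _ u).symm)
  have hρ := ((hasDerivAt_abs_rpow h0 (-2 / 3)).comp t₀ hd).ofReal_comp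
  refine (hρ.mul (hm i j)).congr_deriv ?_
  have e : ((-2 / 3 * |hermDet (m t₀)| ^ (-2 / 3 : ℝ) / hermDet (m t₀) *
      (2 * T.re * hermDet (m t₀)) : ℝ) : ℂ) =
      -2 / 3 * (T + conj T) * ((|hermDet (m t₀)| ^ (-2 / 3 : ℝ) : ℝ) : ℂ) := by
    rw [Complex.add_conj]
    have : -2 / 3 * |hermDet (m t₀)| ^ (-2 / 3 : ℝ) / hermDet (m t₀) *
      (2 * T.re * hermDet (m t₀)) = -2 / 3 * (2 * T.re) * |hermDet (m t₀)| ^ (-2 / 3 : ℝ) := by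
      field_simp
    rw [this]
    push_cast
    ring
  rw [e]
  simp only [Function.comp, parallelRHS, Matrix.smul_apply, smul_eq_mul, Fin.sum_univ_two]
  ring

/-- The functions `h_i` in a section adapted to holomorphic coordinates. -/
def kappaOf (τ : C2) (m : Matrix (Fin 2) (Fin 2) ℂ) (j : Fin 2) : ℂ :=
  1 / 3 * (conj (τ 1) * m j 0 - conj (τ 0) * m j 1)

/-- The local heart of the theorem. In the intended use `τ` is the trace of `Γ`. With `τ' = τ` the
last bracket vanishes and the system is the equation of a rescaled parallel form. For another `τ'`
the bracket is the effect of a projective change of `Γ`, as `parallelRHS_shiftChristoffel` shows. -/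
lemma sysRHS_kappaOf (Γ : Fin 2 → Fin 2 → Fin 2 → ℂ) (τ τ' : C2)
    {m : Matrix (Fin 2) (Fin 2) ℂ} (hm : m.IsHermitian) {u : C2} {X : Matrix (Fin 3) (Fin 3) ℂ}
    (hX0 : X 0 0 = 0) (hX1 : ∀ i : Fin 2, X i.succ 0 = u i)
    (hX2 : ∀ i j : Fin 2, X i.succ j.succ = ∑ k, (Γ i j k - (1 / 3) *
      (τ j * (if i = k then 1 else 0) + τ k * (if i = j then 1 else 0))) * u k)
    (i j : Fin 2) :
    sysRHS m (kappaOf τ' m) X i j = parallelRHS Γ m u i j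
      - 2 / 3 * (∑ k, τ k * u k + conj (∑ k, τ k * u k)) * m i j
      + 1 / 3 * ((τ' i - τ i) * ∑ s, m s j * u s + conj (τ' j - τ j) * ∑ s, m i s * conj (u s)
        - (∑ k, (τ' k - τ k) * u k + conj (∑ k, (τ' k - τ k) * u k)) * m i j) := by
  simp only [sysRHS, hX0, hX1, hX2, kappaOf, parallelRHS, Fin.sum_univ_two, map_add, map_mul,
    map_sub, isHermitian_apply hm, Complex.conj_conj, map_zero, map_div₀, map_one]
  have h3 : conj (3 : ℂ) = 3 := Complex.conj_ofNat 3
  fin_cases i <;> fin_cases j <;> simp [eps, h3] <;> ring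

section Surface

variable {M : Type*} [TopologicalSpace M] [ChartedSpace C2 M] [IsManifold 𝓘(ℂ, C2) ω M]
variable {x₀ y : M}

/-- The curve through `y` which is a line in the chart at `x₀`. -/
def chartLine (x₀ y : M) (v : C2) (t : ℝ) : M :=
  (chartAt C2 x₀).symm (chartAt C2 x₀ y + t • chartDeriv x₀ y v)

lemma chartLine_zero (hy : y ∈ (chartAt C2 x₀).source) (v : C2) : chartLine x₀ y v 0 = y := by
  simp [chartLine, hy]

lemma hasDerivAt_chartLine {V : Type*} [NormedAddCommGroup V] [NormedSpace ℝ V]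
    (hy : y ∈ (chartAt C2 x₀).source) {f : M → V}
    (hf : MDifferentiableAt 𝓘(ℝ, C2) 𝓘(ℝ, V) f y) (v : C2) :
    HasDerivAt (fun t => f (chartLine x₀ y v t)) (mvfderiv 𝓘(ℝ, C2) f y v) 0 := by
  have hf' := (mdifferentiableAt_iff_chart hy f).1 hf
  have hl : HasDerivAt (fun t : ℝ => chartAt C2 x₀ y + t • chartDeriv x₀ y v)
      (chartDeriv x₀ y v) 0 := by
    simpa using ((hasDerivAt_id (0 : ℝ)).smul_const (chartDeriv x₀ y v)).const_add
      (chartAt C2 x₀ y)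
  exact (hf'.hasFDerivAt.comp_hasDerivAt_of_eq (0 : ℝ) hl (by simp)).congr_deriv
    (mvfderiv_eq_chart hy hf' v).symm

lemma eventually_chartLine (hy : y ∈ (chartAt C2 x₀).source) (v : C2) {p : M → Prop}
    (hp : ∀ᶠ x in 𝓝 y, p x) : ∀ᶠ t in 𝓝 (0 : ℝ), p (chartLine x₀ y v t) := by
  have hc : ContinuousAt (chartLine x₀ y v) 0 := by
    refine ContinuousAt.comp (g := (chartAt C2 x₀).symm) ?_ (by fun_prop)
    simpa using (chartAt C2 x₀).continuousAt_symm ((chartAt C2 x₀).map_source hy)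
  have := hc.tendsto
  rw [chartLine_zero hy] at this
  exact this.eventually hp

end Surface

/-! ### From compatible metrics to solutions -/

/-- The matrix `m (det m)^{-2/3}`. -/
def rescale (m : Matrix (Fin 2) (Fin 2) ℂ) : Matrix (Fin 2) (Fin 2) ℂ :=
  ((|hermDet m| ^ (-2 / 3 : ℝ) : ℝ) : ℂ) • m

lemma rescale_isHermitian {m : Matrix (Fin 2) (Fin 2) ℂ} (hm : m.IsHermitian) :
    (rescale m).IsHermitian :=
  smul_isHermitian (Complex.conj_ofReal _) hm

lemma hermDet_gTransl_ne {q : PParam} (hq : pdet q ≠ 0) {m : Matrix (Fin 2) (Fin 2) ℂ}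
    (hm : m.IsHermitian) (h0 : hermDet m ≠ 0) : hermDet (gTransl q m) ≠ 0 := by
  have hn := (Complex.normSq_pos.2 hq).ne'
  rw [gTransl_eq, hermDet_smul, hermDet_conjTr q hm]
  exact mul_ne_zero (pow_ne_zero _ hn) (mul_ne_zero hn h0)

section Bundle

variable {M : Type*} [TopologicalSpace M] [ChartedSpace C2 M] [IsManifold 𝓘(ℂ, C2) ω M]
  {F : Type*} [NormedAddCommGroup F] [NormedSpace ℝ F]
  {B : Type*} [TopologicalSpace B] [ChartedSpace F B] [IsManifold 𝓘(ℝ, F) ∞ B]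
  {x₀ y : M}

/-- The trace `Γ^l_{lk}` of the Christoffel symbols. -/
def christoffelTrace (D : ComplexLinearConnection M) (x₀ y : M) (k : Fin 2) : ℂ :=
  ∑ l, christoffel D (chartAt C2 x₀) y l l k

lemma contMDiffAt_christoffel [T2Space M] (D : ComplexLinearConnection M)
    (hy : y ∈ (chartAt C2 x₀).source) (i j k : Fin 2) :
    ContMDiffAt 𝓘(ℝ, C2) 𝓘(ℝ, ℂ) ∞ (fun x => christoffel D (chartAt C2 x₀) x i j k) y :=
  contMDiffAt_pi_space.1 (contMDiffAt_christoffelVec D hy _ _) i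

lemma contMDiffAt_christoffelTrace [T2Space M] (D : ComplexLinearConnection M)
    (hy : y ∈ (chartAt C2 x₀).source) (k : Fin 2) :
    ContMDiffAt 𝓘(ℝ, C2) 𝓘(ℝ, ℂ) ∞ (fun x => christoffelTrace D x₀ x k) y := by
  simp only [christoffelTrace, Fin.sum_univ_two]
  exact (contMDiffAt_christoffel D hy _ _ _).add (contMDiffAt_christoffel D hy _ _ _)

lemma contMDiffAt_rescale_hermMat (g : PseudoKahlerMetric M) (hy : y ∈ (chartAt C2 x₀).source)
    (i j : Fin 2) :
    ContMDiffAt 𝓘(ℝ, C2) 𝓘(ℝ, ℂ) ∞ (fun x => rescale (hermMat (metricRep g x₀ x)) i j) y :=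
  (contDiffAt_rescale i j (m := fun i j => hermMat (metricRep g x₀ y) i j)
    (hermDet_metricRep g hy)).contMDiffAt.comp y
    (contMDiffAt_pi_space.2 fun i => contMDiffAt_pi_space.2 fun j => contMDiffAt_hermMat g hy i j)

lemma contDiff_kappaOf (i : Fin 2) : ContDiff ℝ ∞ (fun e : C2 × (Fin 2 → Fin 2 → ℂ) =>
    kappaOf e.1 (Matrix.of e.2) i) := by
  rw [contDiff_iff_contDiffAt]
  intro e
  simp only [kappaOf, Matrix.of_apply]
  fun_prop

lemma contMDiffAt_kappaOf {m : M → Matrix (Fin 2) (Fin 2) ℂ} {τ : M → C2}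
    (hm : ∀ i j, ContMDiffAt 𝓘(ℝ, C2) 𝓘(ℝ, ℂ) ∞ (fun x => m x i j) y)
    (hτ : ContMDiffAt 𝓘(ℝ, C2) 𝓘(ℝ, C2) ∞ τ y) :
    ContMDiffAt 𝓘(ℝ, C2) 𝓘(ℝ, C2) ∞ (fun x => (kappaOf (τ x) (m x) : C2)) y := by
  have hm' : ContMDiffAt 𝓘(ℝ, C2) 𝓘(ℝ, Fin 2 → Fin 2 → ℂ) ∞ (fun x i j => m x i j) y :=
    contMDiffAt_pi_space.2 fun i => contMDiffAt_pi_space.2 fun j => hm i j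
  exact contMDiffAt_pi_space.2 fun i =>
    (contDiff_kappaOf i).contMDiff.contMDiffAt.comp y (hτ.prodMk_space hm')

lemma contMDiffAt_solution [T2Space M] (D : ComplexLinearConnection M) (g : PseudoKahlerMetric M)
    (hy : y ∈ (chartAt C2 x₀).source) :
    ContMDiffAt 𝓘(ℝ, C2) 𝓘(ℝ, (Fin 2 → Fin 2 → ℂ) × C2) ∞
      (fun x => ((fun i j => rescale (hermMat (metricRep g x₀ x)) i j : Fin 2 → Fin 2 → ℂ),
        (kappaOf (christoffelTrace D x₀ x) (rescale (hermMat (metricRep g x₀ x))) : C2))) y := by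
  have hm : ContMDiffAt 𝓘(ℝ, C2) 𝓘(ℝ, Fin 2 → Fin 2 → ℂ) ∞
      (fun x i j => rescale (hermMat (metricRep g x₀ x)) i j) y :=
    contMDiffAt_pi_space.2 fun i => contMDiffAt_pi_space.2 fun j =>
      contMDiffAt_rescale_hermMat g hy i j
  have ht : ContMDiffAt 𝓘(ℝ, C2) 𝓘(ℝ, C2) ∞ (fun x => christoffelTrace D x₀ x) y :=
    contMDiffAt_pi_space.2 fun k => contMDiffAt_christoffelTrace D hy k
  exact hm.prodMk_space (contMDiffAt_kappaOf (fun i j => contMDiffAt_rescale_hermMat g hy i j) ht)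

/-- The matrix `phi` belongs to `D`, but the entries that occur in the system involve only the
invariants `Π`, so they may be computed with the symbols of any equivalent `D'`. -/
lemma sysRHS_phi [T2Space M] {D D' : ComplexLinearConnection M} (hE : CProjEquiv D' D)
    (hy : y ∈ (chartAt C2 x₀).source) (τ' : C2) {m : Matrix (Fin 2) (Fin 2) ℂ}
    (hm : m.IsHermitian) (v : C2) (i j : Fin 2) :
    sysRHS m (kappaOf τ' m) (phi D (chartAt C2 x₀) y v) i j =
      parallelRHS (christoffel D' (chartAt C2 x₀) y) m (chartDeriv x₀ y v) i j
      - 2 / 3 * (∑ k, christoffelTrace D' x₀ y k * chartDeriv x₀ y v k +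
          conj (∑ k, christoffelTrace D' x₀ y k * chartDeriv x₀ y v k)) * m i j
      + 1 / 3 * ((τ' i - christoffelTrace D' x₀ y i) * ∑ s, m s j * chartDeriv x₀ y v s
        + conj (τ' j - christoffelTrace D' x₀ y j) * ∑ s, m i s * conj (chartDeriv x₀ y v s)
        - (∑ k, (τ' k - christoffelTrace D' x₀ y k) * chartDeriv x₀ y v k
          + conj (∑ k, (τ' k - christoffelTrace D' x₀ y k) * chartDeriv x₀ y v k)) * m i j) := by
  refine sysRHS_kappaOf _ (christoffelTrace D' x₀ y) _ hm (CartanGeometry.phi_zero_zero D x₀ y v)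
    (CartanGeometry.phi_succ_zero D x₀ y v) (fun i j => ?_) i j
  rw [CartanGeometry.phi_succ_succ]
  refine Finset.sum_congr rfl fun k _ => ?_
  rw [← hE.projInv_eq hy]
  rfl

/-- Taking `τ'` to be the Christoffel trace of the Levi-Civita connection kills the correction in
`sysRHS_phi`. -/
lemma IsLeviCivita.mvfderiv_rescale [T2Space M] {g : PseudoKahlerMetric M}
    {D D' : ComplexLinearConnection M} (hD : IsLeviCivita g D') (hE : CProjEquiv D' D)
    (hy : y ∈ (chartAt C2 x₀).source) (i j : Fin 2) (v : C2) :
    mvfderiv 𝓘(ℝ, C2) (fun x => rescale (hermMat (metricRep g x₀ x)) i j) y v =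
      sysRHS (rescale (hermMat (metricRep g x₀ y)))
        (kappaOf (christoffelTrace D' x₀ y) (rescale (hermMat (metricRep g x₀ y))))
        (phi D (chartAt C2 x₀) y v) i j := by
  have h1 := hasDerivAt_chartLine hy
    ((contMDiffAt_rescale_hermMat g hy i j).mdifferentiableAt (by simp)) v
  have h2 := hasDerivAt_rescale (m := fun t => hermMat (metricRep g x₀ (chartLine x₀ y v t)))
    (t₀ := 0) (Γ := christoffel D' (chartAt C2 x₀) y) (u := chartDeriv x₀ y v)
    (fun i j => by
      refine (hasDerivAt_chartLine hy
        ((contMDiffAt_hermMat g hy i j).mdifferentiableAt (by simp)) v).congr_deriv ?_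
      rw [chartLine_zero hy]
      exact hD.mvfderiv_hermMat hy i j v)
    (eventually_chartLine hy v (p := fun x => (hermMat (metricRep g x₀ x)).IsHermitian) (by
      filter_upwards [(chartAt C2 x₀).open_source.mem_nhds hy] with x hx
      exact (isHermForm_metricRep g hx).isHermitian))
    (by rw [chartLine_zero hy]; exact hermDet_metricRep g hy) i j
  refine (h1.unique h2).trans ?_
  rw [chartLine_zero hy, sysRHS_phi hE hy _
    (rescale_isHermitian (isHermForm_metricRep g hy).isHermitian)]
  simp only [sub_self, zero_mul, map_zero, Finset.sum_const_zero, add_zero, mul_zero]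
  rfl

namespace CartanGeometry

variable {C : CartanGeometry M F B} {D : ComplexLinearConnection M} {σ : M → B}

/-- The metric at `x` as a function on the model space. -/
def _root_.CProj.innerAt (g : PseudoKahlerMetric M) (x : M) (v w : C2) : ℝ := g.inner x v w

lemma IsAdapted.pullbackAt (hσ : C.IsAdapted D x₀ σ) (hy : y ∈ (chartAt C2 x₀).source)
    (g : PseudoKahlerMetric M) :
    C.PullbackAt (innerAt g y) (σ y) (hermMat (metricRep g x₀ y)) := by
  intro v w
  have h := inner_eq_metricRep g hy (C.projDeriv (σ y) v) (C.projDeriv (σ y) w)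
  simp only [hσ.sol_eq hy]
  rw [← (isHermForm_metricRep g hy).eq_sum]
  exact congrArg _ h

/-- On a section the coefficients are those of the metric in coordinates; elsewhere they are carried
over by `gTransl`, which preserves hermitian symmetry and nondegeneracy. -/
lemma IsCartanGeometryOf.exists_pullbackAt (hC : C.IsCartanGeometryOf D)
    (g : PseudoKahlerMetric M) (b : B) :
    ∃ f, C.PullbackAt (innerAt g (C.proj b)) b f ∧ f.IsHermitian ∧ hermDet f ≠ 0 := by
  refine hC.induction (p := fun b => ∃ f, C.PullbackAt (innerAt g (C.proj b)) b f ∧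
    f.IsHermitian ∧ hermDet f ≠ 0) (fun x₀ σ hσ => ?_) ?_ b
  · have hx := mem_chart_source C2 x₀
    refine ⟨_, ?_, (isHermForm_metricRep g hx).isHermitian, hermDet_metricRep g hx⟩
    rw [hσ.proj_eq hx]
    exact hσ.pullbackAt hx g
  · rintro b q hq ⟨f, h1, h2, h3⟩
    refine ⟨gTransl q f, ?_, gTransl_isHermitian q h2, hermDet_gTransl_ne hq h2 h3⟩
    rw [C.proj_act]
    exact h1.transl hq

/-- A function with a smooth transformation law is smooth near the section as soon as the data
entering the law are smooth on the surface. -/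
lemma IsAdapted.contMDiffAt_of_law [FiniteDimensional ℝ F] (hσ : C.IsAdapted D x₀ σ)
    (hy : y ∈ (chartAt C2 x₀).source) {V W : Type*} [NormedAddCommGroup V] [NormedSpace ℝ V]
    [NormedAddCommGroup W] [NormedSpace ℝ W] {k : B → W} {K : M → V} {T : PParam × V → W}
    (hT : ContDiffAt ℝ ∞ T (idParam, K y)) (hK : ContMDiffAt 𝓘(ℝ, C2) 𝓘(ℝ, V) ∞ K y)
    (hk : ∀ x ∈ (chartAt C2 x₀).source, ∀ q, pdet q ≠ 0 → k (C.act (σ x) (toP q)) = T (q, K x)) :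
    ContMDiffAt 𝓘(ℝ, F) 𝓘(ℝ, W) ∞ k (σ y) := by
  refine hσ.contMDiffAt_of_trivialization hy ?_
  have hK' := (contMDiffAt_iff_chart hy K).1 hK
  have h1 : ContDiffAt ℝ ∞ (fun e : C2 × PParam => (e.2, K ((chartAt C2 x₀).symm e.1)))
      (chartAt C2 x₀ y, idParam) :=
    contDiffAt_snd.prodMk (ContDiffAt.comp (f := Prod.fst) (g := K ∘ (chartAt C2 x₀).symm)
      (chartAt C2 x₀ y, idParam) hK' contDiffAt_fst)
  have h2 := ContDiffAt.comp (g := T) (chartAt C2 x₀ y, idParam) (by simpa [hy] using hT) h1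
  refine h2.congr_of_eventuallyEq ?_
  have ho : {e : C2 × PParam | e.1 ∈ (chartAt C2 x₀).target ∧ pdet e.2 ≠ 0} ∈
      𝓝 (chartAt C2 x₀ y, idParam) :=
    (((chartAt C2 x₀).open_target.preimage continuous_fst).inter
      (isOpen_pdet_ne.preimage continuous_snd)).mem_nhds
      ⟨(chartAt C2 x₀).map_source hy, pdet_idParam_ne⟩
  filter_upwards [ho] with e he
  exact hk _ ((chartAt C2 x₀).map_target he.1) _ he.2

/-- Both sides are additive in the tangent vector, so the hypothesis along the section and the
automatic vertical part add up. -/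
lemma IsAdapted.solvesAt (hσ : C.IsAdapted D x₀ σ) (hy : y ∈ (chartAt C2 x₀).source)
    {h : B → Matrix (Fin 2) (Fin 2) ℂ} {κ : Fin 2 → ℂ}
    (hh : ∀ i j, MDifferentiableAt 𝓘(ℝ, F) 𝓘(ℝ, ℂ) (fun b => h b i j) (σ y))
    (hlaw : ∀ q, pdet q ≠ 0 → h (C.act (σ y) (toP q)) = hTransl q (h (σ y)))
    (hsec : ∀ i j v, mvfderiv 𝓘(ℝ, C2) (fun x => h (σ x) i j) y v =
      sysRHS (h (σ y)) κ (phi D (chartAt C2 x₀) y v) i j) : C.SolvesAt h (σ y) κ := by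
  intro i j v
  obtain ⟨u, q, rfl⟩ := hσ.exists_decomp hy v
  have h1 := C.mvfderiv_fund i j (hh i j) hlaw κ q
  have h2 : mvfderiv 𝓘(ℝ, F) (fun b' => h b' i j) (σ y) (secDeriv (F := F) σ y u) =
      sysRHS (h (σ y)) κ (C.theta (σ y) (secDeriv σ y u)) i j := by
    rw [hσ.theta_secDeriv hy]
    refine Eq.trans ?_ (hsec i j u)
    have := ((hh i j).hasMFDerivAt.comp y
      ((hσ.contMDiffAt hy).mdifferentiableAt (by simp)).hasMFDerivAt).mfderiv
    exact (congrArg (fun L : C2 →L[ℝ] ℂ => L u) this).symm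
  rw [theta_add, sysRHS_add, ← h1, ← h2]
  have h3 := map_add (fieldDeriv (fun b' => h b' i j) (σ y) : F →L[ℝ] ℂ) (secDeriv σ y u)
    (C.fund (σ y) q)
  exact h3

theorem IsCartanGeometryOf.exists_solution [T2Space M] [FiniteDimensional ℝ F]
    (hC : C.IsCartanGeometryOf D) {g : PseudoKahlerMetric M} (hg : IsCompatible g D) :
    ∃ f : B → Matrix (Fin 2) (Fin 2) ℂ,
      C.IsPullback g f ∧ (∀ f', C.IsPullback g f' → f' = f) ∧
      (∀ b, (f b).IsHermitian ∧ hermDet (f b) ≠ 0) ∧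
      (∀ i j, ContMDiff 𝓘(ℝ, F) 𝓘(ℝ, ℂ) ∞ (fun b => f b i j)) ∧
      ∃ k : B → Fin 2 → ℂ,
        (∀ i, ContMDiff 𝓘(ℝ, F) 𝓘(ℝ, ℂ) ∞ (fun b => k b i)) ∧
        C.SolvesSystem (fun b => rescale (f b)) k := by
  obtain ⟨D', hLC, hE⟩ := hg
  choose f hf hherm hdet using hC.exists_pullbackAt g
  have hfσ : ∀ {x₀ : M} {σ : M → B}, C.IsAdapted D x₀ σ → ∀ y ∈ (chartAt C2 x₀).source,
      f (σ y) = hermMat (metricRep g x₀ y) := by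
    intro x₀ σ hσ y hy
    have := hf (σ y)
    rw [hσ.proj_eq hy] at this
    exact this.unique (hσ.pullbackAt hy g)
  have hflaw : ∀ b q, pdet q ≠ 0 → f (C.act b (toP q)) = gTransl q (f b) := by
    intro b q hq
    have := hf (C.act b (toP q))
    rw [C.proj_act] at this
    exact this.unique ((hf b).transl hq)
  have hfsm : ∀ i j, ContMDiff 𝓘(ℝ, F) 𝓘(ℝ, ℂ) ∞ (fun b => f b i j) := by
    have key : ∀ b, ContMDiffAt 𝓘(ℝ, F) 𝓘(ℝ, Fin 2 → Fin 2 → ℂ) ∞ (fun b i j => f b i j) b := by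
      refine hC.induction (fun x₀ σ hσ => ?_) (fun b q hq hb => ?_)
      · have hx := mem_chart_source C2 x₀
        refine hσ.contMDiffAt_of_law hx (K := fun x i j => hermMat (metricRep g x₀ x) i j)
          (T := fun e i j => gTransl e.1 (Matrix.of e.2) i j)
          (contDiffAt_pi.2 fun i => contDiffAt_pi.2 fun j => contDiffAt_gTransl i j _)
          (contMDiffAt_matrix fun i j => contMDiffAt_hermMat g hx i j) fun x hx q hq => ?_
        rw [hflaw _ _ hq, hfσ hσ x hx]
        rfl
      · refine contMDiffAt_transl_iff (k' := fun b i j => f b i j)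
          (T := fun m i j => gTransl q (Matrix.of m) i j) ?_ (fun b' => ?_) hb
        · refine contDiff_pi.2 fun i => contDiff_pi.2 fun j => contDiff_iff_contDiffAt.2 fun m => ?_
          exact (contDiffAt_gTransl i j (q, m)).comp m (contDiffAt_const.prodMk contDiffAt_id)
        · rw [hflaw _ _ hq]
          rfl
    exact fun i j b => contMDiffAt_pi_space.1 (contMDiffAt_pi_space.1 (key b) i) j
  set h : B → Matrix (Fin 2) (Fin 2) ℂ := fun b => rescale (f b) with hh
  have hhherm : ∀ b, (h b).IsHermitian := fun b => rescale_isHermitian (hherm b)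
  have hhlaw : ∀ b q, pdet q ≠ 0 → h (C.act b (toP q)) = hTransl q (h b) := by
    intro b q hq
    simp only [hh, hflaw b q hq]
    exact rescale_gTransl hq (hherm b)
  have hhsm : ∀ i j, ContMDiff 𝓘(ℝ, F) 𝓘(ℝ, ℂ) ∞ (fun b => h b i j) := fun i j b =>
    (contDiffAt_rescale i j (m := fun i j => f b i j) (hdet b)).contMDiffAt.comp b
      (contMDiffAt_matrix fun i j => hfsm i j b)
  have hsolσ : ∀ {x₀ : M} {σ : M → B}, C.IsAdapted D x₀ σ → ∀ y ∈ (chartAt C2 x₀).source,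
      C.SolvesAt h (σ y) (kappaOf (christoffelTrace D' x₀ y)
        (rescale (hermMat (metricRep g x₀ y)))) := by
    intro x₀ σ hσ y hy
    refine hσ.solvesAt hy (fun i j => (hhsm i j _).mdifferentiableAt (by simp))
      (fun q hq => hhlaw _ q hq) fun i j v => ?_
    have e : (fun x => h (σ x) i j) =ᶠ[𝓝 y]
        fun x => rescale (hermMat (metricRep g x₀ x)) i j := by
      filter_upwards [(chartAt C2 x₀).open_source.mem_nhds hy] with x hx
      simp only [hh, hfσ hσ x hx]
    have e1 := congrArg (fun L : C2 →L[ℝ] ℂ => L v) (e.mfderiv_eq (I := 𝓘(ℝ, C2)) (I' := 𝓘(ℝ, ℂ)))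
    refine Eq.trans e1 ?_
    have e2 : h (σ y) = rescale (hermMat (metricRep g x₀ y)) := by simp only [hh, hfσ hσ y hy]
    rw [e2]
    exact hLC.mvfderiv_rescale hE hy i j v
  -- Only pointwise existence of `κ` is propagated along the fibres; because `κ` is unique, the
  -- chosen values obey `kTransl` and agree with the explicit ones on sections, and this is what
  -- makes them smooth.
  have hsol : ∀ b, ∃ κ, C.SolvesAt h b κ := by
    refine hC.induction (fun x₀ σ hσ => ⟨_, hsolσ hσ x₀ (mem_chart_source C2 x₀)⟩) ?_
    rintro b q hq ⟨κ, hκ⟩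
    exact ⟨_, hκ.transl (hhherm b) hq hhsm fun b' => hhlaw b' q hq⟩
  choose k hk using hsol
  have hklaw : ∀ b q, pdet q ≠ 0 → k (C.act b (toP q)) = kTransl q (h b) (k b) := fun b q hq =>
    (hk _).unique ((hk b).transl (hhherm b) hq hhsm fun b' => hhlaw b' q hq)
  refine ⟨f, isPullback_iff.2 hf, fun f' hf' => ?_, fun b => ⟨hherm b, hdet b⟩, hfsm, k, ?_,
    solvesSystem_iff.2 hk⟩
  · ext1 b
    exact PullbackAt.unique (isPullback_iff.1 hf' b) (hf b)
  · have key : ∀ b, ContMDiffAt 𝓘(ℝ, F) 𝓘(ℝ, C2) ∞ k b := by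
      refine hC.induction (fun x₀ σ hσ => ?_) (fun b q hq hb => ?_)
      · have hx := mem_chart_source C2 x₀
        refine hσ.contMDiffAt_of_law hx
          (K := fun x => ((fun i j => rescale (hermMat (metricRep g x₀ x)) i j :
              Fin 2 → Fin 2 → ℂ),
            (kappaOf (christoffelTrace D' x₀ x) (rescale (hermMat (metricRep g x₀ x))) : C2)))
          (T := fun e => kTransl e.1 (Matrix.of e.2.1) e.2.2)
          (contDiffAt_pi.2 fun j => contDiffAt_kTransl j pdet_idParam_ne) ?_
          fun x hx q hq => ?_
        · exact contMDiffAt_solution D' g hx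
        · rw [hklaw _ _ hq, (hk _).unique (hsolσ hσ x hx)]
          simp only [hh, hfσ hσ x hx]
          rfl
      · refine contMDiffAt_transl_iff
          (k' := fun b => ((fun i j => h b i j : Fin 2 → Fin 2 → ℂ), k b))
          (T := fun e => kTransl q (Matrix.of e.1) e.2) ?_ (fun b' => ?_)
          ((contMDiffAt_matrix fun i j => hhsm i j b).prodMk_space hb)
        · refine contDiff_pi.2 fun j => contDiff_iff_contDiffAt.2 fun m => ?_
          exact (contDiffAt_kTransl j (e := (q, m)) hq).comp m
            (contDiffAt_const.prodMk contDiffAt_id)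
        · rw [hklaw _ _ hq]
          rfl
    exact fun i b => contMDiffAt_pi_space.1 (key b) i

end CartanGeometry

end Bundle

/-! ### Equivariance of solutions -/

/-- The parameters of the inverse. -/
def invParam (q : PParam) : PParam :=
  (fun i j => (pdet q)⁻¹ * (Matrix.of q.1).adjugate i j,
    fun j => -∑ s, q.2 s * (Matrix.of q.1).adjugate s j)

lemma adjugate_zero_zero (a : Fin 2 → Fin 2 → ℂ) : (Matrix.of a).adjugate 0 0 = a 1 1 := by
  simp [Matrix.adjugate_fin_two]
lemma adjugate_zero_one (a : Fin 2 → Fin 2 → ℂ) : (Matrix.of a).adjugate 0 1 = -a 0 1 := by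
  simp [Matrix.adjugate_fin_two]
lemma adjugate_one_zero (a : Fin 2 → Fin 2 → ℂ) : (Matrix.of a).adjugate 1 0 = -a 1 0 := by
  simp [Matrix.adjugate_fin_two]
lemma adjugate_one_one (a : Fin 2 → Fin 2 → ℂ) : (Matrix.of a).adjugate 1 1 = a 0 0 := by
  simp [Matrix.adjugate_fin_two]

lemma pdet_invParam {q : PParam} (hq : pdet q ≠ 0) : pdet (invParam q) = (pdet q)⁻¹ := by
  have h := pdet_eq q
  rw [pdet_eq (invParam q)]
  simp only [invParam, adjugate_zero_zero, adjugate_zero_one, adjugate_one_zero, adjugate_one_one]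
  field_simp
  rw [h]
  ring

lemma mulParam_invParam {q : PParam} (hq : pdet q ≠ 0) : mulParam (invParam q) q = idParam := by
  have h := pdet_eq q
  ext i j
  · simp only [mulParam, invParam, idParam, Fin.sum_univ_two]
    fin_cases i <;> fin_cases j <;>
      simp [adjugate_zero_zero, adjugate_zero_one, adjugate_one_zero, adjugate_one_one] <;>
      field_simp <;> (try rw [h]) <;> ring
  · simp only [mulParam, pdet_invParam hq, idParam, Fin.sum_univ_two]
    simp only [invParam, Fin.sum_univ_two]
    fin_cases i <;>
      simp [adjugate_zero_zero, adjugate_zero_one, adjugate_one_zero, adjugate_one_one] <;>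
      rw [h] <;> ring

lemma toP_invParam {q : PParam} (hq : pdet q ≠ 0) : toP q * toP (invParam q) = 1 := by
  have h : toP (invParam q) * toP q = 1 := by
    rw [← toP_mulParam (by rw [pdet_invParam hq]; exact inv_ne_zero hq) hq, mulParam_invParam hq,
      toP_idParam]
  rw [eq_inv_of_mul_eq_one_left h, mul_inv_cancel]

/-- `mulParam` as a linear function of its second argument. -/
def mulParamCLM (q : PParam) : PParam →L[ℝ] PParam :=
  LinearMap.toContinuousLinearMap
    { toFun := mulParam q
      map_add' := fun a b => by
        ext i j <;> simp [mulParam, Fin.sum_univ_two] <;> ring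
      map_smul' := fun c a => by
        ext i j <;> simp [mulParam, Fin.sum_univ_two] <;> ring }

/-- The matrix `(adj a)ᵀ m conj (adj a)`. -/
def adjTr (a : Fin 2 → Fin 2 → ℂ) (m : Matrix (Fin 2) (Fin 2) ℂ) : Matrix (Fin 2) (Fin 2) ℂ :=
  conjTr (fun i j => (Matrix.of a).adjugate i j) m

/-- Since `adj a · a = det a`, applying `aᵀ · ā` to `h` recovers `m'` times `|det a|²`. -/
lemma hTransl_of_adjTr {q : PParam} (hq : pdet q ≠ 0) {m m' : Matrix (Fin 2) (Fin 2) ℂ}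
    (h : adjTr q.1 m' = m) : m' = hTransl q m := by
  have hq' : conj (pdet q) ≠ 0 := by simpa using hq
  have e : conjTr q.1 m = (pdet q * conj (pdet q)) • m' := by
    rw [← h, pdet_eq]
    ext i j
    simp only [conjTr, adjTr, Matrix.of_apply, Matrix.smul_apply, smul_eq_mul, Fin.sum_univ_two,
      adjugate_zero_zero, adjugate_zero_one, adjugate_one_zero, adjugate_one_one, map_sub, map_mul,
      map_neg]
    fin_cases i <;> fin_cases j <;> simp <;> ring
  rw [hTransl, e, smul_smul, inv_mul_cancel₀ (mul_ne_zero hq hq'), one_smul]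

/-- Undoing the group action by the adjugate instead of the inverse keeps everything linear in `a`,
as the adjugate of a 2 × 2 matrix is. With `a' = a r`, `adj a' = (tr r - r) adj a`, and this cancels
the vertical derivative `(-tr r) m + rᵀ m` and its conjugate counterpart. -/
lemma hasDerivAt_adjTr {a a' r : Fin 2 → Fin 2 → ℂ} {β κ : Fin 2 → ℂ}
    (hr : ∀ i j, a' i j = ∑ s, a i s * r s j)
    {m : ℝ → Matrix (Fin 2) (Fin 2) ℂ}
    (hm : ∀ i j, HasDerivAt (fun t => m t i j)
      (sysRHS (m 0) κ (blockMat (-(Matrix.of r).trace) (r, β)) i j) 0) (i j : Fin 2) :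
    HasDerivAt (fun t : ℝ => adjTr (a + t • a') (m t) i j) 0 0 := by
  have ha : ∀ i j : Fin 2, HasDerivAt (fun t : ℝ => (a + t • a') i j) (a' i j) 0 := by
    intro i j
    have h := ((hasDerivAt_id (0 : ℝ)).ofReal_comp.mul_const (a' i j)).const_add (a i j)
    simpa using h
  have hc : ∀ i j : Fin 2,
      HasDerivAt (fun t : ℝ => conj ((a + t • a') i j)) (conj (a' i j)) 0 :=
    fun i j => (Complex.conjCLE.toContinuousLinearMap.hasFDerivAt).comp_hasDerivAt (0 : ℝ) (ha i j)
  have hA : ∀ i j : Fin 2, HasDerivAt (fun t : ℝ => (Matrix.of (a + t • a')).adjugate i j)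
      ((Matrix.of a').adjugate i j) 0 := by
    intro i j
    fin_cases i <;> fin_cases j <;>
      simp only [Fin.zero_eta, Fin.mk_one, adjugate_zero_zero, adjugate_zero_one,
        adjugate_one_zero, adjugate_one_one]
    exacts [ha _ _, (ha _ _).neg, (ha _ _).neg, ha _ _]
  have hAc : ∀ i j : Fin 2, HasDerivAt (fun t : ℝ => conj ((Matrix.of (a + t • a')).adjugate i j))
      (conj ((Matrix.of a').adjugate i j)) 0 :=
    fun i j => (Complex.conjCLE.toContinuousLinearMap.hasFDerivAt).comp_hasDerivAt (0 : ℝ) (hA i j)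
  have hs := (((((hA 0 i).mul (hm 0 0)).mul (hAc 0 j)).add
    (((hA 0 i).mul (hm 0 1)).mul (hAc 1 j)))).add
    ((((hA 1 i).mul (hm 1 0)).mul (hAc 0 j)).add
    (((hA 1 i).mul (hm 1 1)).mul (hAc 1 j)))
  refine (hs.congr_of_eventuallyEq (.of_forall fun t => ?_)).congr_deriv ?_
  · simp [adjTr, conjTr, Fin.sum_univ_two]
  · have h0 : a + (0 : ℝ) • a' = a := by simp
    simp only [h0, Pi.mul_apply, sysRHS, Fin.sum_univ_two, blockMat_zero_zero, blockMat_succ_zero,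
      blockMat_succ_succ, Matrix.trace_fin_two, Matrix.of_apply]
    fin_cases i <;> fin_cases j <;>
      simp only [Fin.zero_eta, Fin.mk_one, adjugate_zero_zero, adjugate_zero_one,
        adjugate_one_zero, adjugate_one_one, hr, Fin.sum_univ_two, map_add, map_mul, map_neg,
        mul_zero, add_zero, map_zero] <;> ring

section Bundle

variable {M : Type*} [TopologicalSpace M] [ChartedSpace C2 M] [IsManifold 𝓘(ℂ, C2) ω M]
  {F : Type*} [NormedAddCommGroup F] [NormedSpace ℝ F]
  {B : Type*} [TopologicalSpace B] [ChartedSpace F B] [IsManifold 𝓘(ℝ, F) ∞ B]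

namespace CartanGeometry

variable {C : CartanGeometry M F B}

/-- The orbit map at `q` is the orbit map at the identity of the translated point, precomposed with
left multiplication by the inverse of `q`, which is linear in the parameters. -/
lemma hasFDerivAt_orbit_of_ne {k : B → ℂ} {b : B} {q : PParam} (hq : pdet q ≠ 0)
    (hk : MDifferentiableAt 𝓘(ℝ, F) 𝓘(ℝ, ℂ) k (C.act b (toP q))) :
    HasFDerivAt (fun q' => k (C.act b (toP q')))
      (((fieldDeriv k (C.act b (toP q))).comp (C.fund (C.act b (toP q)))).comp
        (mulParamCLM (invParam q))) q := by
  have hi : pdet (invParam q) ≠ 0 := by rw [pdet_invParam hq]; exact inv_ne_zero hq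
  have h1 := C.hasFDerivAt_orbit hk
  have h2 : mulParamCLM (invParam q) q = idParam := mulParam_invParam hq
  have h3 := HasFDerivAt.comp q (g := fun q' => k (C.act (C.act b (toP q)) (toP q')))
    (f := mulParamCLM (invParam q)) (by rw [h2]; exact h1)
    (mulParamCLM (invParam q)).hasFDerivAt
  refine h3.congr_of_eventuallyEq ?_
  filter_upwards [isOpen_pdet_ne.mem_nhds hq] with q' hq'
  have e : toP (mulParamCLM (invParam q) q') = toP (invParam q) * toP q' :=
    toP_mulParam hi hq'
  simp only [Function.comp, e, ← C.act_mul, ← mul_assoc, toP_invParam hq, one_mul]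

variable {h : B → Matrix (Fin 2) (Fin 2) ℂ} {k : B → Fin 2 → ℂ}

lemma hasDerivAt_adjTr_orbit (hsm : ∀ i j, ContMDiff 𝓘(ℝ, F) 𝓘(ℝ, ℂ) ∞ (fun b => h b i j))
    (hsol : ∀ b, C.SolvesAt h b (k b)) (b : B) {q : PParam} (hq : pdet q ≠ 0) (q' : PParam)
    (i j : Fin 2) :
    HasDerivAt (fun t : ℝ => adjTr (q + t • q').1 (h (C.act b (toP (q + t • q')))) i j) 0 0 := by
  set r := mulParamCLM (invParam q) q' with hrdef
  have hr : ∀ i j, q'.1 i j = ∑ s, q.1 i s * r.1 s j := by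
    intro i j
    have h := pdet_eq q
    simp only [hrdef, mulParamCLM, LinearMap.coe_toContinuousLinearMap', LinearMap.coe_mk,
      AddHom.coe_mk, mulParam, invParam, Fin.sum_univ_two, adjugate_zero_zero, adjugate_zero_one,
      adjugate_one_zero, adjugate_one_one]
    fin_cases i <;> simp <;> field_simp <;> rw [h] <;> ring
  refine hasDerivAt_adjTr (a := q.1) (a' := q'.1) (r := r.1) (β := r.2)
    (κ := k (C.act b (toP q))) hr (m := fun t => h (C.act b (toP (q + t • q')))) (fun i j => ?_) i j
  have hline : HasDerivAt (fun t : ℝ => q + t • q') q' 0 := by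
    simpa using ((hasDerivAt_id (0 : ℝ)).smul_const q').const_add q
  have h0 : q + (0 : ℝ) • q' = q := by simp
  have h1 := HasFDerivAt.comp_hasDerivAt_of_eq (0 : ℝ)
    (C.hasFDerivAt_orbit_of_ne (b := b) hq ((hsm i j _).mdifferentiableAt (by simp))) hline h0.symm
  refine h1.congr_deriv ?_
  have h2 := hsol (C.act b (toP q)) i j (C.fund (C.act b (toP q)) r)
  rw [C.theta_fund] at h2
  simp only [h0]
  exact h2

/-- Solutions of the differential system transform by `hTransl` under right translations. -/
lemma solution_law (hsm : ∀ i j, ContMDiff 𝓘(ℝ, F) 𝓘(ℝ, ℂ) ∞ (fun b => h b i j))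
    (hsol : ∀ b, C.SolvesAt h b (k b)) (b : B) {q : PParam} (hq : pdet q ≠ 0) :
    h (C.act b (toP q)) = hTransl q (h b) := by
  refine hTransl_of_adjTr hq ?_
  ext i j
  -- A real segment from the identity to `q` may meet singular matrices. A complex line avoids the
  -- problem: removing finitely many points does not disconnect the plane.
  set ℓ : ℂ → PParam := fun s => idParam + s • (q - idParam) with hℓ
  have hℓr : ∀ (s s' : ℂ) (t : ℝ), ℓ (s + t • s') = ℓ s + t • (s' • (q - idParam)) := by
    intro s s' t
    simp only [hℓ, add_smul, smul_assoc, add_assoc]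
  set S : Set ℂ := {s | pdet (ℓ s) ≠ 0} with hS
  have hℓc : Continuous ℓ := by fun_prop
  have hSo : IsOpen S := isOpen_pdet_ne.preimage hℓc
  -- Along the line the determinant is a polynomial in `s` with value one at `s = 0`, so its zero
  -- set is finite.
  have hcount : Sᶜ.Countable := by
    let p : Polynomial ℂ := (Polynomial.C (idParam.1 0 0) + Polynomial.X * Polynomial.C
      ((q - idParam).1 0 0)) * (Polynomial.C (idParam.1 1 1) + Polynomial.X * Polynomial.C
      ((q - idParam).1 1 1)) - (Polynomial.C (idParam.1 0 1) + Polynomial.X * Polynomial.C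
      ((q - idParam).1 0 1)) * (Polynomial.C (idParam.1 1 0) + Polynomial.X * Polynomial.C
      ((q - idParam).1 1 0))
    have hp : ∀ s, p.eval s = pdet (ℓ s) := by
      intro s
      simp only [p, pdet_eq, hℓ]
      simp
    have hp0 : p ≠ 0 := by
      intro h0
      have := hp 0
      rw [h0] at this
      simp [hℓ, pdet_idParam] at this
    refine ((Polynomial.finite_setOfPred_isRoot hp0).subset fun s hs => ?_).countable
    have hs' : pdet (ℓ s) = 0 := by simpa [hS] using hs
    exact (hp s).trans hs'
  have hconn : IsPreconnected S := by
    have := (hcount.isPathConnected_compl_of_one_lt_rank (E := ℂ)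
      (by rw [Complex.rank_real_complex]; norm_num)).isConnected.isPreconnected
    rwa [compl_compl] at this
  set φ : ℂ → ℂ := fun s => adjTr (ℓ s).1 (h (C.act b (toP (ℓ s)))) i j with hφ
  have hdiff : ∀ s ∈ S, DifferentiableAt ℝ φ s := by
    intro s hs
    have hℓd : DifferentiableAt ℝ ℓ s := by fun_prop
    have hN : ∀ i j, DifferentiableAt ℝ (fun s => h (C.act b (toP (ℓ s))) i j) s := fun i j =>
      DifferentiableAt.comp s (f := ℓ) (g := fun q' => h (C.act b (toP q')) i j)
        (C.hasFDerivAt_orbit_of_ne hs ((hsm i j _).mdifferentiableAt (by simp))).differentiableAt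
        hℓd
    have hℓ' : ∀ i j, DifferentiableAt ℝ (fun s => (ℓ s).1 i j) s := fun i j => by
      simp only [hℓ]; fun_prop
    have hA : ∀ i j, DifferentiableAt ℝ (fun s => (Matrix.of (ℓ s).1).adjugate i j) s := by
      intro i j
      fin_cases i <;> fin_cases j <;>
        simp only [Fin.zero_eta, Fin.mk_one, adjugate_zero_zero, adjugate_zero_one,
          adjugate_one_zero, adjugate_one_one]
      exacts [hℓ' _ _, (hℓ' _ _).neg, (hℓ' _ _).neg, hℓ' _ _]
    have hAc : ∀ i j, DifferentiableAt ℝ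
        (fun s => conj ((Matrix.of (ℓ s).1).adjugate i j)) s := fun i j =>
      Complex.conjCLE.differentiableAt.comp s (hA i j)
    simp only [hφ, adjTr, conjTr, Matrix.of_apply, Fin.sum_univ_two]
    exact ((((hA 0 i).mul (hN 0 0)).mul (hAc 0 j)).add (((hA 0 i).mul (hN 0 1)).mul (hAc 1 j))).add
      ((((hA 1 i).mul (hN 1 0)).mul (hAc 0 j)).add (((hA 1 i).mul (hN 1 1)).mul (hAc 1 j)))
  -- The adjugate-transformed solution has zero derivative in every real direction, so it is
  -- constant on the connected set `S` and its values at `s = 1` and `s = 0` agree.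
  have hzero : S.EqOn (fderiv ℝ φ) 0 := by
    intro s hs
    ext1 s'
    have hl : HasDerivAt (fun t : ℝ => s + t • s') s' 0 := by
      simpa using ((hasDerivAt_id (0 : ℝ)).smul_const s').const_add s
    have h1 := (hdiff s hs).hasFDerivAt.comp_hasDerivAt_of_eq (0 : ℝ) hl (by simp)
    have h2 := hasDerivAt_adjTr_orbit hsm hsol b hs (s' • (q - idParam)) i j
    refine h1.unique (h2.congr_of_eventuallyEq (.of_forall fun t => ?_))
    simp only [hφ, Function.comp, hℓr]
  have h1 : (1 : ℂ) ∈ S := by simpa [hS, hℓ] using hq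
  have h0 : (0 : ℂ) ∈ S := by simpa [hS, hℓ] using pdet_idParam_ne
  have := hSo.is_const_of_fderiv_eq_zero hconn (fun s hs => (hdiff s hs).differentiableWithinAt)
    hzero h1 h0
  simp only [hφ, hℓ, one_smul, zero_smul, add_zero, add_sub_cancel, act_toP_idParam] at this
  rw [this]
  simp only [adjTr, conjTr, Matrix.of_apply, Fin.sum_univ_two]
  fin_cases i <;> fin_cases j <;> simp [idParam, adjugate_zero_zero, adjugate_zero_one,
    adjugate_one_zero, adjugate_one_one]

end CartanGeometry

end Bundle

/-! ### Hermitian forms from matrices -/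

/-- The real bilinear form `Re (m_{i\bar j} v^i conj w^j)`. -/
def hermForm (m : Matrix (Fin 2) (Fin 2) ℂ) : C2 →L[ℝ] C2 →L[ℝ] ℝ :=
  LinearMap.toContinuousLinearMap (LinearMap.toContinuousLinearMap.toLinearMap ∘ₗ
    LinearMap.mk₂ ℝ (fun v w : C2 => (∑ i, ∑ j, m i j * v i * conj (w j)).re)
      (fun v v' w => by
        rw [← Complex.add_re]
        congr 1
        simp only [Fin.sum_univ_two, Pi.add_apply]
        ring)
      (fun c v w => by
        rw [smul_eq_mul, ← Complex.re_ofReal_mul]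
        congr 1
        simp only [Fin.sum_univ_two, Pi.smul_apply, Complex.real_smul]
        ring)
      (fun v w w' => by
        rw [← Complex.add_re]
        congr 1
        simp only [Fin.sum_univ_two, Pi.add_apply, map_add]
        ring)
      (fun c v w => by
        rw [smul_eq_mul, ← Complex.re_ofReal_mul]
        congr 1
        simp only [Fin.sum_univ_two, Pi.smul_apply, Complex.real_smul, map_mul,
          Complex.conj_ofReal]
        ring))

lemma hermForm_apply (m : Matrix (Fin 2) (Fin 2) ℂ) (v w : C2) :
    hermForm m v w = (∑ i, ∑ j, m i j * v i * conj (w j)).re := rfl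

lemma contDiff_hermForm :
    ContDiff ℝ ∞ (fun m : Fin 2 → Fin 2 → ℂ => hermForm (Matrix.of m)) := by
  refine contDiff_clm_apply_iff.2 fun v => contDiff_clm_apply_iff.2 fun w => ?_
  simp only [hermForm_apply, Matrix.of_apply]
  have h : ContDiff ℝ ∞ (fun m : Fin 2 → Fin 2 → ℂ => ∑ i, ∑ j, m i j * v i * conj (w j)) := by
    fun_prop
  exact Complex.reCLM.contDiff.comp h

section Form

variable {m : Matrix (Fin 2) (Fin 2) ℂ}

lemma isHermForm_hermForm (hm : m.IsHermitian) : IsHermForm (hermForm m) where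
  symm v w := by
    rw [hermForm_apply, hermForm_apply, ← Complex.conj_re]
    congr 1
    simp only [Fin.sum_univ_two, map_add, map_mul, isHermitian_apply hm, Complex.conj_conj]
    ring
  inv v w := by
    rw [hermForm_apply, hermForm_apply]
    congr 1
    simp only [Fin.sum_univ_two, Pi.smul_apply, smul_eq_mul, map_mul, Complex.conj_I]
    linear_combination (-(m 0 0 * v 0 * conj (w 0) + m 0 1 * v 0 * conj (w 1)
      + (m 1 0 * v 1 * conj (w 0) + m 1 1 * v 1 * conj (w 1)))) * Complex.I_mul_I

lemma hermForm_eq_sum (hm : m.IsHermitian) (v w : C2) : (hermForm m v w : ℂ) =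
    ∑ i, ∑ j, m i j * ((v i * conj (w j) + w i * conj (v j)) / 2) := by
  rw [hermForm_apply, ← mul_div_cancel_left₀ ((Complex.re _ : ℝ) : ℂ) (two_ne_zero' ℂ)]
  have h := Complex.add_conj (∑ i, ∑ j, m i j * v i * conj (w j))
  push_cast at h
  rw [← h]
  simp only [Fin.sum_univ_two, map_add, map_mul, isHermitian_apply hm, Complex.conj_conj]
  ring

/-- Pairing with `e_j` and `i e_j` gives the real and imaginary parts of the linear system for `v`,
which Cramer's rule solves. -/
lemma hermForm_nondegenerate (hm : m.IsHermitian) (h0 : hermDet m ≠ 0) {v : C2}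
    (hv : ∀ w, hermForm m v w = 0) : v = 0 := by
  have hD : m 0 0 * m 1 1 - m 0 1 * m 1 0 ≠ 0 := by
    rw [← hermDet_eq hm]
    exact_mod_cast h0
  have key : ∀ j, ∑ i, m i j * v i = 0 := by
    intro j
    have h1 := hv (Pi.single j 1)
    have h2 := hv (Pi.single j Complex.I)
    rw [hermForm_apply] at h1 h2
    have e : ∀ c : ℂ, ∑ i, ∑ j', m i j' * v i * conj ((Pi.single j c : C2) j') =
        (∑ i, m i j * v i) * conj c := by
      intro c
      fin_cases j <;> simp [Fin.sum_univ_two] <;> ring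
    rw [e] at h1 h2
    apply Complex.ext
    · simpa using h1
    · simpa using h2
  have k0 := key 0
  have k1 := key 1
  simp only [Fin.sum_univ_two] at k0 k1
  ext i
  refine (mul_eq_zero.1 (?_ : (m 0 0 * m 1 1 - m 0 1 * m 1 0) * v i = 0)).resolve_left hD
  fin_cases i
  · simp only [Fin.zero_eta]
    linear_combination m 1 1 * k0 - m 1 0 * k1
  · simp only [Fin.mk_one]
    linear_combination m 0 0 * k1 - m 0 1 * k0

end Form

/-! ### Complex projective changes of connection -/

/-- The complex linear form with coefficients `υ`. -/
def dotForm (υ : C2) : C2 →L[ℝ] ℂ := ∑ k, υ k • ContinuousLinearMap.proj (R := ℝ) k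

lemma dotForm_apply (υ v : C2) : dotForm υ v = ∑ k, υ k * v k := by
  simp [dotForm]

/-- The endomorphism `v ↦ υ(v) w + υ(w) v`. -/
def projChange (υ w : C2) : C2 →L[ℝ] C2 :=
  (dotForm υ).smulRight w + dotForm υ w • ContinuousLinearMap.id ℝ C2

lemma projChange_apply (υ w v : C2) :
    projChange υ w v = dotForm υ v • w + dotForm υ w • v := by
  simp [projChange]

lemma projChange_comm (υ w v : C2) : projChange υ w v = projChange υ v w := by
  rw [projChange_apply, projChange_apply, add_comm]

lemma dotForm_I_smul (υ v : C2) : dotForm υ (Complex.I • v) = Complex.I * dotForm υ v := by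
  simp only [dotForm_apply, Fin.sum_univ_two, Pi.smul_apply, smul_eq_mul]
  ring

lemma projChange_I_smul (υ w v : C2) :
    projChange υ (Complex.I • w) v = Complex.I • projChange υ w v := by
  rw [projChange_apply, projChange_apply, dotForm_I_smul, smul_add, smul_smul, smul_smul,
    smul_smul, mul_comm]

lemma contDiff_projChange : ContDiff ℝ ∞ (fun e : C2 × C2 => projChange e.1 e.2) := by
  refine contDiff_clm_apply_iff.2 fun v => contDiff_pi.2 fun i => ?_
  simp only [projChange_apply, dotForm_apply, Fin.sum_univ_two, Pi.add_apply, Pi.smul_apply,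
    smul_eq_mul]
  fun_prop

/-- `projChange` as a bilinear map. -/
def projChangeL (υ : C2) : C2 →L[ℝ] C2 →L[ℝ] C2 :=
  LinearMap.toContinuousLinearMap
    { toFun := projChange υ
      map_add' := fun w w' => by
        ext1 v
        simp only [projChange_apply, add_apply, map_add, smul_add, add_smul]
        abel
      map_smul' := fun c w => by
        ext1 v
        simp only [projChange_apply, smul_apply, map_smul, RingHom.id_apply, smul_add,
          smul_assoc]
        rw [smul_comm] }

/-- The Christoffel symbols of the connection changed by `projChange υ`. -/
def shiftChristoffel (Γ : Fin 2 → Fin 2 → Fin 2 → ℂ) (υ : C2) (s i k : Fin 2) : ℂ :=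
  Γ s i k + (υ k * (if s = i then 1 else 0) + υ i * (if s = k then 1 else 0))

/-- Consistency of the two descriptions of the change: by indices on symbols and invariantly on
vectors. -/
lemma sum_shiftChristoffel (Γ : Fin 2 → Fin 2 → Fin 2 → ℂ) (υ w u : C2) (s : Fin 2) :
    ∑ i, w i * ∑ k, shiftChristoffel Γ υ s i k * u k =
      ∑ i, w i * ∑ k, Γ s i k * u k + projChange υ w u s := by
  rw [projChange_apply, dotForm_apply, dotForm_apply]
  simp only [shiftChristoffel, Fin.sum_univ_two, Pi.add_apply, Pi.smul_apply, smul_eq_mul]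
  fin_cases s <;> simp <;> ring

/-! ### Families of forms parallel for a projectively changed connection -/

section Surface

variable {M : Type*} [TopologicalSpace M] [ChartedSpace C2 M] [IsManifold 𝓘(ℂ, C2) ω M]
variable {x₀ y : M}

/-- A family of bilinear forms on the tangent spaces which in the coordinates at `x₀` is hermitian
with matrix `m x₀`, smooth, nondegenerate, and parallel for the connection obtained from `D` by the
change `projChange (υ x₀)`. -/
structure IsParallelFamily (D : ComplexLinearConnection M) (β : M → C2 →L[ℝ] C2 →L[ℝ] ℝ)
    (m : M → M → Matrix (Fin 2) (Fin 2) ℂ) (υ : M → M → C2) : Prop where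
  rep : ∀ {x₀ y : M}, y ∈ (chartAt C2 x₀).source → ∀ v w,
    β y v w = hermForm (m x₀ y) (chartDeriv x₀ y v) (chartDeriv x₀ y w)
  isHermitian : ∀ {x₀ y : M}, y ∈ (chartAt C2 x₀).source → (m x₀ y).IsHermitian
  hermDet_ne : ∀ {x₀ y : M}, y ∈ (chartAt C2 x₀).source → hermDet (m x₀ y) ≠ 0
  smooth : ∀ {x₀ y : M}, y ∈ (chartAt C2 x₀).source → ∀ i j,
    ContMDiffAt 𝓘(ℝ, C2) 𝓘(ℝ, ℂ) ∞ (fun x => m x₀ x i j) y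
  smooth_change : ∀ {x₀ y : M}, y ∈ (chartAt C2 x₀).source →
    ContMDiffAt 𝓘(ℝ, C2) 𝓘(ℝ, C2) ∞ (fun x => υ x₀ x) y
  parallel : ∀ {x₀ y : M}, y ∈ (chartAt C2 x₀).source → ∀ i j v,
    mvfderiv 𝓘(ℝ, C2) (fun x => m x₀ x i j) y v =
      parallelRHS (shiftChristoffel (christoffel D (chartAt C2 x₀) y) (υ x₀ y)) (m x₀ y)
        (chartDeriv x₀ y v) i j

namespace IsParallelFamily

variable {D : ComplexLinearConnection M} {β : M → C2 →L[ℝ] C2 →L[ℝ] ℝ}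
  {m : M → M → Matrix (Fin 2) (Fin 2) ℂ} {υ : M → M → C2}

lemma rep_self (h : IsParallelFamily D β m υ) (x : M) : β x = hermForm (m x x) := by
  ext v w
  rw [h.rep (mem_chart_source C2 x), chartDeriv_self]
  rfl

/-- The covariant derivative of a vector field for the changed connection, in coordinates. -/
lemma mvfderiv_apply (h : IsParallelFamily D β m υ) (hy : y ∈ (chartAt C2 x₀).source)
    {X Y : ∀ x : M, TangentSpace 𝓘(ℝ, C2) x} (hX : DiffFieldAt X y) (hY : DiffFieldAt Y y)
    (v : C2) :
    mvfderiv 𝓘(ℝ, C2) (fun x => β x (X x) (Y x)) y v =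
      hermForm (m x₀ y) (chartDeriv x₀ y (D.nabla X y v) +
        projChange (υ x₀ y) (chartDeriv x₀ y (X y)) (chartDeriv x₀ y v)) (chartDeriv x₀ y (Y y))
      + hermForm (m x₀ y) (chartDeriv x₀ y (X y)) (chartDeriv x₀ y (D.nabla Y y v) +
        projChange (υ x₀ y) (chartDeriv x₀ y (Y y)) (chartDeriv x₀ y v)) := by
  set z := chartAt C2 x₀
  set u := chartDeriv x₀ y v with hu
  have hs : ∀ᶠ x in 𝓝 y, x ∈ z.source := z.open_source.mem_nhds hy
  set c := chartLine x₀ y v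
  have hc0 : c 0 = y := chartLine_zero hy v
  have hfield : ∀ {X : ∀ x : M, TangentSpace 𝓘(ℝ, C2) x}, DiffFieldAt X y →
      HasDerivAt (fun t : ℝ => localRep x₀ X (z y + t • u))
        (fderiv ℝ (localRep x₀ X) (z y) u) 0 := by
    intro X hX
    have hX' := (diffFieldAt_iff hy X).1 hX
    have hl : HasDerivAt (fun t : ℝ => z y + t • u) u 0 := by
      simpa using ((hasDerivAt_id (0 : ℝ)).smul_const u).const_add (z y)
    exact hX'.hasFDerivAt.comp_hasDerivAt_of_eq (0 : ℝ) hl (by simp [z])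
  have hcomp : ∀ {X : ∀ x : M, TangentSpace 𝓘(ℝ, C2) x}, DiffFieldAt X y → ∀ i,
      HasDerivAt (fun t : ℝ => localRep x₀ X (z y + t • u) i)
        (fderiv ℝ (localRep x₀ X) (z y) u i) 0 := fun hX i => hasDerivAt_pi.1 (hfield hX) i
  have hcompc : ∀ {X : ∀ x : M, TangentSpace 𝓘(ℝ, C2) x}, DiffFieldAt X y → ∀ i,
      HasDerivAt (fun t : ℝ => conj (localRep x₀ X (z y + t • u) i))
        (conj (fderiv ℝ (localRep x₀ X) (z y) u i)) 0 := fun hX i =>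
    (Complex.conjCLE.toContinuousLinearMap.hasFDerivAt).comp_hasDerivAt (0 : ℝ) (hcomp hX i)
  have hm : ∀ i j, HasDerivAt (fun t => m x₀ (c t) i j)
      (parallelRHS (shiftChristoffel (christoffel D z y) (υ x₀ y)) (m x₀ y) u i j) 0 := by
    intro i j
    refine (hasDerivAt_chartLine hy ((h.smooth hy i j).mdifferentiableAt (by simp)) v).congr_deriv ?_
    exact h.parallel hy i j v
  have hterm := fun i j => ((hm i j).mul (hcomp hX i)).mul (hcompc hY j)
  have hsum := ((hterm 0 0).add (hterm 0 1)).add ((hterm 1 0).add (hterm 1 1))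
  have hre := Complex.reCLM.hasFDerivAt.comp_hasDerivAt (0 : ℝ) hsum
  have hdiff : MDifferentiableAt 𝓘(ℝ, C2) 𝓘(ℝ, ℝ) (fun x => β x (X x) (Y x)) y := by
    have hX' := (diffFieldAt_iff hy X).1 hX
    have hY' := (diffFieldAt_iff hy Y).1 hY
    rw [mdifferentiableAt_iff_chart hy]
    have hm' : ∀ i j, DifferentiableAt ℝ (fun p => m x₀ (z.symm p) i j) (z y) := fun i j =>
      (mdifferentiableAt_iff_chart hy _).1 ((h.smooth hy i j).mdifferentiableAt (by simp))
    have hXi : ∀ i, DifferentiableAt ℝ (fun p => localRep x₀ X p i) (z y) :=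
      differentiableAt_pi.1 hX'
    have hYi : ∀ i, DifferentiableAt ℝ (fun p => conj (localRep x₀ Y p i)) (z y) := fun i =>
      Complex.conjCLE.differentiableAt.comp (z y) (differentiableAt_pi.1 hY' i)
    have ht := fun i j => ((hm' i j).mul (hXi i)).mul (hYi j)
    have hsum := ((ht 0 0).add (ht 0 1)).add ((ht 1 0).add (ht 1 1))
    refine (Complex.reCLM.differentiableAt.comp (z y) hsum).congr_of_eventuallyEq ?_
    filter_upwards [target_mem_nhds hy] with p hp
    refine (h.rep (z.map_target hp) _ _).trans ?_
    rw [hermForm_apply]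
    simp only [Function.comp, Complex.reCLM_apply, Fin.sum_univ_two]
    rfl
  have h1 := hasDerivAt_chartLine hy hdiff v
  refine (h1.unique (hre.congr_of_eventuallyEq ?_)).trans ?_
  · filter_upwards [eventually_chartLine hy v hs] with t ht
    refine (h.rep ht _ _).trans ?_
    rw [hermForm_apply]
    simp only [Function.comp, Complex.reCLM_apply, Fin.sum_univ_two]
    rfl
  -- The changed covariant derivative is the directional derivative plus the shifted symbols. The
  -- symbol terms are what the parallel equation contributes when the coefficient matrix is
  -- differentiated.
  · have hnab : ∀ {X : ∀ x : M, TangentSpace 𝓘(ℝ, C2) x}, DiffFieldAt X y → ∀ s,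
        (chartDeriv x₀ y (D.nabla X y v) + projChange (υ x₀ y) (chartDeriv x₀ y (X y)) u) s =
        fderiv ℝ (localRep x₀ X) (z y) u s + ∑ i, chartDeriv x₀ y (X y) i *
          ∑ k, shiftChristoffel (christoffel D z y) (υ x₀ y) s i k * u k := by
      intro X hX s
      have e : chartDeriv x₀ y (D.nabla X y v) s = fderiv ℝ (localRep x₀ X) (z y) u s
          + christoffelVec D z y u (chartDeriv x₀ y (X y)) s :=
        congrFun (chartDeriv_nabla D hy hX v) s
      rw [sum_shiftChristoffel, Pi.add_apply]
      refine (congrArg (· + projChange (υ x₀ y) (chartDeriv x₀ y (X y)) u s) e).trans ?_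
      have hcc : christoffel D z y s 0 1 = christoffel D z y s 1 0 := christoffel_comm D hy s 0 1
      simp only [z, christoffelVec_eq_sum D hy]
      simp only [Fin.sum_univ_two]
      rw [hcc]
      ring
    rw [hermForm_apply, hermForm_apply, ← Complex.add_re, Complex.reCLM_apply]
    refine congrArg Complex.re ?_
    have h0 : ∀ X : ∀ x : M, TangentSpace 𝓘(ℝ, C2) x,
        localRep x₀ X (z y + (0 : ℝ) • u) = chartDeriv x₀ y (X y) := fun X => by
      rw [zero_smul, add_zero]
      exact localRep_comp_chart hy X
    simp only [hnab hX, hnab hY, h0, hc0, Pi.mul_apply, parallelRHS]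
    simp only [Fin.sum_univ_two, map_add, map_mul]
    ring

end IsParallelFamily

end Surface

/-- A trilinear expression symmetric in the first two and skew in the outer arguments vanishes. -/
lemma eq_zero_of_symm_of_skew {E : Type*} {T : E → E → E → ℝ}
    (h1 : ∀ a b c, T a b c = T b a c) (h2 : ∀ a b c, T a b c = -T c b a) (a b c : E) :
    T a b c = 0 := by
  linarith [h1 a b c, h1 b c a, h1 c a b, h2 a b c, h2 b c a, h2 c a b]

/-! ### The metric and the connection defined by a parallel family -/

section Surface

variable {M : Type*} [TopologicalSpace M] [ChartedSpace C2 M] [IsManifold 𝓘(ℂ, C2) ω M]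
variable {x₀ y : M}

/-- A tangent vector as an element of `ℂ²`, in the preferred chart at its base point. -/
abbrev asVec {x : M} (v : TangentSpace 𝓘(ℝ, C2) x) : C2 := v

lemma chartDeriv_symmL (hy : y ∈ (chartAt C2 x₀).source) (u : C2) :
    chartDeriv x₀ y ((trivializationAt C2 (TangentSpace 𝓘(ℝ, C2)) x₀).symmL ℝ y u) = u := by
  rw [chartDeriv_eq_trivialization hy]
  exact Bundle.Trivialization.continuousLinearMapAt_symmL _ (by simpa using hy) u

namespace IsParallelFamily

variable {D : ComplexLinearConnection M} {β : M → C2 →L[ℝ] C2 →L[ℝ] ℝ}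
  {m : M → M → Matrix (Fin 2) (Fin 2) ℂ} {υ : M → M → C2}

lemma symm (h : IsParallelFamily D β m υ) (x : M) (v w : C2) : β x v w = β x w v := by
  rw [h.rep_self]
  exact (isHermForm_hermForm (h.isHermitian (mem_chart_source C2 x))).symm v w

lemma nondegenerate (h : IsParallelFamily D β m υ) (x : M) {v : C2} (hv : ∀ w, β x v w = 0) :
    v = 0 := by
  rw [h.rep_self] at hv
  exact hermForm_nondegenerate (h.isHermitian (mem_chart_source C2 x))
    (h.hermDet_ne (mem_chart_source C2 x)) hv

/-- The change of connection does not depend on the coordinates. -/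
lemma chartDeriv_projChange (h : IsParallelFamily D β m υ) (hy : y ∈ (chartAt C2 x₀).source)
    (w v : C2) :
    chartDeriv x₀ y (projChange (υ y y) w v) =
      projChange (υ x₀ y) (chartDeriv x₀ y w) (chartDeriv x₀ y v) := by
  set L := chartDeriv x₀ y
  set H := hermForm (m x₀ y)
  have hH := isHermForm_hermForm (h.isHermitian hy)
  have hyy := mem_chart_source C2 y
  set S : C2 → C2 → C2 := fun w v =>
    L (projChange (υ y y) w v) - projChange (υ x₀ y) (L w) (L v) with hS
  -- `S` measures the dependence of the change on the chart. It is symmetric by construction.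
  -- Computing the derivative of the form in both charts and comparing makes `H (S a b) (L c)` skew
  -- in `a` and `c`, since the terms from `D` agree. This is the uniqueness argument for the
  -- Levi-Civita connection.
  have key : ∀ a b c, H (S a b) (L c) = 0 := by
    refine eq_zero_of_symm_of_skew (T := fun a b c => H (S a b) (L c)) (fun a b c => ?_)
      fun a b c => ?_
    · simp only [hS]
      rw [projChange_comm _ a, projChange_comm _ (L a)]
    · have hfield : ∀ u : C2, (coordField (chartAt C2 y) u y : C2) = u := fun u => by
        have := chartDeriv_coordField hyy u
        rwa [chartDeriv_self] at this
      have hXd := diffFieldAt_coordField hyy a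
      have hYd := diffFieldAt_coordField hyy c
      have e1 := h.mvfderiv_apply hyy hXd hYd b
      have e2 := h.mvfderiv_apply hy hXd hYd b
      rw [e2, ← h.rep_self] at e1
      simp only [chartDeriv_self] at e1
      set p : C2 := asVec (D.nabla (coordField (chartAt C2 y) a) y b)
      set q : C2 := asVec (D.nabla (coordField (chartAt C2 y) c) y b)
      have e3 : H (L p + projChange (υ x₀ y) (L a) (L b)) (L c)
          + H (L a) (L q + projChange (υ x₀ y) (L c) (L b)) =
          β y (p + projChange (υ y y) a b) c + β y a (q + projChange (υ y y) c b) := by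
        rw [hfield, hfield] at e1
        exact e1
      rw [h.rep hy, h.rep hy] at e3
      simp only [hS]
      rw [hH.symm _ (L a)]
      simp only [map_add, map_sub, add_apply, sub_apply] at e3 ⊢
      linarith
  have hz : S w v = 0 := by
    refine hermForm_nondegenerate (h.isHermitian hy) (h.hermDet_ne hy) fun u => ?_
    have := key w v (coordField (chartAt C2 x₀) u y)
    rwa [show L (coordField (chartAt C2 x₀) u y) = u from chartDeriv_coordField hy u] at this
  exact sub_eq_zero.1 hz

lemma smooth_form (h : IsParallelFamily D β m υ) :
    ContMDiff 𝓘(ℝ, C2) (𝓘(ℝ, C2).prod 𝓘(ℝ, C2 →L[ℝ] C2 →L[ℝ] ℝ)) ∞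
    (fun x => TotalSpace.mk' (C2 →L[ℝ] C2 →L[ℝ] ℝ)
      (E := fun x : M => TangentSpace 𝓘(ℝ, C2) x →L[ℝ] TangentSpace 𝓘(ℝ, C2) x →L[ℝ] ℝ)
      x (β x)) := by
  intro x₀
  have hx₀ := mem_chart_source C2 x₀
  refine (contMDiffAt_hom_bundle _).2 ⟨contMDiffAt_id, ?_⟩
  have hm : ContMDiffAt 𝓘(ℝ, C2) 𝓘(ℝ, C2 →L[ℝ] C2 →L[ℝ] ℝ) ∞
      (fun x => hermForm (m x₀ x)) x₀ := by
    have h1 : ContMDiffAt 𝓘(ℝ, C2) 𝓘(ℝ, Fin 2 → Fin 2 → ℂ) ∞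
        (fun x i j => m x₀ x i j) x₀ :=
      contMDiffAt_pi_space.2 fun i => contMDiffAt_pi_space.2 fun j => h.smooth hx₀ i j
    exact contDiff_hermForm.contMDiff.contMDiffAt.comp x₀ h1
  refine hm.congr_of_eventuallyEq ?_
  filter_upwards [(chartAt C2 x₀).open_source.mem_nhds hx₀] with x hx
  have hb : x ∈ (trivializationAt C2 (TangentSpace 𝓘(ℝ, C2) : M → Type) x₀).baseSet := by
    simpa using hx
  ext v w
  refine (inCoordinates_apply_eq₂ (E₃ := Bundle.Trivial M ℝ) hb hb (Set.mem_univ _)).trans ?_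
  refine (LinearMap.congr_fun (Bundle.Trivial.linearMapAt_trivialization ℝ M ℝ x) _).trans ?_
  refine (h.rep hx _ _).trans ?_
  have e := chartDeriv_symmL hx v
  have e' := chartDeriv_symmL hx w
  rw [Trivialization.symmL_apply _ hb] at e e'
  exact congrArg₂ (fun a b : C2 => hermForm (m x₀ x) a b) e e'

/-- The section of the endomorphism bundle obtained by applying the change of connection. -/
def changeSection (υ : M → M → C2) (X : ∀ x : M, TangentSpace 𝓘(ℝ, C2) x) (x : M) :
    TangentSpace 𝓘(ℝ, C2) x →L[ℝ] TangentSpace 𝓘(ℝ, C2) x :=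
  projChange (υ x x) (asVec (X x))

/-- The change of connection applied to a smooth vector field is smooth. -/
lemma smooth_change_apply (h : IsParallelFamily D β m υ) {X : ∀ x : M, TangentSpace 𝓘(ℝ, C2) x}
    (hX : ContMDiff 𝓘(ℝ, C2) (𝓘(ℝ, C2).prod 𝓘(ℝ, C2)) ∞
      (fun y => TotalSpace.mk' C2 (E := fun y : M => TangentSpace 𝓘(ℝ, C2) y) y (X y))) :
    ContMDiff 𝓘(ℝ, C2) (𝓘(ℝ, C2).prod 𝓘(ℝ, C2 →L[ℝ] C2)) ∞
    (fun x => TotalSpace.mk' (C2 →L[ℝ] C2)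
      (E := fun x : M => TangentSpace 𝓘(ℝ, C2) x →L[ℝ] TangentSpace 𝓘(ℝ, C2) x)
      x (changeSection υ X x)) := by
  intro x₀
  have hx₀ := mem_chart_source C2 x₀
  have hX' : ContMDiffAt 𝓘(ℝ, C2) 𝓘(ℝ, C2) ∞ (fun x => chartDeriv x₀ x (asVec (X x))) x₀ :=
    (contMDiffAt_iff_chart hx₀ _).2 ((contMDiffAt_field_iff hx₀ X).1 (hX x₀))
  have hm : ContMDiffAt 𝓘(ℝ, C2) 𝓘(ℝ, C2 →L[ℝ] C2) ∞
      (fun x => projChange (υ x₀ x) (chartDeriv x₀ x (asVec (X x)))) x₀ :=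
    ContMDiffAt.comp (I' := 𝓘(ℝ, C2 × C2)) (g := fun e : C2 × C2 => projChange e.1 e.2)
      (f := fun x => (υ x₀ x, chartDeriv x₀ x (asVec (X x)))) x₀
      contDiff_projChange.contMDiff.contMDiffAt ((h.smooth_change hx₀).prodMk_space hX')
  refine (contMDiffAt_hom_bundle _).2 ⟨contMDiffAt_id, ?_⟩
  refine hm.congr_of_eventuallyEq ?_
  filter_upwards [(chartAt C2 x₀).open_source.mem_nhds hx₀] with x hx
  refine ContinuousLinearMap.ext fun v => ?_
  have e : chartDeriv x₀ x (projChange (υ x x) (asVec (X x))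
      ((trivializationAt C2 (TangentSpace 𝓘(ℝ, C2)) x₀).symmL ℝ x v)) =
      projChange (υ x₀ x) (chartDeriv x₀ x (asVec (X x))) v :=
    (h.chartDeriv_projChange hx _ _).trans (congrArg _ (chartDeriv_symmL hx v))
  refine Eq.trans ?_ e
  rw [chartDeriv_eq_trivialization hx]
  rfl

/-- The connection for which the family of forms is parallel. -/
def connection (h : IsParallelFamily D β m υ) : ComplexLinearConnection M where
  nabla := D.nabla.addOneForm fun x => projChangeL (υ x x)
  smooth := ⟨⟨fun {σ} hσ => by
    have h1 := D.smooth.contMDiff.contMDiff hσ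
    have h2 := h.smooth_change_apply (X := σ) (contMDiffOn_univ.1 (by simpa using hσ))
    exact h1.add_section h2.contMDiffOn⟩⟩
  torsionFree := by
    refine (CovariantDerivative.torsion_eq_zero_iff _).2 fun {X Y x} hX hY => ?_
    refine Eq.trans ?_ (torsionFree_apply D hX hY)
    change (asVec (D.nabla Y x (X x)) + projChange (υ x x) (asVec (Y x)) (asVec (X x))) -
      (asVec (D.nabla X x (Y x)) + projChange (υ x x) (asVec (X x)) (asVec (Y x))) = _
    rw [projChange_comm _ (asVec (X x))]
    exact add_sub_add_right_eq_sub _ _ _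
  complexLinear Y x hY v := by
    change asVec (D.nabla (fun y => J y (Y y)) x v) +
        projChange (υ x x) (Complex.I • asVec (Y x)) (asVec v) =
      Complex.I • (asVec (D.nabla Y x v) + projChange (υ x x) (asVec (Y x)) (asVec v))
    rw [projChange_I_smul, smul_add]
    exact congrArg (· + Complex.I • projChange (υ x x) (asVec (Y x)) (asVec v)) (D.complexLinear Y x hY v)

lemma mvfderiv_connection (h : IsParallelFamily D β m υ)
    {X Y : ∀ x : M, TangentSpace 𝓘(ℝ, C2) x} {x : M} (hX : DiffFieldAt X x) (hY : DiffFieldAt Y x)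
    (v : C2) :
    mvfderiv 𝓘(ℝ, C2) (fun y => β y (X y) (Y y)) x v =
      β x (h.connection.nabla X x v) (Y x) + β x (X x) (h.connection.nabla Y x v) := by
  have e := h.mvfderiv_apply (mem_chart_source C2 x) hX hY v
  rw [← h.rep_self] at e
  simp only [chartDeriv_self] at e
  exact e

/-- The metric given by the family of forms. -/
def metric (h : IsParallelFamily D β m υ) : PseudoKahlerMetric M where
  inner x := β x
  symm x v w := h.symm x v w
  nondegenerate x v hv := h.nondegenerate x hv
  smooth := h.smooth_form
  hermitian x v w := by
    rw [h.rep_self]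
    exact (isHermForm_hermForm (h.isHermitian (mem_chart_source C2 x))).inv v w
  closed X Y Z x hX hY hZ := by
    -- Closedness follows because `ω` is parallel for a torsion-free connection: each derivative
    -- becomes two terms in `∇`, each bracket is a difference of covariant derivatives, and skewness
    -- of `ω` makes everything cancel.
    have inv : ∀ v w : C2, β x (Complex.I • v) w = -β x (Complex.I • w) v := fun v w => by
      have hH := isHermForm_hermForm (h.isHermitian (mem_chart_source C2 x))
      rw [h.rep_self, ← hH.inv, smul_smul, Complex.I_mul_I, neg_one_smul, map_neg, neg_apply,
        hH.symm]
    set N := fun (X Y : ∀ x : M, TangentSpace 𝓘(ℝ, C2) x) => asVec (h.connection.nabla Y x (X x))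
    have hd : ∀ {X Y Z : ∀ x : M, TangentSpace 𝓘(ℝ, C2) x}, DiffFieldAt Y x → DiffFieldAt Z x →
        mvfderiv 𝓘(ℝ, C2) (fun y => β y (J y (Y y)) (Z y)) x (X x) =
          β x (Complex.I • N X Y) (asVec (Z x)) - β x (Complex.I • N X Z) (asVec (Y x)) := by
      intro X Y Z hY hZ
      refine (h.mvfderiv_connection hY.J_apply hZ (X x)).trans ?_
      rw [sub_eq_add_neg, ← inv]
      exact congrArg (fun e => β x e (Z x) + β x (Complex.I • asVec (Y x)) (N X Z))
        (h.connection.complexLinear Y x hY (X x))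
    have hb : ∀ {X Y Z : ∀ x : M, TangentSpace 𝓘(ℝ, C2) x}, DiffFieldAt X x → DiffFieldAt Y x →
        β x (J x (VectorField.mlieBracket 𝓘(ℝ, C2) X Y x)) (Z x) =
          β x (Complex.I • N X Y) (asVec (Z x)) - β x (Complex.I • N Y X) (asVec (Z x)) := by
      intro X Y Z hX hY
      rw [← sub_apply, ← map_sub, ← smul_sub]
      exact congrArg (fun e : C2 => β x (Complex.I • e) (Z x))
        (torsionFree_apply h.connection hX hY).symm
    refine Eq.trans (congrArg₂ (· - ·) (congrArg₂ (· - ·) (congrArg₂ (· - ·)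
      (congrArg₂ (· + ·) (congrArg₂ (· + ·) (hd (X := X) hY hZ) (hd (X := Y) hZ hX))
        (hd (X := Z) hX hY)) (hb (Z := Z) hX hY)) (hb (Z := X) hY hZ)) (hb (Z := Y) hZ hX)) ?_
    ring

lemma isLeviCivita (h : IsParallelFamily D β m υ) : IsLeviCivita h.metric h.connection :=
  fun _ _ _ hX hY v => h.mvfderiv_connection hX hY v

/-- On equal arguments the change is `2 υ(γ') γ'`, a complex multiple of the velocity. Generalised
geodesics do not see it, because their condition only asks for acceleration in the span of `γ'` and
`J γ'`. -/
lemma covAccel_connection (h : IsParallelFamily D β m υ) {γ : ℝ → M} {t : ℝ}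
    (hγ : ContMDiffAt 𝓘(ℝ, ℝ) 𝓘(ℝ, C2) ∞ γ t) : asVec (covAccel h.connection γ t) =
      asVec (covAccel D γ t) +
        (2 * dotForm (υ (γ t) (γ t)) (asVec (velocity γ t))) • asVec (velocity γ t) := by
  have hs := mem_chart_source C2 (γ t)
  have e1 := chartDeriv_covAccel D hs hγ
  have e2 := chartDeriv_covAccel h.connection hs hγ
  have e3 := chartDeriv_velocity hs hγ
  rw [← e3] at e1 e2
  simp only [chartDeriv_self] at e1 e2
  have e4 : ∀ u : C2, christoffelVec h.connection (chartAt C2 (γ t)) (γ t) u u =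
      christoffelVec D (chartAt C2 (γ t)) (γ t) u u + (2 * dotForm (υ (γ t) (γ t)) u) • u := by
    intro u
    have hfield : (coordField (chartAt C2 (γ t)) u (γ t) : C2) = u := by
      have := chartDeriv_coordField hs u
      rwa [chartDeriv_self] at this
    refine (map_add (chartDeriv (γ t) (γ t)) _ _).trans (congrArg₂ _ rfl ?_)
    rw [chartDeriv_self]
    change projChange (υ (γ t) (γ t)) (coordField (chartAt C2 (γ t)) u (γ t))
      (coordField (chartAt C2 (γ t)) u (γ t)) = _
    rw [hfield, projChange_apply, ← add_smul, two_mul]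
  rw [e4, ← add_assoc] at e2
  refine Eq.trans e2 ?_
  exact congrArg (· + (2 * dotForm (υ (γ t) (γ t)) (asVec (velocity γ t))) • asVec (velocity γ t)) e1.symm

lemma cProjEquiv (h : IsParallelFamily D β m υ) : CProjEquiv h.connection D := by
  have key : ∀ (c : ℂ) (v : C2), c • v = c.re • v + c.im • (Complex.I • v) := fun c v => by
    conv_lhs => rw [← Complex.re_add_im c, add_smul, mul_smul]
    rfl
  intro γ s
  refine and_congr_right fun hs => and_congr_right fun _ => and_congr_right fun hγ =>
    forall₂_congr fun t ht => and_congr_right fun _ => ?_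
  have e := h.covAccel_connection (hγ.contMDiffAt (hs.mem_nhds ht))
  rw [key] at e
  set c := 2 * dotForm (υ (γ t) (γ t)) (asVec (velocity γ t))
  constructor
  · rintro ⟨a, b, hab⟩
    refine ⟨a - c.re, b - c.im, ?_⟩
    have hab' : asVec (covAccel h.connection γ t) =
      a • asVec (velocity γ t) + b • (Complex.I • asVec (velocity γ t)) := hab
    rw [e] at hab'
    change asVec (covAccel D γ t) =
      (a - c.re) • asVec (velocity γ t) + (b - c.im) • (Complex.I • asVec (velocity γ t))
    rw [sub_smul, sub_smul, ← sub_eq_zero, ← sub_eq_zero.2 hab']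
    abel
  · rintro ⟨a, b, hab⟩
    refine ⟨a + c.re, b + c.im, ?_⟩
    refine e.trans ?_
    have hab' : asVec (covAccel D γ t) =
      a • asVec (velocity γ t) + b • (Complex.I • asVec (velocity γ t)) := hab
    change _ = (a + c.re) • asVec (velocity γ t) + (b + c.im) • (Complex.I • asVec (velocity γ t))
    rw [hab', add_smul, add_smul]
    abel

lemma isCompatible (h : IsParallelFamily D β m υ) : IsCompatible h.metric D :=
  ⟨h.connection, h.isLeviCivita, h.cProjEquiv⟩

end IsParallelFamily

end Surface

/-! ### From solutions to compatible metrics -/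

/-- The matrix `m (det m)^{-2}`. -/
def unscale (m : Matrix (Fin 2) (Fin 2) ℂ) : Matrix (Fin 2) (Fin 2) ℂ :=
  ((hermDet m ^ (-2 : ℤ) : ℝ) : ℂ) • m

lemma unscale_isHermitian {m : Matrix (Fin 2) (Fin 2) ℂ} (hm : m.IsHermitian) :
    (unscale m).IsHermitian :=
  smul_isHermitian (Complex.conj_ofReal _) hm

lemma hermDet_unscale_ne {m : Matrix (Fin 2) (Fin 2) ℂ} (h0 : hermDet m ≠ 0) :
    hermDet (unscale m) ≠ 0 := by
  rw [unscale, hermDet_smul]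
  exact mul_ne_zero (pow_ne_zero _ (zpow_ne_zero _ h0)) h0

lemma contDiffAt_unscale (i j : Fin 2) {m : Fin 2 → Fin 2 → ℂ} (hm : hermDet (Matrix.of m) ≠ 0) :
    ContDiffAt ℝ ∞ (fun m : Fin 2 → Fin 2 → ℂ => unscale (Matrix.of m) i j) m := by
  have h1 : ContDiffAt ℝ ∞ (fun m : Fin 2 → Fin 2 → ℂ => hermDet (Matrix.of m) ^ (-2 : ℤ)) m := by
    simp only [zpow_neg]
    exact ((contDiffAt_hermDet m).pow 2).inv (pow_ne_zero 2 hm)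
  have h2 := Complex.ofRealCLM.contDiff.contDiffAt.comp m h1
  exact ContDiffAt.mul h2 (by simp only [Matrix.of_apply]; fun_prop)

/-- The covector `τ` with `kappaOf τ m = κ`. -/
def tauOf (m : Matrix (Fin 2) (Fin 2) ℂ) (κ : Fin 2 → ℂ) : C2 := fun i =>
  -3 * (m i 0 * conj (κ 1) - m i 1 * conj (κ 0)) / (m 0 0 * m 1 1 - m 0 1 * m 1 0)

/-- For nondegenerate `m` the relation between `κ` and `τ` is an invertible linear system up to
conjugation; `tauOf` is its solution by Cramer's rule. -/
lemma kappaOf_tauOf {m : Matrix (Fin 2) (Fin 2) ℂ} (hm : m.IsHermitian) (h0 : hermDet m ≠ 0)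
    (κ : Fin 2 → ℂ) : kappaOf (tauOf m κ) m = κ := by
  have hD : m 0 0 * m 1 1 - m 0 1 * m 1 0 ≠ 0 := by
    rw [← hermDet_eq hm]
    exact_mod_cast h0
  have h3 : conj (3 : ℂ) = 3 := Complex.conj_ofNat 3
  have hc : conj (m 0 0 * m 1 1 - m 0 1 * m 1 0) = m 0 0 * m 1 1 - m 0 1 * m 1 0 := by
    rw [← hermDet_eq hm, Complex.conj_ofReal]
  ext j
  simp only [kappaOf, tauOf]
  rw [map_div₀, map_div₀, hc]
  simp only [map_mul, map_neg, map_sub, isHermitian_apply hm, Complex.conj_conj, h3]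
  generalize hΔ : m 0 0 * m 1 1 - m 0 1 * m 1 0 = Δ at hD
  fin_cases j <;> simp only [Fin.zero_eta, Fin.mk_one] <;> field_simp <;> rw [← hΔ] <;> ring

/-- The covector `(τ' - τ) / 3`. -/
def thirdDiff (τ' τ : C2) : C2 := fun k => 1 / 3 * (τ' k - τ k)

/-- The right-hand side is that of `sysRHS_kappaOf`. A solution whose `κ` comes from an arbitrary
`τ'` is therefore a rescaled parallel form for the shifted symbols. -/
lemma parallelRHS_shiftChristoffel (Γ : Fin 2 → Fin 2 → Fin 2 → ℂ) (τ' τ : C2)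
    (m : Matrix (Fin 2) (Fin 2) ℂ) (u : C2) (i j : Fin 2) :
    parallelRHS (shiftChristoffel Γ (thirdDiff τ' τ)) m u i j
      - 2 / 3 * (∑ k, τ' k * u k + conj (∑ k, τ' k * u k)) * m i j =
    parallelRHS Γ m u i j
      - 2 / 3 * (∑ k, τ k * u k + conj (∑ k, τ k * u k)) * m i j
      + 1 / 3 * ((τ' i - τ i) * ∑ s, m s j * u s + conj (τ' j - τ j) * ∑ s, m i s * conj (u s)
        - (∑ k, (τ' k - τ k) * u k + conj (∑ k, (τ' k - τ k) * u k)) * m i j) := by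
  have h3 : conj (3 : ℂ) = 3 := Complex.conj_ofNat 3
  simp only [parallelRHS, shiftChristoffel, thirdDiff, Fin.sum_univ_two, map_add, map_mul,
    map_sub, map_div₀, map_one, h3]
  fin_cases i <;> fin_cases j <;> simp <;> ring

/-- In complex dimension two a projective change by `υ` adds `3 υ` to the trace, which explains the
third in `thirdDiff`. -/
lemma trace_shiftChristoffel (Γ : Fin 2 → Fin 2 → Fin 2 → ℂ) (τ' : C2) (k : Fin 2) :
    ∑ l, shiftChristoffel Γ (thirdDiff τ' fun k => ∑ l, Γ l l k) l l k = τ' k := by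
  simp only [shiftChristoffel, thirdDiff, Fin.sum_univ_two]
  fin_cases k <;> simp <;> ring

/-! ### The inverse rescaling along lines -/

section Line

variable {m : ℝ → Matrix (Fin 2) (Fin 2) ℂ} {t₀ : ℝ} {Γ : Fin 2 → Fin 2 → Fin 2 → ℂ} {u : C2}
  {T : ℂ}

/-- The parallel part contributes `2 Re T` to the logarithmic derivative, and the density term
contributes `-4/3 Re T` for each of the two dimensions, leaving `-2/3 Re T`. -/
lemma hasDerivAt_hermDet_of_solution (hT : ∑ k, (∑ l, Γ l l k) * u k = T)
    (hm : ∀ i j, HasDerivAt (fun t => m t i j)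
      (parallelRHS Γ (m t₀) u i j - 2 / 3 * (T + conj T) * m t₀ i j) t₀)
    (hh : ∀ᶠ t in 𝓝 t₀, (m t).IsHermitian) :
    HasDerivAt (fun t => hermDet (m t)) (-2 / 3 * T.re * hermDet (m t₀)) t₀ := by
  refine hasDerivAt_hermDet hm hh ?_
  have h1 := parallelRHS_det Γ (m t₀) u
  rw [hT] at h1
  have h2 := Complex.add_conj T
  have h3 := hermDet_eq hh.self_of_nhds
  push_cast at h2 ⊢
  rw [h3]
  linear_combination (-1 : ℂ) * h1 + (1 / 3 : ℂ) * (m t₀ 0 0 * m t₀ 1 1 - m t₀ 0 1 * m t₀ 1 0) * h2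

lemma hasDerivAt_unscale (hT : ∑ k, (∑ l, Γ l l k) * u k = T)
    (hm : ∀ i j, HasDerivAt (fun t => m t i j)
      (parallelRHS Γ (m t₀) u i j - 2 / 3 * (T + conj T) * m t₀ i j) t₀)
    (hh : ∀ᶠ t in 𝓝 t₀, (m t).IsHermitian) (h0 : hermDet (m t₀) ≠ 0) (i j : Fin 2) :
    HasDerivAt (fun t => unscale (m t) i j) (parallelRHS Γ (unscale (m t₀)) u i j) t₀ := by
  have hd := hasDerivAt_hermDet_of_solution hT hm hh
  have hρ := ((hasDerivAt_zpow (-2) (hermDet (m t₀)) (Or.inl h0)).comp t₀ hd).ofReal_comp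
  refine (hρ.mul (hm i j)).congr_deriv ?_
  -- The power `-2` turns the rate `-2/3 Re T` into `4/3 Re T = 2/3 (T + T̄)`, exactly cancelling
  -- the density term of the solution.
  have e : ((((-2 : ℤ) : ℝ) * hermDet (m t₀) ^ (-2 - 1 : ℤ) *
      (-2 / 3 * T.re * hermDet (m t₀)) : ℝ) : ℂ) =
      2 / 3 * (T + conj T) * ((hermDet (m t₀) ^ (-2 : ℤ) : ℝ) : ℂ) := by
    rw [Complex.add_conj, zpow_sub_one₀ h0]
    have : ((-2 : ℤ) : ℝ) * (hermDet (m t₀) ^ (-2 : ℤ) * (hermDet (m t₀))⁻¹) *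
      (-2 / 3 * T.re * hermDet (m t₀)) = 2 / 3 * (2 * T.re) * hermDet (m t₀) ^ (-2 : ℤ) := by
      push_cast
      field_simp
    rw [this]
    push_cast
    ring
  rw [e]
  simp only [Function.comp, parallelRHS, unscale, Matrix.smul_apply, smul_eq_mul,
    Fin.sum_univ_two]
  ring

end Line

/-! ### Solutions in a chart and smoothness of the projective change -/

section Surface

variable {M : Type*} [TopologicalSpace M] [ChartedSpace C2 M] [IsManifold 𝓘(ℂ, C2) ω M]
  {x₀ y : M}

/-- The matrix-valued function `H` with the covector `τ` satisfies the differential system in the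
coordinates at `x₀`. -/
structure IsLocalSolution (D : ComplexLinearConnection M) (x₀ : M)
    (H : M → Matrix (Fin 2) (Fin 2) ℂ) (τ : M → C2) : Prop where
  isHermitian : ∀ y, (H y).IsHermitian
  hermDet_ne : ∀ y, hermDet (H y) ≠ 0
  smooth : ∀ {y}, y ∈ (chartAt C2 x₀).source → ∀ i j,
    ContMDiffAt 𝓘(ℝ, C2) 𝓘(ℝ, ℂ) ∞ (fun x => H x i j) y
  deriv_eq : ∀ {y}, y ∈ (chartAt C2 x₀).source → ∀ i j (v : C2),
    mvfderiv 𝓘(ℝ, C2) (fun x => H x i j) y v =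
      parallelRHS (shiftChristoffel (christoffel D (chartAt C2 x₀) y)
        (thirdDiff (τ y) (christoffelTrace D x₀ y))) (H y) (chartDeriv x₀ y v) i j
      - 2 / 3 * (∑ k, τ y k * chartDeriv x₀ y v k + conj (∑ k, τ y k * chartDeriv x₀ y v k))
        * H y i j

namespace IsLocalSolution

variable {D : ComplexLinearConnection M} {H : M → Matrix (Fin 2) (Fin 2) ℂ} {τ : M → C2}

lemma trace_eq (D : ComplexLinearConnection M) (x₀ y : M) (τ u : C2) :
    ∑ k, (∑ l, shiftChristoffel (christoffel D (chartAt C2 x₀) y)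
      (thirdDiff τ (christoffelTrace D x₀ y)) l l k) * u k = ∑ k, τ k * u k :=
  Finset.sum_congr rfl fun k _ => congrArg (· * u k) (trace_shiftChristoffel _ τ k)

lemma hasDerivAt (h : IsLocalSolution D x₀ H τ) (hy : y ∈ (chartAt C2 x₀).source) (v : C2)
    (i j : Fin 2) :
    HasDerivAt (fun t => H (chartLine x₀ y v t) i j)
      (parallelRHS (shiftChristoffel (christoffel D (chartAt C2 x₀) y)
        (thirdDiff (τ y) (christoffelTrace D x₀ y))) (H (chartLine x₀ y v 0))
          (chartDeriv x₀ y v) i j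
      - 2 / 3 * (∑ k, τ y k * chartDeriv x₀ y v k + conj (∑ k, τ y k * chartDeriv x₀ y v k))
        * H (chartLine x₀ y v 0) i j) 0 := by
  refine (hasDerivAt_chartLine hy ((h.smooth hy i j).mdifferentiableAt (by simp)) v).congr_deriv ?_
  rw [chartLine_zero hy]
  exact h.deriv_eq hy i j v

lemma contMDiffAt_hermDet (h : IsLocalSolution D x₀ H τ) (hy : y ∈ (chartAt C2 x₀).source) :
    ContMDiffAt 𝓘(ℝ, C2) 𝓘(ℝ, ℝ) ∞ (fun x => hermDet (H x)) y :=
  (contDiffAt_hermDet fun i j => H y i j).contMDiffAt.comp y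
    (contMDiffAt_pi_space.2 fun i => contMDiffAt_pi_space.2 fun j => h.smooth hy i j)

lemma contMDiffAt_unscale (h : IsLocalSolution D x₀ H τ) (hy : y ∈ (chartAt C2 x₀).source)
    (i j : Fin 2) : ContMDiffAt 𝓘(ℝ, C2) 𝓘(ℝ, ℂ) ∞ (fun x => unscale (H x) i j) y :=
  (contDiffAt_unscale i j (m := fun i j => H y i j) (h.hermDet_ne y)).contMDiffAt.comp y
    (contMDiffAt_pi_space.2 fun i => contMDiffAt_pi_space.2 fun j => h.smooth hy i j)

lemma mvfderiv_unscale (h : IsLocalSolution D x₀ H τ) (hy : y ∈ (chartAt C2 x₀).source)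
    (i j : Fin 2) (v : C2) :
    mvfderiv 𝓘(ℝ, C2) (fun x => unscale (H x) i j) y v =
      parallelRHS (shiftChristoffel (christoffel D (chartAt C2 x₀) y)
        (thirdDiff (τ y) (christoffelTrace D x₀ y))) (unscale (H y)) (chartDeriv x₀ y v) i j := by
  have h1 := hasDerivAt_chartLine hy
    ((h.contMDiffAt_unscale hy i j).mdifferentiableAt (by simp)) v
  have h2 := hasDerivAt_unscale (trace_eq D x₀ y (τ y) (chartDeriv x₀ y v)) (h.hasDerivAt hy v)
    (.of_forall fun t => h.isHermitian _) (h.hermDet_ne _) i j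
  refine (h1.unique h2).trans ?_
  rw [chartLine_zero hy]

/-- The determinant in the coordinates at `x₀`. -/
def detRep (x₀ : M) (H : M → Matrix (Fin 2) (Fin 2) ℂ) (p : C2) : ℝ :=
  hermDet (H ((chartAt C2 x₀).symm p))

lemma fderiv_detRep (h : IsLocalSolution D x₀ H τ) (hy : y ∈ (chartAt C2 x₀).source) (u : C2) :
    fderiv ℝ (detRep x₀ H) (chartAt C2 x₀ y) u =
      -2 / 3 * (∑ k, τ y k * u k).re * hermDet (H y) := by
  have hu := chartDeriv_coordField hy u
  set v : C2 := asVec (coordField (chartAt C2 x₀) u y)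
  have hd := (h.contMDiffAt_hermDet hy).mdifferentiableAt (by simp)
  have h1 := hasDerivAt_chartLine hy hd v
  have h2 := hasDerivAt_hermDet_of_solution (trace_eq D x₀ y (τ y) (chartDeriv x₀ y v))
    (h.hasDerivAt hy v) (.of_forall fun t => h.isHermitian _)
  have h3 := mvfderiv_eq_chart hy ((mdifferentiableAt_iff_chart hy _).1 hd) v
  have h4 := h3.symm.trans (h1.unique h2)
  rw [chartLine_zero hy] at h4
  have hu' : chartDeriv x₀ y v = u := hu
  rw [hu'] at h4
  exact h4

/-- The determinant equation gives the real part of `τ` on every vector; real and imaginary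
directions together yield `τ_k = -3 ∂ log |det H| / ∂z^k`. -/
lemma tau_eq (h : IsLocalSolution D x₀ H τ) (hy : y ∈ (chartAt C2 x₀).source) (k : Fin 2) :
    τ y k = -3 / 2 * ((fderiv ℝ (detRep x₀ H) (chartAt C2 x₀ y) (Pi.single k 1) : ℝ)
      - Complex.I * (fderiv ℝ (detRep x₀ H) (chartAt C2 x₀ y) (Pi.single k Complex.I) : ℝ))
      * ((hermDet (H y))⁻¹ : ℝ) := by
  have h0 := h.hermDet_ne y
  have e : ∀ c : ℂ, ∑ l, τ y l * (Pi.single k c : C2) l = τ y k * c := fun c => by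
    fin_cases k <;> simp [Fin.sum_univ_two]
  rw [h.fderiv_detRep hy, h.fderiv_detRep hy, e, e]
  apply Complex.ext <;> simp <;> field_simp

/-- No smoothness of the functions `h_i` is assumed; that of `τ` comes from the determinant of the
smooth matrix `H`. -/
lemma contMDiffAt_tau (h : IsLocalSolution D x₀ H τ) (hy : y ∈ (chartAt C2 x₀).source) :
    ContMDiffAt 𝓘(ℝ, C2) 𝓘(ℝ, C2) ∞ τ y := by
  have hsrc := (chartAt C2 x₀).open_source.mem_nhds hy
  have hdet : ContDiffAt ℝ ∞ (detRep x₀ H) (chartAt C2 x₀ y) :=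
    (contMDiffAt_iff_chart hy _).1 (h.contMDiffAt_hermDet hy)
  have hz : ContMDiffAt 𝓘(ℝ, C2) 𝓘(ℝ, C2) ∞ (chartAt C2 x₀) y :=
    contMDiffOn_chart.contMDiffAt hsrc
  have hd : ∀ u : C2, ContDiffAt ℝ ∞ (fun p => (fderiv ℝ (detRep x₀ H) p u : ℂ))
      (chartAt C2 x₀ y) := fun u =>
    Complex.ofRealCLM.contDiff.contDiffAt.comp _
      ((hdet.fderiv_right (m := ∞) (by simp)).clm_apply contDiffAt_const)
  have hinv : ContDiffAt ℝ ∞ (fun p => (((detRep x₀ H p)⁻¹ : ℝ) : ℂ)) (chartAt C2 x₀ y) :=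
    Complex.ofRealCLM.contDiff.contDiffAt.comp _ (hdet.inv (h.hermDet_ne _))
  refine contMDiffAt_pi_space.2 fun k => ?_
  have hf : ContDiffAt ℝ ∞ (fun p => -3 / 2 *
      ((fderiv ℝ (detRep x₀ H) p (Pi.single k 1) : ℂ)
      - Complex.I * (fderiv ℝ (detRep x₀ H) p (Pi.single k Complex.I) : ℂ))
      * (((detRep x₀ H p)⁻¹ : ℝ) : ℂ)) (chartAt C2 x₀ y) :=
    (contDiffAt_const.mul ((hd _).sub (contDiffAt_const.mul (hd _)))).mul hinv
  refine (ContMDiffAt.comp y hf.contMDiffAt hz).congr_of_eventuallyEq ?_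
  filter_upwards [hsrc] with x hx
  rw [h.tau_eq hx k]
  simp only [Function.comp, detRep, (chartAt C2 x₀).left_inv hx]

end IsLocalSolution

end Surface

/-! ### Descent of a solution to a compatible metric -/

section Bundle

variable {M : Type*} [TopologicalSpace M] [ChartedSpace C2 M] [IsManifold 𝓘(ℂ, C2) ω M]
  {F : Type*} [NormedAddCommGroup F] [NormedSpace ℝ F]
  {B : Type*} [TopologicalSpace B] [ChartedSpace F B] [IsManifold 𝓘(ℝ, F) ∞ B]
  {x₀ y : M}

namespace CartanGeometry

variable {C : CartanGeometry M F B} {D : ComplexLinearConnection M} {σ : M → B}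
  {h : B → Matrix (Fin 2) (Fin 2) ℂ} {k : B → Fin 2 → ℂ}

lemma IsAdapted.isLocalSolution [T2Space M] (hσ : C.IsAdapted D x₀ σ)
    (hherm : ∀ b, (h b).IsHermitian) (hdet : ∀ b, hermDet (h b) ≠ 0)
    (hsm : ∀ i j, ContMDiff 𝓘(ℝ, F) 𝓘(ℝ, ℂ) ∞ (fun b => h b i j))
    (hsol : ∀ b, C.SolvesAt h b (k b)) :
    IsLocalSolution D x₀ (fun y => h (σ y)) (fun y => tauOf (h (σ y)) (k (σ y))) where
  isHermitian y := hherm _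
  hermDet_ne y := hdet _
  smooth {y} hy i j := (hsm i j (σ y)).comp y (hσ.contMDiffAt hy)
  deriv_eq {y} hy i j v := by
    have h1 : mvfderiv 𝓘(ℝ, C2) (fun x => h (σ x) i j) y v =
        mvfderiv 𝓘(ℝ, F) (fun b => h b i j) (σ y) (secDeriv (F := F) σ y v) := by
      have := (((hsm i j (σ y)).mdifferentiableAt (by simp)).hasMFDerivAt.comp y
        ((hσ.contMDiffAt hy).mdifferentiableAt (by simp)).hasMFDerivAt).mfderiv
      exact congrArg (fun L : C2 →L[ℝ] ℂ => L v) this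
    -- The base connection is compared with itself here; the given `k` is rewritten as the
    -- contraction of `h` with `τ`.
    rw [h1, hsol (σ y) i j, hσ.theta_secDeriv hy, parallelRHS_shiftChristoffel,
      ← sysRHS_phi (D' := D) (fun _ _ => Iff.rfl) hy _ (hherm _), kappaOf_tauOf (hherm _) (hdet _)]

lemma IsAdapted.pullbackAt_hermForm (hσ : C.IsAdapted D x₀ σ)
    (hy : y ∈ (chartAt C2 x₀).source) {m : Matrix (Fin 2) (Fin 2) ℂ} (hm : m.IsHermitian) :
    C.PullbackAt (fun v w => hermForm m (chartDeriv x₀ y v) (chartDeriv x₀ y w)) (σ y) m := by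
  intro v w
  simp only [hσ.sol_eq hy]
  exact hermForm_eq_sum hm _ _

lemma IsAdapted.eq_hermForm (hσ : C.IsAdapted D x₀ σ) (hy : y ∈ (chartAt C2 x₀).source)
    {m : Matrix (Fin 2) (Fin 2) ℂ} (hm : m.IsHermitian) {β : C2 → C2 → ℝ}
    (hβ : C.PullbackAt β (σ y) m) (v w : C2) :
    β v w = hermForm m (chartDeriv x₀ y v) (chartDeriv x₀ y w) := by
  have h1 := hβ (secDeriv σ y v) (secDeriv σ y w)
  have h2 := hσ.pullbackAt_hermForm hy hm (secDeriv σ y v) (secDeriv σ y w)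
  have h3 := h1.trans h2.symm
  simp only [hσ.projDeriv_secDeriv hy] at h3
  exact_mod_cast h3

theorem IsCartanGeometryOf.exists_metric [T2Space M] (hC : C.IsCartanGeometryOf D)
    (hherm : ∀ b, (h b).IsHermitian)
    (hsm : ∀ i j, ContMDiff 𝓘(ℝ, F) 𝓘(ℝ, ℂ) ∞ (fun b => h b i j))
    (hsys : C.SolvesSystem h k) (hdet : ∀ b, hermDet (h b) ≠ 0) :
    ∃ g : PseudoKahlerMetric M, IsCompatible g D ∧ C.IsPullback g (fun b => unscale (h b)) := by
  have hsol := solvesSystem_iff.1 hsys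
  choose σ hσ using hC.exists_isAdapted
  set m : M → M → Matrix (Fin 2) (Fin 2) ℂ := fun x₀ y => unscale (h (σ x₀ y)) with hm
  have hmherm : ∀ x₀ y, (m x₀ y).IsHermitian := fun x₀ y => unscale_isHermitian (hherm _)
  -- Each tangent space is identified with `ℂ²` by the preferred chart at its own base point, so the
  -- form at `x` uses the section over that chart.
  set β : M → C2 →L[ℝ] C2 →L[ℝ] ℝ := fun x => hermForm (m x x) with hβ
  have hpull : ∀ b, C.PullbackAt (fun v w => β (C.proj b) v w) b (unscale (h b)) := by
    intro b
    have hx := mem_chart_source C2 (C.proj b)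
    obtain ⟨r, hr⟩ := (C.proj_eq_iff (σ (C.proj b) (C.proj b)) b).1 ((hσ _).proj_eq hx)
    obtain ⟨q, hq, rfl⟩ := exists_toP r
    have h1 := ((hσ (C.proj b)).pullbackAt_hermForm hx
      (hmherm (C.proj b) (C.proj b))).transl hq
    simp only [chartDeriv_self] at h1
    -- The law of `h`, integrated from the system, and the intertwining property of `(det h)⁻²` make
    -- the rescaled coefficients at `b` those of one form on the surface.
    have h2 : unscale (h b) = gTransl q (m (C.proj b) (C.proj b)) := by
      conv_lhs => rw [hr, solution_law hsm hsol _ hq]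
      exact rescale_hTransl hq (hherm _)
    rw [← hr, ← h2] at h1
    exact h1
  have hsolσ := fun x₀ => (hσ x₀).isLocalSolution hherm hdet hsm hsol
  have hfam : IsParallelFamily D β m (fun x₀ y =>
      thirdDiff (tauOf (h (σ x₀ y)) (k (σ x₀ y))) (christoffelTrace D x₀ y)) := by
    constructor
    · intro x₀ y hy v w
      have h1 := hpull (σ x₀ y)
      rw [(hσ x₀).proj_eq hy] at h1
      exact (hσ x₀).eq_hermForm hy (hmherm _ _) h1 v w
    · exact fun _ => hmherm _ _
    · exact fun _ => hermDet_unscale_ne (hdet _)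
    · exact fun hy i j => (hsolσ _).contMDiffAt_unscale hy i j
    · intro x₀ y hy
      refine contMDiffAt_pi_space.2 fun k => ?_
      have hc : ContDiff ℝ ∞ (fun c : ℂ => 1 / 3 * c) := contDiff_const.mul contDiff_id
      exact hc.contMDiff.contMDiffAt.comp y ((contMDiffAt_pi_space.1 ((hsolσ x₀).contMDiffAt_tau hy) k).sub
        (contMDiffAt_christoffelTrace D hy k))
    · exact fun hy i j v => (hsolσ _).mvfderiv_unscale hy i j v
  exact ⟨hfam.metric, hfam.isCompatible, isPullback_iff.2 hpull⟩

end CartanGeometry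

end Bundle

end CProj

end

open CProj in
open scoped Manifold ContDiff in
theorem mainTheorem4
    -- a complex surface `M` with a complex projective structure `[∇]`
    {M : Type*} [TopologicalSpace M] [T2Space M] [SecondCountableTopology M]
    [ChartedSpace C2 M] [IsManifold 𝓘(ℂ, C2) ω M]
    (D : ComplexLinearConnection M)
    -- the Cartan geometry `(π : B → M, θ)` of `[∇]`
    {F : Type*} [NormedAddCommGroup F] [NormedSpace ℝ F] [FiniteDimensional ℝ F]
    {B : Type*} [TopologicalSpace B] [T2Space B] [SecondCountableTopology B]
    [ChartedSpace F B] [IsManifold 𝓘(ℝ, F) ∞ B]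
    (C : CartanGeometry M F B) (hC : C.IsCartanGeometryOf D) :
    -- compatible metrics give solutions
    (∀ g : PseudoKahlerMetric M, IsCompatible g D →
      ∃ f : B → Matrix (Fin 2) (Fin 2) ℂ,
        C.IsPullback g f ∧ (∀ f', C.IsPullback g f' → f' = f) ∧
        (∀ b, (f b).IsHermitian ∧ hermDet (f b) ≠ 0) ∧
        (∀ i j, ContMDiff 𝓘(ℝ, F) 𝓘(ℝ, ℂ) ∞ (fun b => f b i j)) ∧
        ∃ k : B → Fin 2 → ℂ,
          (∀ i, ContMDiff 𝓘(ℝ, F) 𝓘(ℝ, ℂ) ∞ (fun b => k b i)) ∧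
          -- `G ^ (-2/3)` for real `G ≠ 0` is the real number `|G| ^ (-2/3)`
          C.SolvesSystem (fun b => ((|hermDet (f b)| ^ (-2 / 3 : ℝ) : ℝ) : ℂ) • f b) k) ∧
    -- nondegenerate hermitian solutions give compatible metrics
    (∀ (h : B → Matrix (Fin 2) (Fin 2) ℂ) (k : B → Fin 2 → ℂ),
      (∀ b, (h b).IsHermitian) →
      (∀ i j, ContMDiff 𝓘(ℝ, F) 𝓘(ℝ, ℂ) ∞ (fun b => h b i j)) →
      C.SolvesSystem h k →
      (∀ b, hermDet (h b) ≠ 0) →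
      ∃ g : PseudoKahlerMetric M, IsCompatible g D ∧
        C.IsPullback g (fun b => ((hermDet (h b) ^ (-2 : ℤ) : ℝ) : ℂ) • h b)) := by
  exact ⟨fun g hg => hC.exists_solution hg,
    fun h k hherm hsm hsys hdet => hC.exists_metric hherm hsm hsys hdet⟩
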